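/- Let $r,p,n$ be positive integers with $p$ dividing $r$. Let $G(r,1,n)=\mathbb{Z}_r\wr S_n$ be the group of pairs $g=(x,\pi)$ with $x\in(\mathbb{Z}_r)^n$, $\pi\in S_n$ and multiplication $(x,\pi)(y,\sigma)=(\sigma^{-1}(x)+y,\pi\sigma)$, where $\pi(x)=(x_{\pi^{-1}(1)},\dots,x_{\pi^{-1}(n)})$. For $g=(x,\pi)$ write $|g|=\pi$, $z_g(i)=x_i$, $\Delta(g)=x_1+\dots+x_n\in\mathbb{Z}_r$ and $g^T=(\pi(x),\pi^{-1})$, and call $g$ symmetric if $g^T=g$. Let $G(r,p,n)$ be the subgroup $\{g\in G(r,1,n):\Delta(g)\in p\mathbb{Z}_r\}$. For $\pi\in S_n$ let $\mathrm{Inv}(\pi)=\{(i,j):1\le i<j\le n,\ \pi(i)>\pi(j)\}$ and $\mathrm{Pair}(\pi)=\{(i,j):1\le i<j\le n,\ \pi(i)=j,\ \pi(j)=i\}$. For $g,\omega\in G(r,1,n)$ let $B(g,\omega)=\varnothing$ if $r$ is odd; if $r$ is even let $B(g,\omega)$ be the set of all $i\in\{1,\dots,n\}$ such that $|\omega|(i)=i$,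 $z_\omega(i)$ is odd, and, for the $k\in\{0,\dots,r/2-1\}$ with $2k+1=z_\omega(i)$, the representative of $z_g(i)+k$ in $\{0,\dots,r-1\}$ is at least $r/2$. Put $$\mathrm{sign}_{r,n}(g,\omega)=(-1)^{|B(g,\omega)|}\,(-1)^{|\mathrm{Inv}(|g|)\cap\mathrm{Pair}(|\omega|)|}.$$ Let $\mathcal{V}_{r,p,n}$ be the rational vector space with basis $\{C_\omega:\omega\in G(r,p,n),\ \omega^T=\omega\}$, and let $\rho_{r,p,n}$ be the representation of $G(r,p,n)$ on $\mathcal{V}_{r,p,n}$ given by $$\rho_{r,p,n}(g)\,C_\omega=\mathrm{sign}_{r,n}(g,\omega)\,C_{g\omega g^T}.$$ (It is the restriction to $G(r,p,n)$ and to $\mathcal{V}_{r,p,n}\subset\mathcal{V}_{r,1,n}$ of the representation $\rho_{r,1,n}$ of $G(r,1,n)$.) **Theorem.** The representation $\rho_{r,p,n}$ is a Gelfand model for $G(r,p,n)$, that is, after extension of scalars from $\mathbb{Q}$ to $\mathbb{C}$ it is equivalent to the direct sum of all irreducible complex representations of $G(r,p,n)$, each taken exactly once up to equivalence, if and only if $\gcd(p,n)=1$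 and at least one of $p$ and $r/p$ is odd. -/

import Mathlib

open scoped TensorProduct

/-! ### The wreath product of `ZMod r` with the symmetric group on `n` letters -/

/-- An element `(x, π)` of the wreath product of the cyclic group `ZMod r` with the symmetric group
on `n` letters; it stands for the `n × n` matrix with entry `ζ ^ x i` in position `(π i, i)` and
zeros elsewhere, `ζ` being a primitive `r`-th root of unity. -/
@[ext]
structure Wreath (r n : ℕ) where
  /-- the exponents, `z_g : [1, n] → ℤ_r` -/
  z : Fin n → ZMod r
  /-- the underlying permutation `|g|` -/
  perm : Equiv.Perm (Fin n)

namespace Wreath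

variable {r n : ℕ}

/-- `(x, π) (y, σ) = (σ⁻¹(x) + y, π σ)`, where `σ⁻¹(x)` has `i`-th coordinate `x (σ i)`. -/
instance : Mul (Wreath r n) where
  mul g h := ⟨fun i => g.z (h.perm i) + h.z i, g.perm * h.perm⟩

instance : One (Wreath r n) where
  one := ⟨0, 1⟩

instance : Inv (Wreath r n) where
  inv g := ⟨fun i => -g.z (g.perm⁻¹ i), g.perm⁻¹⟩

@[simp] theorem mul_z (g h : Wreath r n) (i : Fin n) :
    (g * h).z i = g.z (h.perm i) + h.z i := rfl

@[simp] theorem mul_perm (g h : Wreath r n) : (g * h).perm = g.perm * h.perm := rfl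

@[simp] theorem one_z (i : Fin n) : (1 : Wreath r n).z i = 0 := rfl

@[simp] theorem one_perm : (1 : Wreath r n).perm = 1 := rfl

@[simp] theorem inv_z (g : Wreath r n) (i : Fin n) : g⁻¹.z i = -g.z (g.perm⁻¹ i) := rfl

@[simp] theorem inv_perm (g : Wreath r n) : g⁻¹.perm = g.perm⁻¹ := rfl

instance : Group (Wreath r n) :=
  Group.ofLeftAxioms
    (fun a b c => by
      ext i
      · simp [add_assoc]
      · simp)
    (fun a => by
      ext i
      · simp
      · simp)
    (fun a => by
      ext i
      · simp
      · simp)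

/-- The transpose `g^T = (π(x), π⁻¹)` of `g = (x, π)`; `π(x)` has `i`-th coordinate
`x (π⁻¹ i)`. -/
def transpose (g : Wreath r n) : Wreath r n :=
  ⟨fun i => g.z (g.perm⁻¹ i), g.perm⁻¹⟩

@[simp] theorem transpose_z (g : Wreath r n) (i : Fin n) :
    g.transpose.z i = g.z (g.perm⁻¹ i) := rfl

@[simp] theorem transpose_perm (g : Wreath r n) : g.transpose.perm = g.perm⁻¹ := rfl

theorem transpose_mul (g h : Wreath r n) :
    (g * h).transpose = h.transpose * g.transpose := by
  ext i
  · simp [add_comm]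
  · simp

theorem transpose_transpose (g : Wreath r n) : g.transpose.transpose = g := by
  ext i
  · simp
  · simp

/-- The homomorphism `Δ(x, π) = x_1 + ⋯ + x_n`. -/
def Delta (g : Wreath r n) : ZMod r := ∑ i, g.z i

theorem Delta_mul (g h : Wreath r n) : (g * h).Delta = g.Delta + h.Delta := by
  simp only [Delta, mul_z, Finset.sum_add_distrib]
  rw [Equiv.sum_comp h.perm g.z]

theorem Delta_one : (1 : Wreath r n).Delta = 0 := by simp [Delta]

theorem Delta_inv (g : Wreath r n) : g⁻¹.Delta = -g.Delta := by
  simp only [Delta, inv_z, Finset.sum_neg_distrib]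
  rw [Equiv.sum_comp g.perm⁻¹ g.z]

theorem Delta_transpose (g : Wreath r n) : g.transpose.Delta = g.Delta := by
  simp only [Delta, transpose_z]
  rw [Equiv.sum_comp g.perm⁻¹ g.z]

end Wreath

/-- The complex reflection group `G(r, p, n)`: the elements `g` of the wreath product with
`Δ(g) ∈ p ℤ_r`. -/
def reflectionGroup (r p n : ℕ) : Subgroup (Wreath r n) where
  carrier := {g | g.Delta ∈ AddSubgroup.zmultiples (p : ZMod r)}
  mul_mem' {a b} ha hb := by
    simp only [Set.mem_ofPred_eq] at ha hb ⊢
    rw [Wreath.Delta_mul]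
    exact add_mem ha hb
  one_mem' := by
    simp only [Set.mem_ofPred_eq]
    rw [Wreath.Delta_one]
    exact zero_mem _
  inv_mem' {a} ha := by
    simp only [Set.mem_ofPred_eq] at ha ⊢
    rw [Wreath.Delta_inv]
    exact neg_mem ha

/-! ### The representation on the span of the symmetric elements -/

/-- The symmetric elements of the wreath product. -/
abbrev SymmElt (r n : ℕ) : Type := {w : Wreath r n // w.transpose = w}

/-- `g ω g^T`, as a symmetric element. -/
def SymmElt.conj {r n : ℕ} (g : Wreath r n) (w : SymmElt r n) : SymmElt r n :=
  ⟨g * w.1 * g.transpose, by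
    rw [Wreath.transpose_mul, Wreath.transpose_mul, Wreath.transpose_transpose, w.2, mul_assoc]⟩

/-- `Inv(π) = {(i, j) : i < j, π(i) > π(j)}`. -/
def invSet {n : ℕ} (π : Equiv.Perm (Fin n)) : Finset (Fin n × Fin n) :=
  {q | q.1 < q.2 ∧ π q.2 < π q.1}

/-- `Pair(π) = {(i, j) : i < j, π(i) = j, π(j) = i}`. -/
def pairSet {n : ℕ} (π : Equiv.Perm (Fin n)) : Finset (Fin n × Fin n) :=
  {q | q.1 < q.2 ∧ π q.1 = q.2 ∧ π q.2 = q.1}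

/-- The set `B(g, ω)`: empty if `r` is odd, and if `r` is even the set of the fixed points `i` of
`|ω|` such that `z_ω(i) = 2k + 1` with `k ∈ [0, r/2 - 1]` and the representative in `[0, r - 1]`
of `z_g(i) + k` lies in `[r/2, r - 1]`. -/
def signSet {r n : ℕ} (g w : Wreath r n) : Finset (Fin n) :=
  if Odd r then ∅
  else Finset.univ.filter fun i => w.perm i = i ∧
    ∃ k, k < r / 2 ∧ (w.z i).val = 2 * k + 1 ∧ r / 2 ≤ (g.z i + (k : ZMod r)).val

/-- `sign_{r,n}(g, ω) = (-1)^|B(g, ω)| (-1)^|Inv(|g|) ∩ Pair(|ω|)|`. -/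
def modelSign {r n : ℕ} (g w : Wreath r n) : ℚ :=
  (-1) ^ (signSet g w).card * (-1) ^ (invSet g.perm ∩ pairSet w.perm).card

theorem neg_one_pow_card_invSet_inter {n : ℕ} (g h w : Equiv.Perm (Fin n)) :
    ((-1 : ℚ)) ^ (invSet (g * h) ∩ pairSet w).card =
      (-1) ^ (invSet g ∩ pairSet (h * w * h⁻¹)).card * (-1) ^ (invSet h ∩ pairSet w).card := by
  have key : ∀ (a b : Equiv.Perm (Fin n)), ((-1 : ℚ)) ^ (invSet a ∩ pairSet b).card =
      ∏ q ∈ pairSet b, if a q.2 < a q.1 then (-1 : ℚ) else 1 := by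
    intro a b
    rw [Finset.prod_ite, Finset.prod_const, Finset.prod_const_one, mul_one]
    congr 2
    ext q
    simp only [invSet, pairSet, Finset.mem_inter, Finset.mem_filter, Finset.mem_univ, true_and]
    tauto
  have hre : ∏ q ∈ pairSet (h * w * h⁻¹), (if g q.2 < g q.1 then (-1 : ℚ) else 1) =
      ∏ q ∈ pairSet w, if h q.1 < h q.2
        then (if g (h q.2) < g (h q.1) then (-1 : ℚ) else 1)
        else (if g (h q.1) < g (h q.2) then (-1 : ℚ) else 1) := by
    symm
    refine Finset.prod_nbij'
      (fun q => if h q.1 < h q.2 then (h q.1, h q.2) else (h q.2, h q.1))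
      (fun q => if h⁻¹ q.1 < h⁻¹ q.2 then (h⁻¹ q.1, h⁻¹ q.2) else (h⁻¹ q.2, h⁻¹ q.1))
      ?_ ?_ ?_ ?_ ?_
    · rintro ⟨i, j⟩ hq
      simp only [pairSet, Finset.mem_filter, Finset.mem_univ, true_and] at hq ⊢
      obtain ⟨hij, h1, h2⟩ := hq
      have hne : h i ≠ h j := fun e => hij.ne (h.injective e)
      split_ifs with hlt
      · simp [hlt, h1, h2]
      · simp [lt_of_le_of_ne (not_lt.mp hlt) hne.symm, h1, h2]
    · rintro ⟨i, j⟩ hq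
      simp only [pairSet, Finset.mem_filter, Finset.mem_univ, true_and] at hq ⊢
      simp only [Equiv.Perm.mul_apply] at hq
      obtain ⟨hij, h1, h2⟩ := hq
      have h1' : w (h⁻¹ i) = h⁻¹ j := by rw [← h1]; simp
      have h2' : w (h⁻¹ j) = h⁻¹ i := by rw [← h2]; simp
      have hne : h⁻¹ i ≠ h⁻¹ j := fun e => hij.ne (h⁻¹.injective e)
      split_ifs with hlt
      · exact ⟨hlt, h1', h2'⟩
      · exact ⟨lt_of_le_of_ne (not_lt.mp hlt) hne.symm, h2', h1'⟩
    · rintro ⟨i, j⟩ hq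
      simp only [pairSet, Finset.mem_filter, Finset.mem_univ, true_and] at hq
      by_cases hlt : h i < h j
      · simp [hlt, hq.1]
      · simp [hlt, hq.1.le]
    · rintro ⟨i, j⟩ hq
      simp only [pairSet, Finset.mem_filter, Finset.mem_univ, true_and] at hq
      have e : ∀ x, h (h⁻¹ x) = x := h.apply_symm_apply
      by_cases hlt : h⁻¹ i < h⁻¹ j
      · simp only [if_pos hlt, e, if_pos hq.1]
      · simp only [if_neg hlt, e, if_neg hq.1.not_gt]
    · rintro ⟨i, j⟩ hq
      by_cases hlt : h i < h j
      · simp [hlt]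
      · simp [hlt]
  rw [key, key, key, hre, ← Finset.prod_mul_distrib]
  refine Finset.prod_congr rfl ?_
  rintro ⟨i, j⟩ hq
  simp only [pairSet, Finset.mem_filter, Finset.mem_univ, true_and] at hq
  have hne : h i ≠ h j := fun e => hq.1.ne (h.injective e)
  have hne' : g (h i) ≠ g (h j) := fun e => hne (g.injective e)
  simp only [Equiv.Perm.mul_apply]
  rcases lt_or_gt_of_ne hne with h1 | h1 <;> rcases lt_or_gt_of_ne hne' with h2 | h2 <;>
    simp [h1, h2, h1.not_gt, h2.not_gt]

theorem sign_residue_nat (m A B k k' : ℕ) (hA : A < 2 * m) (hB : B < 2 * m) (hk : k < m)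
    (hk' : k' = (B + k) % m) :
    m ≤ (A + B + k) % (2 * m) ↔
      ¬ (m ≤ (A + k') % (2 * m) ↔ m ≤ (B + k) % (2 * m)) := by
  have hm : 0 < m := by omega
  have hmod : ∀ x : ℕ, x < 6 * m → x % (2 * m) < 2 * m ∧
      (x = x % (2 * m) ∨ x = x % (2 * m) + 2 * m ∨ x = x % (2 * m) + 4 * m) := by
    intro x hx
    refine ⟨Nat.mod_lt _ (by omega), ?_⟩
    rcases lt_or_ge x (2 * m) with h1 | h1
    · rw [Nat.mod_eq_of_lt h1]
      omega
    rcases lt_or_ge x (4 * m) with h2 | h2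
    · rw [Nat.mod_eq_sub_mod h1, Nat.mod_eq_of_lt (by omega)]
      omega
    · rw [Nat.mod_eq_sub_mod h1, Nat.mod_eq_sub_mod (by omega), Nat.mod_eq_of_lt (by omega)]
      omega
  have hk1 : k' < m := hk' ▸ Nat.mod_lt _ hm
  have hk2 : B + k = k' ∨ B + k = k' + m ∨ B + k = k' + 2 * m := by
    rw [hk']
    rcases lt_or_ge (B + k) m with h1 | h1
    · rw [Nat.mod_eq_of_lt h1]
      omega
    rcases lt_or_ge (B + k) (2 * m) with h2 | h2
    · rw [Nat.mod_eq_sub_mod h1, Nat.mod_eq_of_lt (by omega)]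
      omega
    · rw [Nat.mod_eq_sub_mod h1, Nat.mod_eq_sub_mod (by omega), Nat.mod_eq_of_lt (by omega)]
      omega
  have g1 := hmod (A + B + k) (by omega)
  have g2 := hmod (A + k') (by omega)
  have g3 := hmod (B + k) (by omega)
  clear hmod hk'
  generalize (A + B + k) % (2 * m) = x at *
  generalize (A + k') % (2 * m) = y at *
  generalize (B + k) % (2 * m) = z at *
  obtain ⟨g1, g1'⟩ := g1
  obtain ⟨g2, g2'⟩ := g2
  obtain ⟨g3, g3'⟩ := g3
  rcases hk2 with hk2 | hk2 | hk2 <;> rcases g3' with g3' | g3' | g3' <;>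
    first
    | (exfalso; omega)
    | (by_cases h2 : m ≤ y <;> by_cases h3 : m ≤ z <;> simp only [h2, h3, iff_true, iff_false,
        not_true_eq_false, not_false_eq_true] <;> omega)

/-- The arithmetic behind the multiplicativity of `(-1)^|B(g, ω)|`. -/
theorem sign_residue {r : ℕ} [NeZero r] (hr : ¬ Odd r) (a b c : ZMod r) :
    (if ∃ k, k < r / 2 ∧ c.val = 2 * k + 1 ∧ r / 2 ≤ (a + b + (k : ZMod r)).val
      then (-1 : ℚ) else 1) =
    (if ∃ k, k < r / 2 ∧ (b + c + b).val = 2 * k + 1 ∧ r / 2 ≤ (a + (k : ZMod r)).val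
      then (-1 : ℚ) else 1) *
    (if ∃ k, k < r / 2 ∧ c.val = 2 * k + 1 ∧ r / 2 ≤ (b + (k : ZMod r)).val
      then (-1 : ℚ) else 1) := by
  obtain ⟨m, rfl⟩ : ∃ m, r = 2 * m := by
    obtain ⟨m, hm⟩ := Nat.not_odd_iff_even.mp hr
    exact ⟨m, by omega⟩
  have hm : 0 < m := by
    have := NeZero.pos (2 * m)
    omega
  have hdiv : 2 * m / 2 = m := by omega
  have ha := ZMod.val_lt a
  have hb := ZMod.val_lt b
  have hc := ZMod.val_lt c
  have hk : ∀ (x : ZMod (2 * m)) (k : ℕ), k < m →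
      (x + (k : ZMod (2 * m))).val = (x.val + k) % (2 * m) := by
    intro x k hkm
    rw [ZMod.val_add, ZMod.val_natCast, Nat.add_mod_mod]
  have hbcb : (b + c + b).val = (2 * b.val + c.val) % (2 * m) := by
    rw [ZMod.val_add, ZMod.val_add, Nat.mod_add_mod]
    congr 1
    omega
  rw [hdiv, hbcb]
  by_cases hodd : c.val % 2 = 1
  · obtain ⟨k, hck⟩ : ∃ k, c.val = 2 * k + 1 := ⟨c.val / 2, by omega⟩
    have hkm : k < m := by omega
    obtain ⟨k', hk'm, hk', hk''⟩ : ∃ k', k' < m ∧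
        (2 * b.val + c.val) % (2 * m) = 2 * k' + 1 ∧ k' = (b.val + k) % m := by
      refine ⟨(b.val + k) % m, Nat.mod_lt _ hm, ?_, rfl⟩
      rw [hck, show 2 * b.val + (2 * k + 1) = 2 * (b.val + k) + 1 by ring]
      have h1 : 2 * (b.val + k) + 1 = (2 * ((b.val + k) % m) + 1) + 2 * m * ((b.val + k) / m) := by
        have := Nat.mod_add_div (b.val + k) m
        nlinarith
      have h2 := Nat.mod_lt (b.val + k) hm
      rw [h1, Nat.add_mul_mod_self_left, Nat.mod_eq_of_lt (by omega)]
    have e1 : ∀ x : ZMod (2 * m),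
        (∃ l, l < m ∧ c.val = 2 * l + 1 ∧ m ≤ (x + (l : ZMod (2 * m))).val) ↔
        m ≤ (x.val + k) % (2 * m) := by
      intro x
      constructor
      · rintro ⟨l, hl, hcl, hx⟩
        obtain rfl : l = k := by omega
        rwa [hk x l hl] at hx
      · intro hx
        exact ⟨k, hkm, hck, by rwa [hk x k hkm]⟩
    have e2 : (∃ l, l < m ∧ (2 * b.val + c.val) % (2 * m) = 2 * l + 1 ∧
        m ≤ (a + (l : ZMod (2 * m))).val) ↔ m ≤ (a.val + k') % (2 * m) := by
      constructor
      · rintro ⟨l, hl, hcl, hx⟩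
        obtain rfl : l = k' := by omega
        rwa [hk a l hl] at hx
      · intro hx
        exact ⟨k', hk'm, hk', by rwa [hk a k' hk'm]⟩
    have e3 : ((a + b).val + k) % (2 * m) = (a.val + b.val + k) % (2 * m) := by
      rw [ZMod.val_add, Nat.mod_add_mod]
    have e4 := sign_residue_nat m a.val b.val k k' ha hb hkm hk''
    simp only [e1, e2, e3, e4]
    by_cases h1 : m ≤ (a.val + k') % (2 * m) <;> by_cases h2 : m ≤ (b.val + k) % (2 * m) <;>
      simp [h1, h2]
  · have e1 : ∀ x : ZMod (2 * m),
        ¬ (∃ l, l < m ∧ c.val = 2 * l + 1 ∧ m ≤ (x + (l : ZMod (2 * m))).val) := by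
      rintro x ⟨l, -, hl, -⟩
      omega
    have e2 : ¬ (∃ l, l < m ∧ (2 * b.val + c.val) % (2 * m) = 2 * l + 1 ∧
        m ≤ (a + (l : ZMod (2 * m))).val) := by
      rintro ⟨l, -, hl, -⟩
      have h1 := Nat.mod_add_div (2 * b.val + c.val) (2 * m)
      rw [hl, mul_assoc] at h1
      omega
    rw [if_neg (e1 _), if_neg (e1 _), if_neg e2, mul_one]

theorem neg_one_pow_card_signSet {r n : ℕ} [NeZero r] (g h : Wreath r n) (w : SymmElt r n) :
    ((-1 : ℚ)) ^ (signSet (g * h) w.1).card =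
      (-1) ^ (signSet g (w.conj h).1).card * (-1) ^ (signSet h w.1).card := by
  by_cases hr : Odd r
  · simp [signSet, hr]
  have key : ∀ (a b : Wreath r n), ((-1 : ℚ)) ^ (signSet a b).card =
      ∏ i, if b.perm i = i then
        (if ∃ k, k < r / 2 ∧ (b.z i).val = 2 * k + 1 ∧ r / 2 ≤ (a.z i + (k : ZMod r)).val
          then (-1 : ℚ) else 1) else 1 := by
    intro a b
    simp only [signSet, if_neg hr]
    simp only [← ite_and]
    rw [Finset.prod_ite, Finset.prod_const, Finset.prod_const_one, mul_one]
  rw [key, key g (w.conj h).1, key h, ← Equiv.prod_comp h.perm (fun i =>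
    if (w.conj h).1.perm i = i then _ else _), ← Finset.prod_mul_distrib]
  refine Finset.prod_congr rfl fun i _ => ?_
  by_cases hi : w.1.perm i = i
  · have hi' : (w.conj h).1.perm (h.perm i) = h.perm i := by simp [SymmElt.conj, hi]
    have hz : (w.conj h).1.z (h.perm i) = h.z i + w.1.z i + h.z i := by
      simp [SymmElt.conj, hi]
    rw [if_pos hi, if_pos hi', if_pos hi, hz, Wreath.mul_z]
    exact sign_residue hr _ _ _
  · have hi' : (w.conj h).1.perm (h.perm i) ≠ h.perm i := by simp [SymmElt.conj, hi]
    rw [if_neg hi, if_neg hi', if_neg hi, mul_one]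

theorem modelSign_mul {r n : ℕ} [NeZero r] (g h : Wreath r n) (w : SymmElt r n) :
    modelSign (g * h) w.1 = modelSign g (w.conj h).1 * modelSign h w.1 := by
  have h1 := neg_one_pow_card_signSet g h w
  have h2 := neg_one_pow_card_invSet_inter g.perm h.perm w.1.perm
  have h3 : (w.conj h).1.perm = h.perm * w.1.perm * h.perm⁻¹ := rfl
  simp only [modelSign, Wreath.mul_perm]
  rw [h1, h2, h3]
  ring

theorem modelSign_one {r n : ℕ} [NeZero r] (w : Wreath r n) : modelSign 1 w = 1 := by
  have h1 : signSet (1 : Wreath r n) w = ∅ := by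
    unfold signSet
    split_ifs with hr
    · rfl
    · ext i
      simp only [Finset.mem_filter, Finset.mem_univ, true_and, Finset.notMem_empty, iff_false]
      rintro ⟨-, k, hk, -, hk'⟩
      rw [Wreath.one_z, zero_add, ZMod.val_natCast, Nat.mod_eq_of_lt (by omega)] at hk'
      omega
  have h2 : invSet (1 : Equiv.Perm (Fin n)) = ∅ := by
    ext q
    simp only [invSet, Finset.mem_filter, Finset.mem_univ, true_and, Finset.notMem_empty,
      iff_false]
    exact fun hq => hq.1.not_gt hq.2
  simp [modelSign, h1, h2]

theorem SymmElt.conj_one {r n : ℕ} (w : SymmElt r n) : w.conj 1 = w := by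
  apply Subtype.ext
  have : (1 : Wreath r n).transpose = 1 := by
    ext i <;> simp
  simp [SymmElt.conj, this]

theorem SymmElt.conj_mul {r n : ℕ} (g h : Wreath r n) (w : SymmElt r n) :
    w.conj (g * h) = (w.conj h).conj g := by
  apply Subtype.ext
  simp [SymmElt.conj, Wreath.transpose_mul, mul_assoc]

/-- The representation `ρ_{r,n}` of the wreath product on the rational vector space with basis
`C_ω = Finsupp.single ω 1`, `ω` symmetric: `ρ_{r,n}(g) C_ω = sign_{r,n}(g, ω) C_{g ω g^T}`. -/
noncomputable def wreathModel (r n : ℕ) [NeZero r] :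
    Representation ℚ (Wreath r n) (SymmElt r n →₀ ℚ) where
  toFun g := Finsupp.linearCombination ℚ fun w => Finsupp.single (w.conj g) (modelSign g w.1)
  map_one' := by
    ext1 w
    ext1
    simp [modelSign_one, SymmElt.conj_one]
  map_mul' g h := by
    ext1 w
    ext1
    simp [modelSign_mul, SymmElt.conj_mul, mul_comm]

theorem wreathModel_single {r n : ℕ} [NeZero r] (g : Wreath r n) (w : SymmElt r n) :
    wreathModel r n g (Finsupp.single w 1) =
      modelSign g w.1 • Finsupp.single (w.conj g) 1 := by
  simp [wreathModel]

/-- The subspace `V_{r,p,n}` spanned by the `C_ω` with `ω` a symmetric element of `G(r, p, n)`. -/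
noncomputable def symmSpan (r p n : ℕ) : Submodule ℚ (SymmElt r n →₀ ℚ) :=
  Submodule.span ℚ {v | ∃ w : SymmElt r n, w.1 ∈ reflectionGroup r p n ∧ v = Finsupp.single w 1}

theorem symmSpan_le_comap (r p n : ℕ) [NeZero r] (g : reflectionGroup r p n) :
    symmSpan r p n ≤
      (symmSpan r p n).comap ((wreathModel r n).comp (reflectionGroup r p n).subtype g) := by
  refine Submodule.span_le.mpr ?_
  rintro v ⟨w, hw, rfl⟩
  simp only [Submodule.comap_coe, Set.mem_preimage, MonoidHom.coe_comp, Function.comp_apply,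
    Subgroup.coe_subtype, SetLike.mem_coe]
  rw [wreathModel_single]
  refine Submodule.smul_mem _ _ (Submodule.subset_span ⟨_, ?_, rfl⟩)
  refine mul_mem (mul_mem g.2 hw) ?_
  change g.1.transpose.Delta ∈ AddSubgroup.zmultiples (p : ZMod r)
  rw [Wreath.Delta_transpose]
  exact g.2

/-- The rational representation `ρ_{r,p,n}` of `G(r, p, n)` on `V_{r,p,n}`: the restriction of
`ρ_{r,n}` to the subgroup `G(r, p, n)` and the subspace `V_{r,p,n}`. -/
noncomputable def reflectionModel (r p n : ℕ) [NeZero r] :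
    Representation ℚ (reflectionGroup r p n) (symmSpan r p n) :=
  Representation.subrepresentation ((wreathModel r n).comp (reflectionGroup r p n).subtype)
    (symmSpan r p n) (symmSpan_le_comap r p n)

/-! ### Gelfand models -/

/-- Extension of scalars from `ℚ` to `ℂ` of a rational representation. -/
noncomputable def complexification {G V : Type*} [Group G] [AddCommGroup V] [Module ℚ V]
    (ρ : Representation ℚ G V) : Representation ℂ G (ℂ ⊗[ℚ] V) where
  toFun g := (ρ g).baseChange ℂ
  map_one' := by simp
  map_mul' g h := by
    rw [map_mul, Module.End.mul_eq_comp, LinearMap.baseChange_comp, Module.End.mul_eq_comp]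

/-- A complex representation `ρ` of a finite group is a Gelfand model if it is equivalent to a
direct sum of irreducible representations `σ i`, in which each irreducible complex
representation occurs, up to equivalence, for exactly one index `i`. (Irreducible complex
representations of a finite group are finite-dimensional, so `σ i` may live on `Fin (d i) → ℂ`.) -/
def IsGelfandModel {G V : Type*} [Group G] [Finite G] [AddCommGroup V] [Module ℂ V]
    (ρ : Representation ℂ G V) : Prop :=
  ∃ (ι : Type) (d : ι → ℕ) (σ : ∀ i, Representation ℂ G (Fin (d i) → ℂ)),
    (∀ i, (σ i).IsIrreducible) ∧
    (∀ (U : Type) [AddCommGroup U] [Module ℂ U] (τ : Representation ℂ G U),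
      τ.IsIrreducible → ∃! i, Nonempty (τ.Equiv (σ i))) ∧
    Nonempty (ρ.Equiv (Representation.directSum σ))

instance {r n : ℕ} [NeZero r] : Finite (Wreath r n) :=
  Finite.of_injective (fun g => (g.z, g.perm)) fun a b h => by
    simp only [Prod.mk.injEq] at h
    exact Wreath.ext h.1 h.2

/-!
Write `G` for the full wreath product, `H = G(r, p, n)`, `M = p ℤ_r` and `V_p` for the model of `H`,
spanned by the `C_w` with `Δ(w) ∈ M`. By semisimplicity a representation is a Gelfand model if and
only if each irreducible representation has multiplicity one in it
(`isGelfandModel_of_finrank_eq_one`), and a Gelfand model is faithful and admits at least two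
independent maps from any reducible representation.

*The full group.* Let `bar (x, π) = (-x, π)`, the inverse of the transpose. The basis elements `C_w`
fixed up to sign by `g` are the `w` with `w * bar w = 1` and `g * w = w * bar g`; that is, `w` is an
antilinear involution commuting with `g`. The involution `|w|` permutes the cycles of `|g|`. Those
`w` that map to itself some cycle on which `g` has even period cancel in pairs in the character of
the model (`sum_modelSign_of_min_eq`). The remaining ones have sign `1`, and multiplying them by
suitable powers of `g` on the cycles turns them into the solutions of `f * bar f = g`. So the
character at `g` is the number of these solutions (`sum_modelSign`). Its scalar product with an
irreducible character `χ` is therefore the mean of `χ (f^T * f⁻¹)`, the Frobenius–Schur indicator of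
`χ` twisted by the transpose. As every element is conjugate to its transpose, this is `1` or `-1`,
and being a multiplicity it is `1` (`sum_character_wreathModel_mul`). Twisting `χ` by the characters
of `Δ` shows that the sum over each fibre of `Δ` over a nonzero residue vanishes.

*The subgroup.* For `χ` irreducible on `G`, let `A j` be the sum over `h ∈ H` of `χ (h⁻¹)` times the
part of the character coming from the `w` with `Δ(w) = j`. Then `∑ j, A j = |G|`, the multiplicity
of `χ|_H` in `V_p` is `|H|⁻¹ ∑ j ∈ M, A j`, and `A (j + 2 * t) = A j` by conjugation in `G`. For `p`
odd this makes the multiplicity `1`. For `p` even, suppose that the scalar matrix `-1` is not in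
`H`; it acts on `C_w` by the parity of `Δ(w)`, so the vanishing over its coset gives
`∑ j, (-1) ^ j * A j = 0`. Thus `A` is constant, and again the multiplicity is `1`
(`finrank_intertwiningMap_reflectionModel`).

*Necessity.* If `p` is even and `-1 ∈ H`, then `-1` acts trivially on `V_p`, which is then not
faithful. Otherwise the multiplicities above are `1`, and `-1 ∉ H` excludes that `p` and `r / p` are
both even. If a prime `q` divides `p` and `n`, the representation of `G` on the functions of the
rearrangements of the word `(0, s, 2 * s, …)`, `s = r / q`, is irreducible but becomes reducible on
`H`, because translation of the words by `s` commutes with `H`; so there would be at least two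
independent maps from it to a Gelfand model.

*Sufficiency.* If `p` is prime to `n`, then `G` is the product of its centre and `H`, so the
irreducible representations of `H` are the restrictions of those of `G`. If in addition `p` or
`r / p` is odd, then `p` is odd or `-1 ∉ H`, and all multiplicities are `1`.
-/

/-! ### Representations of finite groups -/

namespace Representation

open Module

section Hom

variable {G U V W : Type*} [Group G] [AddCommGroup U] [Module ℂ U] [AddCommGroup V] [Module ℂ V]
  [AddCommGroup W] [Module ℂ W]

theorem isIrreducible_iff (ρ : Representation ℂ G V) : ρ.IsIrreducible ↔
    Nontrivial V ∧ ∀ S : Submodule ℂ V, (∀ g, ∀ v ∈ S, ρ g v ∈ S) → S = ⊥ ∨ S = ⊤ := by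
  constructor
  · intro h
    have h0 : (⊥ : Subrepresentation ρ) ≠ ⊤ := bot_ne_top
    refine ⟨?_, fun S hS => ?_⟩
    · by_contra hV
      rw [not_nontrivial_iff_subsingleton] at hV
      exact h0 (Subrepresentation.toSubmodule_injective (Subsingleton.elim _ _))
    · rcases eq_bot_or_eq_top (⟨S, fun g v hv => hS g v hv⟩ : Subrepresentation ρ) with h1 | h1
      · exact .inl (congrArg Subrepresentation.toSubmodule h1)
      · exact .inr (congrArg Subrepresentation.toSubmodule h1)
  · rintro ⟨hV, h⟩
    refine { exists_pair_ne := ⟨⊥, ⊤, fun e => ?_⟩, eq_bot_or_eq_top := fun S => ?_ }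
    · exact bot_ne_top (α := Submodule ℂ V) (congrArg Subrepresentation.toSubmodule e)
    · rcases h S.toSubmodule (fun g v hv => S.apply_mem_toSubmodule g hv) with h1 | h1
      · exact .inl (Subrepresentation.toSubmodule_injective h1)
      · exact .inr (Subrepresentation.toSubmodule_injective h1)

theorem exists_equiv_coordinates [FiniteDimensional ℂ V] (τ : Representation ℂ G V) :
    ∃ (m : ℕ) (τ' : Representation ℂ G (Fin m → ℂ)), Nonempty (τ.Equiv τ') := by
  let f := (finBasis ℂ V).equivFun
  refine ⟨_, ((f.conjAlgEquiv ℂ).toAlgHom : _ →* _).comp τ,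
    ⟨Representation.Equiv.mk f fun g => LinearMap.ext fun v => ?_⟩⟩
  simp [LinearEquiv.conjAlgEquiv]

theorem IsIrreducible.of_equiv {ρ : Representation ℂ G V} {σ : Representation ℂ G W}
    (e : ρ.Equiv σ) (h : ρ.IsIrreducible) : σ.IsIrreducible := by
  rw [isIrreducible_iff] at h ⊢
  obtain ⟨hV, h⟩ := h
  refine ⟨e.toLinearEquiv.injective.nontrivial, fun S hS => ?_⟩
  have := h (S.comap e.toLinearEquiv.toLinearMap) fun g v hv => by
    have h2 : e (ρ g v) = σ g (e v) := e.toIntertwiningMap.isIntertwining ρ σ g v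
    change e (ρ g v) ∈ S
    rw [h2]
    exact hS g _ hv
  have hmap := S.map_comap_eq_of_surjective (f := e.toLinearEquiv.toLinearMap)
    e.toLinearEquiv.surjective
  rcases this with h1 | h1
  · left
    rw [← hmap, h1, Submodule.map_bot]
  · right
    rw [← hmap, h1, Submodule.map_top, LinearEquiv.range]

theorem finrank_intertwiningMap_congr {τ : Representation ℂ G V} {σ : Representation ℂ G W}
    (e : τ.Equiv σ) (ρ : Representation ℂ G U) :
    finrank ℂ (IntertwiningMap τ ρ) = finrank ℂ (IntertwiningMap σ ρ) :=
  LinearEquiv.finrank_eq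
    { toFun := fun q => q.comp e.symm.toIntertwiningMap
      invFun := fun q => q.comp e.toIntertwiningMap
      map_add' := fun _ _ => rfl
      map_smul' := fun _ _ => rfl
      left_inv := fun q => IntertwiningMap.ext (LinearMap.ext fun v =>
        congrArg q (e.symm_apply_apply v))
      right_inv := fun q => IntertwiningMap.ext (LinearMap.ext fun v =>
        congrArg q (e.apply_symm_apply v)) }

/-- An irreducible representation of a finite group is spanned by the orbit of a vector. -/
theorem IsIrreducible.finiteDimensional [Finite G] {ρ : Representation ℂ G V}
    (h : ρ.IsIrreducible) : FiniteDimensional ℂ V := by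
  rw [isIrreducible_iff] at h
  obtain ⟨hV, h⟩ := h
  obtain ⟨v, hv⟩ := exists_ne (0 : V)
  have hfin : (Set.range fun g => ρ g v).Finite := Set.finite_range _
  rcases h (Submodule.span ℂ (Set.range fun g => ρ g v)) (by
    intro g w hw
    refine (Submodule.span_le.mpr ?_ : _ ≤ (Submodule.span ℂ _).comap (ρ g)) hw
    rintro _ ⟨k, rfl⟩
    refine Submodule.subset_span ⟨g * k, ?_⟩
    simp) with h1 | h1
  · exfalso
    rw [Submodule.span_eq_bot] at h1
    exact hv (by simpa using h1 _ ⟨1, rfl⟩)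
  · exact ⟨⟨hfin.toFinset, by simpa using h1⟩⟩

/-- Maschke's theorem: a finite-dimensional representation of a finite group is a finite direct
sum of irreducible ones. -/
theorem exists_equiv_directSum [Finite G] [FiniteDimensional ℂ V] (ρ : Representation ℂ G V) :
    ∃ (k : ℕ) (d : Fin k → ℕ) (σ : ∀ i, Representation ℂ G (Fin (d i) → ℂ)),
      (∀ i, (σ i).IsIrreducible) ∧ Nonempty (ρ.Equiv (directSum σ)) := by
  classical
  have : NeZero (Nat.card G : ℂ) := ⟨Nat.cast_ne_zero.mpr Nat.card_pos.ne'⟩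
  have : FiniteDimensional ℂ ρ.asModule := inferInstanceAs (FiniteDimensional ℂ V)
  have : Module.Finite (MonoidAlgebra ℂ G) ρ.asModule :=
    Module.Finite.of_restrictScalars_finite ℂ _ _
  obtain ⟨k, S, e, hS⟩ :=
    IsSemisimpleModule.exists_linearEquiv_fin_dfinsupp (MonoidAlgebra ℂ G) ρ.asModule
  have hfin : ∀ i, FiniteDimensional ℂ (S i) := fun i =>
    inferInstanceAs (FiniteDimensional ℂ ((S i).restrictScalars ℂ))
  let f : ∀ i, S i ≃ₗ[ℂ] (Fin (finrank ℂ (S i)) → ℂ) := fun i => (finBasis ℂ (S i)).equivFun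
  let σ : ∀ i, Representation ℂ G (Fin (finrank ℂ (S i)) → ℂ) := fun i =>
    (((f i).conjAlgEquiv ℂ).toAlgHom.comp
      (Algebra.lsmul ℂ ℂ (S i) : MonoidAlgebra ℂ G →ₐ[ℂ] _)).toMonoidHom.comp
        (MonoidAlgebra.of ℂ G)
  have hσ : ∀ i g x, σ i g (f i x) = f i (MonoidAlgebra.of ℂ G g • x) := by
    intro i g x
    simp [σ, LinearEquiv.conjAlgEquiv]
  refine ⟨k, fun i => finrank ℂ (S i), σ, fun i => ?_, ⟨?_⟩⟩
  · rw [isIrreducible_iff]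
    have := (hS i)
    have hnt : Nontrivial (S i) := IsSimpleModule.nontrivial (MonoidAlgebra ℂ G) (S i)
    refine ⟨(f i).injective.nontrivial, fun T hT => ?_⟩
    let N : Submodule (MonoidAlgebra ℂ G) (S i) :=
      { (T.comap (f i).toLinearMap) with
        smul_mem' := by
          intro c x hx
          induction c using MonoidAlgebra.induction_linear with
          | zero => simp
          | add a b ha hb =>
            rw [add_smul]
            exact Submodule.add_mem (T.comap (f i).toLinearMap) ha hb
          | single g a =>
            have h1 : (MonoidAlgebra.single g a : MonoidAlgebra ℂ G) • x =
              a • (MonoidAlgebra.of ℂ G g • x) := by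
              rw [← smul_assoc]; simp
            rw [h1]
            refine Submodule.smul_mem (T.comap (f i).toLinearMap) a ?_
            have := hT g _ hx
            erw [hσ] at this
            exact this }
    have hmap := T.map_comap_eq_of_surjective (f := (f i).toLinearMap) (f i).surjective
    have hN : ∀ x, x ∈ N ↔ x ∈ T.comap (f i).toLinearMap := fun x => Iff.rfl
    rcases eq_bot_or_eq_top N with h1 | h1
    · left
      have : T.comap (f i).toLinearMap = ⊥ := by
        ext x; rw [← hN, h1]; simp
      rw [← hmap, this, Submodule.map_bot]
    · right
      have : T.comap (f i).toLinearMap = ⊤ := by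
        ext x; rw [← hN, h1]; simp
      rw [← hmap, this, Submodule.map_top, LinearEquiv.range]
  · refine Representation.Equiv.mk
      ((e.restrictScalars ℂ).trans (DFinsupp.mapRange.linearEquiv f) : V ≃ₗ[ℂ] _) fun g => ?_
    refine LinearMap.ext fun v => DFinsupp.ext fun i => ?_
    change f i ((e (ρ g v)) i) = σ i g (f i (e v i))
    have h1 : e (ρ g v) = MonoidAlgebra.of ℂ G g • e v :=
      (congrArg e ((single_smul ρ 1 g v).trans (one_smul ℂ _)).symm).trans
        (e.map_smul (MonoidAlgebra.of ℂ G g) v)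
    rw [h1, hσ]
    rfl

/-- The inclusion of a summand of a direct sum of representations. -/
def directSumInclusion {ι : Type*} [DecidableEq ι] {V : ι → Type*} [∀ i, AddCommGroup (V i)]
    [∀ i, Module ℂ (V i)] (σ : ∀ i, Representation ℂ G (V i)) (i : ι) :
    IntertwiningMap (σ i) (directSum σ) :=
  ⟨DirectSum.lof ℂ ι V i, fun g => by
    ext v : 1
    simp [directSum]⟩

/-- The projection of a direct sum of representations to a summand. -/
def directSumProjection {ι : Type*} {V : ι → Type*} [∀ i, AddCommGroup (V i)]
    [∀ i, Module ℂ (V i)] (σ : ∀ i, Representation ℂ G (V i)) (i : ι) :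
    IntertwiningMap (directSum σ) (σ i) :=
  ⟨DirectSum.component ℂ ι V i, fun g => by
    ext v : 1
    rfl⟩

theorem directSumProjection_inclusion_same {ι : Type*} [DecidableEq ι] {V : ι → Type*}
    [∀ i, AddCommGroup (V i)] [∀ i, Module ℂ (V i)] (σ : ∀ i, Representation ℂ G (V i)) (i : ι)
    (v : V i) : directSumProjection σ i (directSumInclusion σ i v) = v :=
  DirectSum.component.lof_self ℂ i v

theorem directSumProjection_inclusion_of_ne {ι : Type*} [DecidableEq ι] {V : ι → Type*}
    [∀ i, AddCommGroup (V i)] [∀ i, Module ℂ (V i)] (σ : ∀ i, Representation ℂ G (V i)) {i j : ι}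
    (h : i ≠ j) (v : V i) : directSumProjection σ j (directSumInclusion σ i v) = 0 :=
  (DirectSum.component.of ℂ j i v).trans (dif_neg h)

theorem two_le_finrank_of_independent {X Y : Type*} [AddCommGroup X] [Module ℂ X]
    [AddCommGroup Y] [Module ℂ Y] [FiniteDimensional ℂ X] [FiniteDimensional ℂ Y]
    {ρ : Representation ℂ G X} {σ : Representation ℂ G Y} (f g : IntertwiningMap ρ σ)
    (h : ∀ a b : ℂ, a • f + b • g = 0 → a = 0 ∧ b = 0) :
    2 ≤ finrank ℂ (IntertwiningMap ρ σ) := by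
  have hli : LinearIndependent ℂ ![f, g] := LinearIndependent.pair_iff.mpr h
  simpa using hli.fintype_card_le_finrank

/-- The regular representation on the functions on `G`, with `G` acting by right translation. -/
def regularRep (G : Type*) [Group G] : Representation ℂ G (G → ℂ) where
  toFun g := LinearMap.funLeft ℂ ℂ fun x => x * g
  map_one' := by ext; simp
  map_mul' g h := by ext; simp [LinearMap.funLeft_apply, mul_assoc]

theorem regularRep_apply (g : G) (f : G → ℂ) (x : G) : regularRep G g f x = f (x * g) := rfl

end Hom

end Representation

/-! ### Multiplicities in Gelfand models -/

section Gelfand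

open Module Representation

variable {G V : Type} [Group G] [Finite G] [AddCommGroup V] [Module ℂ V]

/-- Multiplicity one characterizes Gelfand models; by `exists_equiv_coordinates` it suffices to test
it on representations on coordinate spaces. -/
theorem isGelfandModel_of_finrank_eq_one [FiniteDimensional ℂ V] (ρ : Representation ℂ G V)
    (h : ∀ (m : ℕ) (τ : Representation ℂ G (Fin m → ℂ)), τ.IsIrreducible →
      finrank ℂ (IntertwiningMap τ ρ) = 1) : IsGelfandModel ρ := by
  classical
  obtain ⟨k, d, σ, hσ, ⟨e⟩⟩ := exists_equiv_directSum ρ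
  refine ⟨Fin k, d, σ, hσ, ?_, ⟨e⟩⟩
  intro U _ _ τ hτ
  have := hτ.finiteDimensional
  -- it is enough to treat representations on coordinate spaces
  obtain ⟨m, τ', ⟨e'⟩⟩ := exists_equiv_coordinates τ
  have hτ' : τ'.IsIrreducible := hτ.of_equiv e'
  have h1 := h m τ' hτ'
  obtain ⟨f, hf⟩ : ∃ f : IntertwiningMap τ' ρ, f ≠ 0 := by
    by_contra! hall
    have : Subsingleton (IntertwiningMap τ' ρ) := ⟨fun a b => by rw [hall a, hall b]⟩
    rw [finrank_zero_of_subsingleton] at h1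
    exact zero_ne_one h1
  obtain ⟨v, hv⟩ : ∃ v, f v ≠ 0 := by
    by_contra! hall
    exact hf (IntertwiningMap.ext (LinearMap.ext hall))
  have hev : e (f v) ≠ 0 := fun h0 => hv (by
    rw [← e.symm_apply_apply (f v), h0, map_zero])
  obtain ⟨i, hi⟩ : ∃ i, directSumProjection σ i (e (f v)) ≠ 0 := by
    by_contra! hall
    exact hev (DFinsupp.ext hall)
  have hiso : ∀ (i : Fin k) (q : IntertwiningMap τ' (σ i)), q ≠ 0 → Nonempty (τ'.Equiv (σ i)) := by
    intro i q hq
    have := hτ'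
    have := hσ i
    rcases IsIrreducible.bijective_or_eq_zero q with hb | hb
    · exact ⟨q.ofBijective hb⟩
    · exact absurd hb hq
  obtain ⟨ψ⟩ := hiso i (((directSumProjection σ i).comp e.toIntertwiningMap).comp f) fun h0 => by
    have := congrArg (fun q : IntertwiningMap τ' (σ i) => q v) h0
    exact hi this
  refine ⟨i, ⟨e'.trans ψ⟩, ?_⟩
  rintro j ⟨φ'⟩
  by_contra hij
  let φ : τ'.Equiv (σ j) := e'.symm.trans φ'
  let a : IntertwiningMap τ' ρ := e.symm.toIntertwiningMap.comp
    ((directSumInclusion σ i).comp ψ.toIntertwiningMap)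
  let b : IntertwiningMap τ' ρ := e.symm.toIntertwiningMap.comp
    ((directSumInclusion σ j).comp φ.toIntertwiningMap)
  have ha : ∀ v, e (a v) = directSumInclusion σ i (ψ v) := fun v => e.apply_symm_apply _
  have hb : ∀ v, e (b v) = directSumInclusion σ j (φ v) := fun v => e.apply_symm_apply _
  obtain ⟨w, hw⟩ := @exists_ne _ ((isIrreducible_iff _).mp hτ').1 0
  have h2 : 2 ≤ finrank ℂ (IntertwiningMap τ' ρ) :=
    two_le_finrank_of_independent a b fun s t hst => by
      have h3 : s • a w + t • b w = 0 :=
        congrArg (fun q : IntertwiningMap τ' ρ => q w) hst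
      have h4 : s • directSumInclusion σ i (ψ w) + t • directSumInclusion σ j (φ w) = 0 := by
        rw [← ha, ← hb, ← map_smul e, ← map_smul e, ← map_add e, h3, map_zero]
      constructor
      · have := congrArg (directSumProjection σ i) h4
        rw [map_add, map_smul, map_smul, directSumProjection_inclusion_same,
          directSumProjection_inclusion_of_ne _ hij, smul_zero, add_zero, map_zero,
          smul_eq_zero] at this
        exact this.resolve_right fun h0 => hw (by rw [← ψ.symm_apply_apply w, h0, map_zero])
      · have := congrArg (directSumProjection σ j) h4
        rw [map_add, map_smul, map_smul, directSumProjection_inclusion_same,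
          directSumProjection_inclusion_of_ne _ (Ne.symm hij), smul_zero, zero_add, map_zero,
          smul_eq_zero] at this
        exact this.resolve_right fun h0 => hw (by rw [← φ.symm_apply_apply w, h0, map_zero])
  omega

theorem IsGelfandModel.exists_injective {ρ : Representation ℂ G V} (h : IsGelfandModel ρ)
    {U : Type} [AddCommGroup U] [Module ℂ U] {τ : Representation ℂ G U} (hτ : τ.IsIrreducible) :
    ∃ f : IntertwiningMap τ ρ, Function.Injective f := by
  classical
  obtain ⟨ι, d, σ, hσ, hu, ⟨e⟩⟩ := h
  obtain ⟨i, ⟨ψ⟩, -⟩ := hu U τ hτ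
  refine ⟨e.symm.toIntertwiningMap.comp ((directSumInclusion σ i).comp ψ.toIntertwiningMap), ?_⟩
  intro x y hxy
  have h1 : directSumInclusion σ i (ψ x) = directSumInclusion σ i (ψ y) :=
    e.symm.toLinearEquiv.injective hxy
  have h2 := congrArg (directSumProjection σ i) h1
  rw [directSumProjection_inclusion_same, directSumProjection_inclusion_same] at h2
  exact ψ.toLinearEquiv.injective h2

/-- A Gelfand model is faithful, since the regular representation is. -/
theorem IsGelfandModel.eq_one_of_apply_eq_one {ρ : Representation ℂ G V} (h : IsGelfandModel ρ)
    {g : G} (hg : ρ g = 1) : g = 1 := by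
  classical
  obtain ⟨k, d, σ, hσ, ⟨e⟩⟩ := exists_equiv_directSum (regularRep G)
  have h1 : ∀ i v, σ i g v = v := by
    intro i v
    obtain ⟨f, hf⟩ := h.exists_injective (hσ i)
    apply hf
    rw [f.isIntertwining, hg]
    rfl
  have h2 : regularRep G g (Pi.single 1 1) = Pi.single 1 1 := by
    apply e.toLinearEquiv.injective
    refine DFinsupp.ext fun i => ?_
    have h3 := e.toIntertwiningMap.isIntertwining _ _ g (Pi.single 1 1)
    exact (congrArg (directSumProjection σ i) h3).trans (h1 i _)
  have h3 := congrFun h2 1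
  rw [regularRep_apply, one_mul, Pi.single_eq_same] at h3
  by_contra hne
  rw [Pi.single_eq_of_ne hne] at h3
  exact zero_ne_one h3

/-- A reducible representation of `G` has at least two independent maps to a Gelfand model. -/
theorem IsGelfandModel.two_le_finrank [FiniteDimensional ℂ V] {ρ : Representation ℂ G V}
    (h : IsGelfandModel ρ) {W : Type} [AddCommGroup W] [Module ℂ W] [FiniteDimensional ℂ W]
    [Nontrivial W] {τ : Representation ℂ G W} (hτ : ¬ τ.IsIrreducible) :
    2 ≤ finrank ℂ (IntertwiningMap τ ρ) := by
  classical
  obtain ⟨k, d, σ, hσ, ⟨e⟩⟩ := exists_equiv_directSum τ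
  obtain ⟨v, hv⟩ := exists_ne (0 : W)
  obtain ⟨i, j, hij⟩ : ∃ i j : Fin k, i ≠ j := by
    by_contra! hall
    obtain ⟨i, hi⟩ : ∃ i, directSumProjection σ i (e v) ≠ 0 := by
      by_contra! hall
      refine hv ?_
      rw [← e.symm_apply_apply v, show e v = 0 from DFinsupp.ext hall, map_zero]
    refine hτ (IsIrreducible.of_equiv (Representation.Equiv.symm
      (((directSumProjection σ i).comp e.toIntertwiningMap).ofBijective ⟨?_, ?_⟩)) (hσ i))
    · intro x y hxy
      apply e.toLinearEquiv.injective
      refine DFinsupp.ext fun j => ?_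
      rw [hall j i]
      exact hxy
    · intro y
      refine ⟨e.symm (directSumInclusion σ i y), ?_⟩
      change directSumProjection σ i (e (e.symm _)) = y
      rw [e.apply_symm_apply, directSumProjection_inclusion_same]
  obtain ⟨f, hf⟩ := h.exists_injective (hσ i)
  obtain ⟨g, hg⟩ := h.exists_injective (hσ j)
  obtain ⟨x, hx⟩ := @exists_ne _ ((isIrreducible_iff _).mp (hσ i)).1 0
  obtain ⟨y, hy⟩ := @exists_ne _ ((isIrreducible_iff _).mp (hσ j)).1 0
  refine two_le_finrank_of_independent
    (f.comp ((directSumProjection σ i).comp e.toIntertwiningMap))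
    (g.comp ((directSumProjection σ j).comp e.toIntertwiningMap)) fun s t hst => ?_
  have key : ∀ w, s • f (directSumProjection σ i w) + t • g (directSumProjection σ j w) = 0 := by
    intro w
    have := congrArg (fun q : IntertwiningMap τ ρ => q (e.symm w)) hst
    change s • f (directSumProjection σ i (e (e.symm w))) +
      t • g (directSumProjection σ j (e (e.symm w))) = 0 at this
    rwa [e.apply_symm_apply] at this
  constructor
  · have := key (directSumInclusion σ i x)
    rw [directSumProjection_inclusion_same, directSumProjection_inclusion_of_ne _ hij, map_zero,
      smul_zero, add_zero, smul_eq_zero] at this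
    exact this.resolve_right fun h0 => hx (hf (h0.trans (map_zero f).symm))
  · have := key (directSumInclusion σ j y)
    rw [directSumProjection_inclusion_same, directSumProjection_inclusion_of_ne _ hij.symm,
      map_zero, smul_zero, zero_add, smul_eq_zero] at this
    exact this.resolve_right fun h0 => hy (hg (h0.trans (map_zero g).symm))

end Gelfand

/-! ### Characters, twists and restriction to subgroups -/

namespace Representation

open Module

section Characters

variable {G V W : Type*} [Group G] [AddCommGroup V] [Module ℂ V] [AddCommGroup W] [Module ℂ W]

theorem sum_character_mul_character_inv [Fintype G] [FiniteDimensional ℂ V]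
    [FiniteDimensional ℂ W] (σ : Representation ℂ G W) (ρ : Representation ℂ G V) :
    ∑ g, ρ.character g * σ.character g⁻¹ =
      (Fintype.card G : ℂ) * finrank ℂ (IntertwiningMap σ ρ) := by
  have h0 : (Nat.card G : ℂ) ≠ 0 := Nat.cast_ne_zero.mpr Nat.card_pos.ne'
  have : Invertible (Nat.card G : ℂ) := invertibleOfNonzero h0
  rw [← card_inv_mul_sum_char_mul_char_eq_finrank, ← Nat.card_eq_fintype_card,
    mul_inv_cancel_left₀ h0]

theorem exists_ne_zero_of_finrank_ne_zero {σ : Representation ℂ G W} {ρ : Representation ℂ G V}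
    (h : finrank ℂ (IntertwiningMap σ ρ) ≠ 0) : ∃ f : IntertwiningMap σ ρ, f ≠ 0 := by
  by_contra! hall
  have : Subsingleton (IntertwiningMap σ ρ) := ⟨fun a b => by rw [hall a, hall b]⟩
  exact h finrank_zero_of_subsingleton

theorem IsIrreducible.exists_eq_smul [Finite G] {ρ : Representation ℂ G V} (hρ : ρ.IsIrreducible)
    (f : IntertwiningMap ρ ρ) : ∃ c : ℂ, ∀ v, f v = c • v := by
  have := hρ.finiteDimensional
  obtain ⟨c, hc⟩ := (IsIrreducible.algebraMap_intertwiningMap_bijective_of_isAlgClosed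
    (ρ := ρ)).2 f
  exact ⟨c, fun v => by rw [← hc]; rfl⟩

/-- The twist of a representation by a linear character. -/
def twist (ρ : Representation ℂ G V) (χ : G →* ℂ) : Representation ℂ G V where
  toFun g := χ g • ρ g
  map_one' := by simp
  map_mul' g h := by rw [map_mul, map_mul, smul_mul_smul_comm]

theorem twist_apply (ρ : Representation ℂ G V) (χ : G →* ℂ) (g : G) (v : V) :
    ρ.twist χ g v = χ g • ρ g v := rfl

theorem character_twist (ρ : Representation ℂ G V) (χ : G →* ℂ) (g : G) :
    (ρ.twist χ).character g = χ g * ρ.character g := by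
  simp [character, twist]

theorem IsIrreducible.twist {ρ : Representation ℂ G V} (h : ρ.IsIrreducible) (χ : G →* ℂ) :
    (ρ.twist χ).IsIrreducible := by
  rw [isIrreducible_iff] at h ⊢
  refine ⟨h.1, fun S hS => h.2 S fun g v hv => ?_⟩
  have h1 := S.smul_mem (χ g⁻¹) (hS g v hv)
  rwa [twist_apply, smul_smul, ← map_mul, inv_mul_cancel, map_one, one_smul] at h1

/-- If the centre of `G` and `H` together generate `G`, then restriction to `H` preserves
irreducibility, the centre acting by scalars. -/
theorem IsIrreducible.comp_subtype {ρ : Representation ℂ G V} [Finite G] (h : ρ.IsIrreducible)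
    (H : Subgroup G) (hH : ∀ g : G, ∃ z ∈ Subgroup.center G, z * g ∈ H) :
    IsIrreducible (ρ.comp H.subtype) := by
  have h' := h
  rw [isIrreducible_iff] at h ⊢
  refine ⟨h.1, fun S hS => h.2 S fun g v hv => ?_⟩
  obtain ⟨z, hz, hzg⟩ := hH g
  have hz' : z⁻¹ ∈ Submonoid.center G := (Subgroup.center G).inv_mem hz
  obtain ⟨c, hc⟩ := h'.exists_eq_smul (IntertwiningMap.centralMul ρ z⁻¹ hz')
  have h1 : ρ g v = ρ z⁻¹ (ρ (z * g) v) := by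
    rw [← Module.End.mul_apply, ← map_mul, inv_mul_cancel_left]
  have h2 : ρ z⁻¹ (ρ (z * g) v) = c • ρ (z * g) v := hc _
  rw [h1, h2]
  exact S.smul_mem c (hS ⟨z * g, hzg⟩ v hv)

/-- Every irreducible representation of a subgroup `H` embeds into the restriction to `H` of an
irreducible representation of `G`: it embeds into the restriction of the regular one. -/
theorem IsIrreducible.exists_injective_restrict [Finite G] {H : Subgroup G}
    {τ : Representation ℂ H W} (hτ : τ.IsIrreducible) :
    ∃ (m : ℕ) (σ : Representation ℂ G (Fin m → ℂ)), σ.IsIrreducible ∧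
      ∃ f : IntertwiningMap τ (σ.comp H.subtype), Function.Injective f := by
  classical
  obtain ⟨w, hw⟩ := @exists_ne _ ((isIrreducible_iff τ).mp hτ).1 0
  obtain ⟨l, hl⟩ : ∃ l : Module.Dual ℂ W, l w ≠ 0 := by
    by_contra! hall
    exact hw ((Module.forall_dual_apply_eq_zero_iff ℂ w).mp hall)
  let F : W →ₗ[ℂ] (G → ℂ) :=
    LinearMap.pi fun x => if hx : x ∈ H then l ∘ₗ τ ⟨x, hx⟩ else 0
  have hF : ∀ v x, F v x = if hx : x ∈ H then l (τ ⟨x, hx⟩ v) else 0 := by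
    intro v x
    simp only [F, LinearMap.pi_apply]
    split_ifs <;> rfl
  let f : IntertwiningMap τ ((regularRep G).comp H.subtype) := ⟨F, fun h => by
    refine LinearMap.ext fun v => funext fun x => ?_
    change F (τ h v) x = regularRep G h (F v) x
    rw [regularRep_apply, hF, hF]
    by_cases hx : x ∈ H
    · rw [dif_pos hx, dif_pos (H.mul_mem hx h.2), ← Module.End.mul_apply, ← map_mul]
      rfl
    · rw [dif_neg hx, dif_neg (by rwa [H.mul_mem_cancel_right h.2])]⟩
  have hfw : f w ≠ 0 := fun h0 => hl (by
    have := congrFun h0 1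
    change F w 1 = 0 at this
    rw [hF, dif_pos H.one_mem] at this
    have h1 : τ ⟨1, H.one_mem⟩ w = w := by
      change τ 1 w = w
      rw [map_one]; rfl
    rwa [h1] at this)
  obtain ⟨k, d, σ, hσ, ⟨e⟩⟩ := exists_equiv_directSum (regularRep G)
  obtain ⟨i, hi⟩ : ∃ i, directSumProjection σ i (e (f w)) ≠ 0 := by
    by_contra! hall
    refine hfw ?_
    rw [← e.symm_apply_apply (f w), show e (f w) = 0 from DFinsupp.ext hall, map_zero]
  let q : IntertwiningMap τ ((σ i).comp H.subtype) :=
    ⟨((directSumProjection σ i).toLinearMap ∘ₗ e.toLinearMap) ∘ₗ f.toLinearMap, fun h => by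
      refine LinearMap.ext fun v => ?_
      change directSumProjection σ i (e (f (τ h v))) =
        σ i h (directSumProjection σ i (e (f v)))
      have h1 : f (τ h v) = regularRep G h (f v) := f.isIntertwining _ _ h v
      have h2 : e (regularRep G h (f v)) = directSum σ h (e (f v)) :=
        e.toIntertwiningMap.isIntertwining _ _ _ _
      rw [h1, h2, IntertwiningMap.isIntertwining]⟩
  have := hτ
  refine ⟨d i, σ i, hσ i, q, (IsIrreducible.injective_or_eq_zero q).resolve_right fun h0 => hi ?_⟩
  exact congrArg (fun q : IntertwiningMap τ ((σ i).comp H.subtype) => q w) h0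

end Characters

/-! ### The twisted Frobenius–Schur indicator -/

section TwistedFrobeniusSchur

variable {G : Type*} [Group G] [Fintype G] {m : ℕ}

open Matrix

/-- Schur's orthogonality relation in matrix form. -/
theorem IsIrreducible.sum_mul_mul {ρ : Representation ℂ G (Fin m → ℂ)} (h : ρ.IsIrreducible)
    (X : Matrix (Fin m) (Fin m) ℂ) :
    (m : ℂ) • ∑ g, LinearMap.toMatrix' (ρ g) * X * LinearMap.toMatrix' (ρ g⁻¹) =
      ((Fintype.card G : ℂ) * X.trace) • (1 : Matrix (Fin m) (Fin m) ℂ) := by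
  let Y := ∑ g, LinearMap.toMatrix' (ρ g) * X * LinearMap.toMatrix' (ρ g⁻¹)
  have hmul : ∀ a b, LinearMap.toMatrix' (ρ (a * b)) =
      LinearMap.toMatrix' (ρ a) * LinearMap.toMatrix' (ρ b) := by
    intro a b
    rw [map_mul, LinearMap.toMatrix'_mul]
  have hY : ∀ a, LinearMap.toMatrix' (ρ a) * Y = Y * LinearMap.toMatrix' (ρ a) := by
    intro a
    simp only [Y]
    rw [Finset.mul_sum, Finset.sum_mul, ← Equiv.sum_comp (Equiv.mulLeft a⁻¹)]
    refine Finset.sum_congr rfl fun g _ => ?_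
    rw [Equiv.coe_mulLeft, _root_.mul_inv_rev, inv_inv, hmul, hmul g⁻¹ a]
    simp only [← mul_assoc]
    rw [← hmul, mul_inv_cancel, map_one]
    simp
  obtain ⟨c, hc⟩ := h.exists_eq_smul (⟨Matrix.toLin' Y, fun a => by
    apply LinearMap.toMatrix'.injective
    rw [LinearMap.toMatrix'_comp, LinearMap.toMatrix'_comp, LinearMap.toMatrix'_toLin', hY]⟩ :
      IntertwiningMap ρ ρ)
  have hYc : Y = c • (1 : Matrix (Fin m) (Fin m) ℂ) := by
    apply Matrix.toLin'.injective
    refine LinearMap.ext fun v => ?_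
    rw [map_smul, Matrix.toLin'_one]
    exact hc v
  have htr : Y.trace = Fintype.card G * X.trace := by
    simp only [Y]
    rw [Matrix.trace_sum, Finset.sum_congr rfl fun g _ => ?_, Finset.sum_const, Finset.card_univ,
      nsmul_eq_mul]
    rw [Matrix.trace_mul_comm, ← mul_assoc, ← hmul, inv_mul_cancel, map_one]
    simp
  change (m : ℂ) • Y = _
  rw [← htr, hYc, Matrix.trace_smul, Matrix.trace_one, smul_smul, Fintype.card_fin, smul_eq_mul,
    mul_comm]

theorem trace_mul_transpose_mul (A B N N' : Matrix (Fin m) (Fin m) ℂ) :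
    (B * Nᵀ * A * N').trace = ∑ a, ∑ c, (N * vecMulVec (B a) (A c) * N') c a := by
  simp only [Matrix.trace, Matrix.diag_apply, Matrix.mul_apply, Finset.sum_mul,
    vecMulVec_apply, Matrix.transpose_apply]
  refine Finset.sum_congr rfl fun a _ => ?_
  rw [Finset.sum_comm]
  refine Finset.sum_congr rfl fun c _ => Finset.sum_congr rfl fun e _ =>
    Finset.sum_congr rfl fun b _ => ?_
  ring

/-- The twisted Frobenius–Schur indicator of an irreducible character that is invariant under an
anti-involution is a sign. -/
theorem IsIrreducible.sum_character_antiInvolution {ρ : Representation ℂ G (Fin m → ℂ)}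
    (h : ρ.IsIrreducible) (T : G → G) (hT : ∀ g, T (T g) = g) (hmul : ∀ g k, T (g * k) = T k * T g)
    (hinv : ∀ g, ρ.character (T g) = ρ.character g) :
    ∑ g, ρ.character (T g * g⁻¹) = Fintype.card G ∨
      ∑ g, ρ.character (T g * g⁻¹) = -Fintype.card G := by
  have hT1 : T 1 = 1 := by
    have := hmul (T 1) 1
    rw [mul_one, hT] at this
    have h2 := hmul 1 1
    rw [mul_one] at h2
    exact mul_eq_left.mp h2.symm
  let M : G → Matrix (Fin m) (Fin m) ℂ := fun g => LinearMap.toMatrix' (ρ g)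
  have hM : ∀ a b, M (a * b) = M a * M b := by
    intro a b
    simp only [M]
    rw [map_mul, LinearMap.toMatrix'_mul]
  have hM1 : M 1 = 1 := by
    simp only [M]
    rw [map_one]
    exact LinearMap.toMatrix'_one
  have hχ : ∀ g, ρ.character g = (M g).trace := fun g =>
    LinearMap.trace_eq_matrix_trace ℂ (Pi.basisFun ℂ (Fin m)) (ρ g)
  -- the representation `g ↦ (M (T g))ᵀ` has the same character as `ρ`
  let ρ' : Representation ℂ G (Fin m → ℂ) :=
    { toFun := fun g => Matrix.toLin' (M (T g))ᵀ
      map_one' := by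
        rw [hT1, hM1, Matrix.transpose_one, Matrix.toLin'_one]
        rfl
      map_mul' := fun a b => by
        rw [hmul, hM, Matrix.transpose_mul, Matrix.toLin'_mul]
        rfl }
  have hρ' : ∀ g, LinearMap.toMatrix' (ρ' g) = (M (T g))ᵀ := fun g =>
    LinearMap.toMatrix'_toLin' _
  have hχ' : ∀ g, ρ'.character g = ρ.character g := by
    intro g
    rw [← hinv g, hχ, ← Matrix.trace_transpose, ← hρ']
    exact LinearMap.trace_eq_matrix_trace ℂ (Pi.basisFun ℂ (Fin m)) (ρ' g)
  have hirr := h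
  have hfin : finrank ℂ (IntertwiningMap ρ ρ') = 1 := by
    have h1 := sum_character_mul_character_inv ρ ρ'
    have h2 := sum_character_mul_character_inv ρ ρ
    rw [Finset.sum_congr rfl fun g _ => by rw [hχ' g], h2,
      IsIrreducible.finrank_intertwiningMap_self ρ] at h1
    have h3 := mul_left_cancel₀ (Nat.cast_ne_zero.mpr Fintype.card_ne_zero) h1
    exact_mod_cast h3.symm
  obtain ⟨f, hf⟩ := exists_ne_zero_of_finrank_ne_zero (σ := ρ) (ρ := ρ') (by omega)
  have hinj : Function.Injective f := (IsIrreducible.injective_or_eq_zero f).resolve_right hf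
  let A : Matrix (Fin m) (Fin m) ℂ := LinearMap.toMatrix' f.toLinearMap
  have hA : ∀ g, A * M g = (M (T g))ᵀ * A := by
    intro g
    have := congrArg LinearMap.toMatrix' (f.isIntertwining' g)
    rwa [LinearMap.toMatrix'_comp, LinearMap.toMatrix'_comp, hρ'] at this
  have hAdet : IsUnit A.det := by
    rw [← Matrix.isUnit_iff_isUnit_det]
    have hbij : Function.Bijective f.toLinearMap :=
      ⟨hinj, LinearMap.injective_iff_surjective.mp hinj⟩
    let e := LinearEquiv.ofBijective f.toLinearMap hbij
    refine IsUnit.of_mul_eq_one (LinearMap.toMatrix' e.symm.toLinearMap) ?_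
    simp only [A]
    rw [← LinearMap.toMatrix'_comp]
    have : f.toLinearMap ∘ₗ e.symm.toLinearMap = LinearMap.id :=
      LinearMap.ext fun v => e.apply_symm_apply v
    rw [this, LinearMap.toMatrix'_id]
  have hAt : ∀ g, Aᵀ * M g = (M (T g))ᵀ * Aᵀ := by
    intro g
    have := congrArg Matrix.transpose (hA (T g))
    rw [hT, Matrix.transpose_mul, Matrix.transpose_mul, Matrix.transpose_transpose] at this
    exact this.symm
  -- `Aᵀ` is an intertwining map as well, hence a multiple of `A`
  obtain ⟨c, hc⟩ : ∃ c : ℂ, Aᵀ = c • A := by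
    let f' : IntertwiningMap ρ ρ' := ⟨Matrix.toLin' Aᵀ, fun g => by
      apply LinearMap.toMatrix'.injective
      rw [LinearMap.toMatrix'_comp, LinearMap.toMatrix'_comp, LinearMap.toMatrix'_toLin', hρ']
      exact hAt g⟩
    obtain ⟨c, hc⟩ := (finrank_eq_one_iff_of_nonzero' f hf).mp hfin f'
    refine ⟨c, ?_⟩
    have h1 : Matrix.toLin' Aᵀ = c • f.toLinearMap :=
      (congrArg (fun q : IntertwiningMap ρ ρ' => q.toLinearMap) hc).symm
    have h2 := congrArg LinearMap.toMatrix' h1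
    rwa [LinearMap.toMatrix'_toLin', map_smul] at h2
  have hm : (m : ℂ) ≠ 0 := by
    rintro h0
    have hm0 : m = 0 := by exact_mod_cast h0
    subst hm0
    exact not_nontrivial_iff_subsingleton.mpr inferInstance ((isIrreducible_iff ρ).mp h).1
  have hc2 : c = 1 ∨ c = -1 := by
    have h1 : A = (c * c) • A := by
      conv_lhs => rw [← Matrix.transpose_transpose A, hc, Matrix.transpose_smul, hc, smul_smul]
    have h2 := congrArg (fun X => (X * A⁻¹).trace) h1
    simp only [Matrix.smul_mul, Matrix.mul_nonsing_inv A hAdet, Matrix.trace_smul,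
      Matrix.trace_one, Fintype.card_fin, smul_eq_mul] at h2
    have h3 : c * c = 1 := mul_right_cancel₀ hm (by rw [← h2, one_mul])
    exact mul_self_eq_one_iff.mp h3
  have hc0 : c ≠ 0 := by rcases hc2 with rfl | rfl <;> norm_num
  have hTg : ∀ g, M (T g) = A⁻¹ * (M g)ᵀ * A := by
    intro g
    have h1 := hA (T g)
    rw [hT] at h1
    rw [mul_assoc, ← h1, ← mul_assoc, Matrix.nonsing_inv_mul A hAdet, one_mul]
  have hsum : (m : ℂ) * ∑ g, ρ.character (T g * g⁻¹) = Fintype.card G * (c * m) := by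
    have h1 : ∀ g, ρ.character (T g * g⁻¹) =
        ∑ a, ∑ b, (M g * vecMulVec (A⁻¹ a) (A b) * M g⁻¹) b a := by
      intro g
      rw [hχ, hM, hTg, trace_mul_transpose_mul]
    have h2 : ∀ a b, (m : ℂ) * ∑ g, (M g * vecMulVec (A⁻¹ a) (A b) * M g⁻¹) b a =
        (Fintype.card G * (vecMulVec (A⁻¹ a) (A b)).trace) *
          (1 : Matrix (Fin m) (Fin m) ℂ) b a := by
      intro a b
      have := congrFun (congrFun (h.sum_mul_mul (vecMulVec (A⁻¹ a) (A b))) b) a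
      rw [Matrix.smul_apply, Matrix.smul_apply, Matrix.sum_apply, smul_eq_mul, smul_eq_mul] at this
      exact this
    have h3 : ∑ a, (vecMulVec (A⁻¹ a) (A a)).trace = c * m := by
      have : (A⁻¹ * Aᵀ).trace = c * m := by
        rw [hc, Matrix.mul_smul, Matrix.nonsing_inv_mul A hAdet, Matrix.trace_smul,
          Matrix.trace_one, Fintype.card_fin, smul_eq_mul]
      rw [← this]
      simp [Matrix.trace, Matrix.mul_apply, vecMulVec_apply]
    rw [Finset.sum_congr rfl fun g _ => h1 g, Finset.sum_comm, Finset.mul_sum, ← h3,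
      Finset.mul_sum]
    refine Finset.sum_congr rfl fun a _ => ?_
    rw [Finset.sum_comm, Finset.mul_sum, Finset.sum_congr rfl fun b _ => h2 a b,
      Finset.sum_eq_single a]
    · rw [Matrix.one_apply_eq, mul_one]
    · intro b _ hb
      rw [Matrix.one_apply_ne hb, mul_zero]
    · simp
  have hfinal : ∑ g, ρ.character (T g * g⁻¹) = Fintype.card G * c :=
    mul_left_cancel₀ hm (by rw [hsum]; ring)
  rcases hc2 with rfl | rfl
  · left; rw [hfinal, mul_one]
  · right; rw [hfinal, mul_neg_one]

end TwistedFrobeniusSchur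

end Representation

/-! ### Antilinear maps commuting with an element of the wreath product -/

namespace Wreath

variable {r n : ℕ}

/-- Complex conjugation: `bar (x, π) = (-x, π)`, the inverse of the transpose. -/
def bar (g : Wreath r n) : Wreath r n := ⟨fun i => -g.z i, g.perm⟩

@[simp] theorem bar_z (g : Wreath r n) (i : Fin n) : (bar g).z i = -g.z i := rfl

@[simp] theorem bar_perm (g : Wreath r n) : (bar g).perm = g.perm := rfl

/-- `bar` as a homomorphism. -/
def barHom : Wreath r n →* Wreath r n where
  toFun := bar
  map_one' := by ext <;> simp
  map_mul' g h := by
    ext i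
    · simp [add_comm]
    · simp

theorem bar_mul (g h : Wreath r n) : bar (g * h) = bar g * bar h := map_mul barHom g h

theorem bar_zpow (g : Wreath r n) (m : ℤ) : bar (g ^ m) = bar g ^ m := map_zpow barHom g m

@[simp] theorem bar_bar (g : Wreath r n) : bar (bar g) = g := by
  ext <;> simp

theorem transpose_eq (g : Wreath r n) : g.transpose = (bar g)⁻¹ := by
  ext <;> simp

/-- The homomorphism `g ↦ |g|`. -/
def permHom : Wreath r n →* Equiv.Perm (Fin n) where
  toFun := perm
  map_one' := rfl
  map_mul' _ _ := rfl

@[simp] theorem zpow_perm (g : Wreath r n) (m : ℤ) : (g ^ m).perm = g.perm ^ m :=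
  map_zpow permHom g m

@[simp] theorem pow_perm (g : Wreath r n) (m : ℕ) : (g ^ m).perm = g.perm ^ m :=
  map_pow permHom g m

/-- The wreath product acts on `n` copies of `ZMod r`, each of which is a copy of the group of
`r`-th roots of unity. -/
instance : MulAction (Wreath r n) (Fin n × ZMod r) where
  smul g x := (g.perm x.1, x.2 + g.z x.1)
  one_smul x := by
    change ((1 : Wreath r n).perm x.1, x.2 + (1 : Wreath r n).z x.1) = x
    simp
  mul_smul g h x := by
    change ((g * h).perm x.1, x.2 + (g * h).z x.1) =
      (g.perm (h.perm x.1), x.2 + h.z x.1 + g.z (h.perm x.1))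
    simp [add_comm (g.z _), add_assoc]

theorem smul_def (g : Wreath r n) (x : Fin n × ZMod r) :
    g • x = (g.perm x.1, x.2 + g.z x.1) := rfl

theorem smul_eq_self_iff (g : Wreath r n) (i : Fin n) :
    g • (i, (0 : ZMod r)) = (i, 0) ↔ g.perm i = i ∧ g.z i = 0 := by
  rw [smul_def, Prod.mk.injEq, zero_add]

/-- The least `N > 0` for which `g ^ N` is trivial at the point `i`. -/
noncomputable def pointPeriod (g : Wreath r n) (i : Fin n) : ℕ :=
  MulAction.period g (i, (0 : ZMod r))

theorem pointPeriod_dvd_iff (g : Wreath r n) (i : Fin n) (m : ℤ) :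
    (g.pointPeriod i : ℤ) ∣ m ↔ (g.perm ^ m) i = i ∧ (g ^ m).z i = 0 := by
  rw [pointPeriod, ← MulAction.zpow_smul_eq_iff_period_dvd, smul_eq_self_iff, zpow_perm]

theorem pointPeriod_eq_of_forall (g : Wreath r n) (i j : Fin n)
    (h : ∀ m : ℤ, ((g.perm ^ m) i = i ∧ (g ^ m).z i = 0) ↔
      ((g.perm ^ m) j = j ∧ (g ^ m).z j = 0)) : g.pointPeriod i = g.pointPeriod j := by
  apply Nat.dvd_antisymm
  · rw [← Int.natCast_dvd_natCast, pointPeriod_dvd_iff, h, ← pointPeriod_dvd_iff]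
  · rw [← Int.natCast_dvd_natCast, pointPeriod_dvd_iff, ← h, ← pointPeriod_dvd_iff]

theorem pointPeriod_perm (g : Wreath r n) (i : Fin n) :
    g.pointPeriod (g.perm i) = g.pointPeriod i := by
  symm
  apply pointPeriod_eq_of_forall
  intro m
  have hcomm : g ^ m * g = g * g ^ m := (Commute.refl g).zpow_left m
  have h1 : (g.perm ^ m) (g.perm i) = g.perm ((g.perm ^ m) i) := by
    have := congrArg (fun x => x.perm i) hcomm
    simpa using this
  have h2 : (g ^ m).z (g.perm i) + g.z i = g.z ((g.perm ^ m) i) + (g ^ m).z i := by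
    have := congrArg (fun x => x.z i) hcomm
    simpa using this
  rw [h1, g.perm.injective.eq_iff]
  refine and_congr_right fun hi => ?_
  rw [hi, add_comm, add_right_inj] at h2
  rw [h2]

/-- The integer-valued functions that are constant on the cycles of a permutation. -/
def cycleFun (π : Equiv.Perm (Fin n)) : AddSubgroup (Fin n → ℤ) where
  carrier := {k | ∀ i, k (π i) = k i}
  add_mem' ha hb i := by simp [ha i, hb i]
  zero_mem' _ := rfl
  neg_mem' ha i := by simp [ha i]

theorem cycleFun_apply {π : Equiv.Perm (Fin n)} (k : cycleFun π) (i : Fin n) :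
    k.1 (π i) = k.1 i := k.2 i

theorem cycleFun_zpow_apply {π : Equiv.Perm (Fin n)} (k : cycleFun π) (m : ℤ) (i : Fin n) :
    k.1 ((π ^ m) i) = k.1 i := by
  induction m using Int.induction_on with
  | zero => simp
  | succ m ih => rw [add_comm, zpow_add, zpow_one, Equiv.Perm.mul_apply, cycleFun_apply, ih]
  | pred m ih =>
    rw [← cycleFun_apply, ← Equiv.Perm.mul_apply, ← zpow_one_add]
    simpa using ih

/-- The element acting on the cycle through `i` as `g ^ k i`. -/
def cyclePow (g : Wreath r n) (k : cycleFun g.perm) : Wreath r n where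
  z i := (g ^ k.1 i).z i
  perm :=
    { toFun := fun i => (g.perm ^ k.1 i) i
      invFun := fun i => (g.perm ^ (-k.1 i)) i
      left_inv := fun i => by
        simp only [cycleFun_zpow_apply]
        rw [← Equiv.Perm.mul_apply, ← zpow_add, neg_add_cancel, zpow_zero, Equiv.Perm.one_apply]
      right_inv := fun i => by
        simp only [cycleFun_zpow_apply]
        rw [← Equiv.Perm.mul_apply, ← zpow_add, add_neg_cancel, zpow_zero, Equiv.Perm.one_apply] }

@[simp] theorem cyclePow_z (g : Wreath r n) (k : cycleFun g.perm) (i : Fin n) :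
    (g.cyclePow k).z i = (g ^ k.1 i).z i := rfl

@[simp] theorem cyclePow_perm (g : Wreath r n) (k : cycleFun g.perm) (i : Fin n) :
    (g.cyclePow k).perm i = (g.perm ^ k.1 i) i := rfl

theorem cyclePow_add (g : Wreath r n) (k l : cycleFun g.perm) :
    g.cyclePow (k + l) = g.cyclePow k * g.cyclePow l := by
  ext i
  · simp [zpow_add, cycleFun_zpow_apply]
  · simp [zpow_add, cycleFun_zpow_apply]

/-- `cyclePow` only depends on the exponents modulo the periods of `g` at the points. -/
theorem cyclePow_congr (g : Wreath r n) (k l : cycleFun g.perm)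
    (h : ∀ i, (g.pointPeriod i : ℤ) ∣ k.1 i - l.1 i) : g.cyclePow k = g.cyclePow l := by
  have key : ∀ i, (g.perm ^ k.1 i) i = (g.perm ^ l.1 i) i ∧
      (g ^ k.1 i).z i = (g ^ l.1 i).z i := by
    intro i
    obtain ⟨h1, h2⟩ := (g.pointPeriod_dvd_iff i _).mp (h i)
    have h3 : k.1 i = l.1 i + (k.1 i - l.1 i) := by ring
    constructor
    · conv_lhs => rw [h3]
      rw [zpow_add, Equiv.Perm.mul_apply, h1]
    · conv_lhs => rw [h3]
      rw [zpow_add, mul_z, zpow_perm, h1, h2, add_zero]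
  ext i
  · exact (key i).2
  · exact congrArg Fin.val (key i).1

theorem cyclePow_zero (g : Wreath r n) : g.cyclePow 0 = 1 := by
  ext i <;> simp

theorem cyclePow_one (g : Wreath r n) (k : cycleFun g.perm) (hk : ∀ i, k.1 i = 1) :
    g.cyclePow k = g := by
  ext i <;> simp [hk]

/-- `f * bar g = g * f`: the antilinear map attached to `f` commutes with `g`. -/
def AntiCommute (g f : Wreath r n) : Prop := g * f = f * bar g

theorem AntiCommute.zpow {g f : Wreath r n} (h : AntiCommute g f) (m : ℤ) :
    g ^ m * f = f * bar (g ^ m) := by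
  have : SemiconjBy f (bar g) g := h.symm
  rw [bar_zpow]
  exact (this.zpow_right m).symm

theorem AntiCommute.perm_zpow {g f : Wreath r n} (h : AntiCommute g f) (m : ℤ) (i : Fin n) :
    (g.perm ^ m) (f.perm i) = f.perm ((g.perm ^ m) i) := by
  have := congrArg (fun x => x.perm i) (h.zpow m)
  simpa using this

theorem AntiCommute.perm {g f : Wreath r n} (h : AntiCommute g f) (i : Fin n) :
    g.perm (f.perm i) = f.perm (g.perm i) := by
  simpa using h.perm_zpow 1 i

theorem AntiCommute.z_zpow {g f : Wreath r n} (h : AntiCommute g f) (m : ℤ) (i : Fin n) :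
    (g ^ m).z (f.perm i) + f.z i = f.z ((g.perm ^ m) i) - (g ^ m).z i := by
  have := congrArg (fun x => x.z i) (h.zpow m)
  simpa [sub_eq_add_neg] using this

theorem AntiCommute.pointPeriod {g f : Wreath r n} (h : AntiCommute g f) (i : Fin n) :
    g.pointPeriod (f.perm i) = g.pointPeriod i := by
  symm
  apply pointPeriod_eq_of_forall
  intro m
  rw [h.perm_zpow, f.perm.injective.eq_iff]
  refine and_congr_right fun hi => ?_
  have h2 := h.z_zpow m i
  rw [hi] at h2
  constructor
  · intro h0
    rw [h0, sub_zero] at h2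
    simpa using h2
  · intro h0
    rw [h0, zero_add] at h2
    simpa using (sub_eq_self.mp h2.symm)

/-- The function `k ∘ |f|`. -/
def AntiCommute.cycleFunComp {g f : Wreath r n} (h : AntiCommute g f) (k : cycleFun g.perm) :
    cycleFun g.perm :=
  ⟨fun i => k.1 (f.perm i), fun i => by
    change k.1 (f.perm (g.perm i)) = k.1 (f.perm i)
    rw [← h.perm, cycleFun_apply]⟩

theorem AntiCommute.cyclePow_mul {g f : Wreath r n} (h : AntiCommute g f) (k : cycleFun g.perm) :
    g.cyclePow k * f = f * bar (g.cyclePow (h.cycleFunComp k)) := by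
  ext i
  · have := h.z_zpow (k.1 (f.perm i)) i
    simpa [cycleFunComp, sub_eq_add_neg] using this
  · have := h.perm_zpow (k.1 (f.perm i)) i
    simpa [cycleFunComp] using congrArg Fin.val this

theorem AntiCommute.cyclePow_mul_mul_bar {g f : Wreath r n} (h : AntiCommute g f)
    (k : cycleFun g.perm) (hk : ∀ i, k.1 (f.perm (f.perm i)) = k.1 i) :
    (g.cyclePow k * f) * bar (g.cyclePow k * f) =
      g.cyclePow (k + h.cycleFunComp k) * (f * bar f) := by
  have h1 : h.cycleFunComp (h.cycleFunComp k) = k := Subtype.ext (funext hk)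
  have h2 : f * bar (g.cyclePow k) = g.cyclePow (h.cycleFunComp k) * f := by
    rw [h.cyclePow_mul, h1]
  rw [bar_mul, cyclePow_add, mul_assoc, ← mul_assoc f, h2]
  simp only [mul_assoc]

theorem AntiCommute.cyclePow_left {g f : Wreath r n} (h : AntiCommute g f)
    (k : cycleFun g.perm) : AntiCommute g (g.cyclePow k * f) := by
  have h1 : g * g.cyclePow k = g.cyclePow k * g := by
    let l : cycleFun g.perm := ⟨fun _ => 1, fun _ => rfl⟩
    have hl := g.cyclePow_one l fun _ => rfl
    calc g * g.cyclePow k = g.cyclePow l * g.cyclePow k := by rw [hl]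
      _ = g.cyclePow k * g.cyclePow l := by rw [← cyclePow_add, add_comm, cyclePow_add]
      _ = g.cyclePow k * g := by rw [hl]
  rw [AntiCommute, ← mul_assoc, h1, mul_assoc, h, mul_assoc]

end Wreath

/-! ### Solutions of `f * bar f = g` -/

namespace Wreath

variable {r n : ℕ}

open Equiv.Perm

noncomputable instance [NeZero r] : Fintype (Wreath r n) := Fintype.ofFinite _

theorem mul_bar_eq_one_iff (f : Wreath r n) : f * bar f = 1 ↔
    (∀ i, f.perm (f.perm i) = i) ∧ ∀ i, f.z (f.perm i) = f.z i := by
  constructor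
  · intro h
    constructor
    · intro i
      simpa using congrArg (fun x => x.perm i) h
    · intro i
      have := congrArg (fun x => x.z i) h
      simpa [← sub_eq_add_neg, sub_eq_zero] using this
  · rintro ⟨h1, h2⟩
    ext i
    · simp [h2]
    · simp [h1]

theorem antiCommute_iff (g f : Wreath r n) : AntiCommute g f ↔
    (∀ i, g.perm (f.perm i) = f.perm (g.perm i)) ∧
      ∀ i, g.z (f.perm i) + f.z i = f.z (g.perm i) - g.z i := by
  constructor
  · intro h
    exact ⟨h.perm, fun i => by simpa using h.z_zpow 1 i⟩
  · rintro ⟨h1, h2⟩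
    unfold AntiCommute
    ext i
    · simp [h2, sub_eq_add_neg]
    · simp [h1]

theorem AntiCommute.of_mul_bar_eq {g f : Wreath r n} (h : f * bar f = g) : AntiCommute g f := by
  subst h
  rw [AntiCommute, bar_mul, bar_bar, mul_assoc]

/-- `f` is symmetric and is fixed by `g`. -/
def SymmFixed (g f : Wreath r n) : Prop := f * bar f = 1 ∧ AntiCommute g f

/-- `|f|` maps the cycle of `|g|` through `i` to itself. -/
def Stable (g f : Wreath r n) (i : Fin n) : Prop := g.perm.SameCycle i (f.perm i)

theorem Stable.congr_sameCycle {g f : Wreath r n} (h : AntiCommute g f) {i j : Fin n}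
    (hij : g.perm.SameCycle i j) (hi : Stable g f i) : Stable g f j := by
  obtain ⟨m, rfl⟩ := hij
  unfold Stable at *
  rw [sameCycle_zpow_left, ← h.perm_zpow, sameCycle_zpow_right]
  exact hi

theorem stable_perm_iff {g f : Wreath r n} (h : AntiCommute g f) (i : Fin n) :
    Stable g f (f.perm i) ↔ Stable g f i := by
  unfold Stable
  constructor
  · rintro ⟨m, hm⟩
    refine ⟨m, f.perm.injective ?_⟩
    rw [← hm, h.perm_zpow]
  · rintro ⟨m, hm⟩
    refine ⟨m, ?_⟩
    rw [← hm, ← h.perm_zpow, hm]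

theorem sameCycle_cyclePow_mul (g f : Wreath r n) (k : cycleFun g.perm) (i : Fin n) :
    g.perm.SameCycle (f.perm i) ((g.cyclePow k * f).perm i) := ⟨k.1 (f.perm i), rfl⟩

theorem stable_cyclePow_mul_iff (g f : Wreath r n) (k : cycleFun g.perm) (i : Fin n) :
    Stable g (g.cyclePow k * f) i ↔ Stable g f i :=
  ⟨fun h => h.trans (sameCycle_cyclePow_mul g f k i).symm,
    fun h => h.trans (sameCycle_cyclePow_mul g f k i)⟩

/-- On a stable cycle, `|f| = |g| ^ m` forces `f * bar f = g ^ (2 * m)`. -/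
theorem pointPeriod_dvd_of_stable {g f : Wreath r n} (h : AntiCommute g f) {a : ℤ}
    (hf : f * bar f = g ^ a) {i : Fin n} {m : ℤ} (hm : (g.perm ^ m) i = f.perm i) :
    (g.pointPeriod i : ℤ) ∣ 2 * m - a := by
  have h1 : f * bar (g ^ (-m)) = g ^ (-m) * f := (h.zpow (-m)).symm
  have hx : (g ^ (-m) * f) * bar (g ^ (-m) * f) = g ^ (a - 2 * m) := by
    rw [bar_mul, mul_assoc, ← mul_assoc f, h1, mul_assoc, hf, ← zpow_add, ← zpow_add]
    congr 1
    ring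
  have hi : (g ^ (-m) * f).perm i = i := by
    rw [mul_perm, zpow_perm, Equiv.Perm.mul_apply, ← hm, ← Equiv.Perm.mul_apply, ← zpow_add,
      neg_add_cancel, zpow_zero, Equiv.Perm.one_apply]
  rw [show 2 * m - a = -(a - 2 * m) by ring, dvd_neg, pointPeriod_dvd_iff]
  constructor
  · rw [← zpow_perm, ← hx, mul_perm, Equiv.Perm.mul_apply, bar_perm, hi, hi]
  · rw [← hx, mul_z, bar_perm, hi, bar_z, add_neg_cancel]

/-- A chosen representative of the cycle through `i`. -/
noncomputable def cycleRep (π : Equiv.Perm (Fin n)) (i : Fin n) : Fin n :=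
  (Quotient.mk (SameCycle.setoid π) i).out

theorem cycleRep_eq_iff (π : Equiv.Perm (Fin n)) (i j : Fin n) :
    cycleRep π i = cycleRep π j ↔ π.SameCycle i j := by
  unfold cycleRep
  rw [Quotient.out_inj, Quotient.eq]
  rfl

theorem sameCycle_cycleRep (π : Equiv.Perm (Fin n)) (i : Fin n) :
    π.SameCycle (cycleRep π i) i := Quotient.mk_out (s := SameCycle.setoid π) i

/-- All cycles of `g` that `f` maps to themselves have odd period. -/
def OddStable (g f : Wreath r n) : Prop := ∀ i, Stable g f i → Odd (g.pointPeriod i)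

open Classical in
/-- The exponents `k` with `k + k ∘ |f| = 1`: they are `1 / 2` on the stable cycles, which have odd
period, and `0` and `1` on the two cycles of an interchanged pair. -/
noncomputable def rootExp {g f : Wreath r n} (h : AntiCommute g f) : cycleFun g.perm :=
  ⟨fun i => if Stable g f i then ((g.pointPeriod i + 1) / 2 : ℕ)
      else if cycleRep g.perm i < cycleRep g.perm (f.perm i) then 0 else 1, fun i => by
    have h1 : g.perm.SameCycle i (g.perm i) := sameCycle_apply_right.mpr (SameCycle.refl _ _)
    have h2 : Stable g f (g.perm i) ↔ Stable g f i :=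
      ⟨Stable.congr_sameCycle h h1.symm, Stable.congr_sameCycle h h1⟩
    have h3 : cycleRep g.perm (g.perm i) = cycleRep g.perm i := (cycleRep_eq_iff _ _ _).mpr h1.symm
    have h4 : cycleRep g.perm (f.perm (g.perm i)) = cycleRep g.perm (f.perm i) := by
      rw [cycleRep_eq_iff, ← h.perm, sameCycle_apply_left]
    simp only [h2, h3, h4, pointPeriod_perm]⟩

/-- The equation `k + k ∘ |f| = 1` for `k = rootExp h`, modulo the periods. -/
theorem rootExp_add_dvd {g f : Wreath r n} (h : AntiCommute g f) (ho : OddStable g f)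
    (hs : ∀ i, g.perm.SameCycle (f.perm (f.perm i)) i) (i : Fin n) :
    (g.pointPeriod i : ℤ) ∣ (rootExp h + h.cycleFunComp (rootExp h)).1 i - 1 := by
  change _ ∣ (rootExp h).1 i + (rootExp h).1 (f.perm i) - 1
  by_cases hi : Stable g f i
  · have hi' := (stable_perm_iff h i).mpr hi
    obtain ⟨c, hc⟩ := ho i hi
    simp only [rootExp, if_pos hi, if_pos hi', h.pointPeriod]
    refine ⟨1, ?_⟩
    rw [hc]
    omega
  · have hi' : ¬ Stable g f (f.perm i) := fun hc => hi ((stable_perm_iff h i).mp hc)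
    have h1 : cycleRep g.perm (f.perm (f.perm i)) = cycleRep g.perm i :=
      (cycleRep_eq_iff _ _ _).mpr (hs i)
    have h2 : cycleRep g.perm i ≠ cycleRep g.perm (f.perm i) := fun hc =>
      hi ((cycleRep_eq_iff _ _ _).mp hc)
    simp only [rootExp, if_neg hi, if_neg hi', h1]
    rcases lt_or_gt_of_ne h2 with h3 | h3
    · simp [h3, h3.not_gt]
    · simp [h3, h3.not_gt]

theorem rootExp_cyclePow_mul {g f : Wreath r n} (h : AntiCommute g f) (k : cycleFun g.perm) :
    rootExp (h.cyclePow_left k) = rootExp h := by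
  refine Subtype.ext (funext fun i => ?_)
  have h1 : cycleRep g.perm ((g.cyclePow k * f).perm i) = cycleRep g.perm (f.perm i) :=
    (cycleRep_eq_iff _ _ _).mpr (sameCycle_cyclePow_mul g f k i).symm
  have h2 := stable_cyclePow_mul_iff g f k i
  simp only [rootExp, h1]
  by_cases hi : Stable g f i
  · rw [if_pos hi, if_pos (h2.mpr hi)]
  · rw [if_neg hi, if_neg fun hc => hi (h2.mp hc)]

/-- On a stable cycle, `|f| = |g| ^ m` and `f * bar f = g` force the period to divide
`2 * m - 1`. -/
theorem oddStable_of_mul_bar_eq {g f : Wreath r n} (h : f * bar f = g) : OddStable g f := by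
  rintro i ⟨m, hm⟩
  have h1 := pointPeriod_dvd_of_stable (AntiCommute.of_mul_bar_eq h) (a := 1)
    (by rw [h, zpow_one]) hm
  rw [← Int.odd_coe_nat]
  by_contra h2
  rw [Int.not_odd_iff_even] at h2
  have h3 := (even_iff_two_dvd.mp h2).trans h1
  omega

open Classical in
/-- Multiplication by a suitable power of `g` on each cycle turns the symmetric elements fixed by
`g` without stable cycles of even period into the solutions of `f * bar f = g`. -/
theorem card_oddStable_eq [NeZero r] (g : Wreath r n) :
    (Finset.univ.filter fun f => SymmFixed g f ∧ OddStable g f).card =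
      (Finset.univ.filter fun f : Wreath r n => f * bar f = g).card := by
  let l : cycleFun g.perm := ⟨fun _ => 1, fun _ => rfl⟩
  have hl : g.cyclePow l = g := g.cyclePow_one l fun _ => rfl
  have hsq : ∀ f : Wreath r n, f * bar f = 1 ∨ f * bar f = g →
      ∀ i, g.perm.SameCycle (f.perm (f.perm i)) i := by
    rintro f (hf | hf) i
    · rw [((mul_bar_eq_one_iff f).mp hf).1]
    · have : f.perm (f.perm i) = g.perm i := by rw [← hf]; simp
      rw [this, sameCycle_apply_left]
  have hk : ∀ (f : Wreath r n), f * bar f = 1 ∨ f * bar f = g → ∀ (k : cycleFun g.perm) (i),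
      k.1 (f.perm (f.perm i)) = k.1 i := by
    intro f hf k i
    obtain ⟨m, hm⟩ := (hsq f hf i).symm
    rw [← hm, cycleFun_zpow_apply]
  refine Finset.card_bij'
    (fun f hf => g.cyclePow (rootExp (Finset.mem_filter.mp hf).2.1.2) * f)
    (fun f hf => g.cyclePow (-rootExp (AntiCommute.of_mul_bar_eq (Finset.mem_filter.mp hf).2)) * f)
    ?_ ?_ ?_ ?_
  · intro f hf
    obtain ⟨⟨hf1, hf2⟩, hf3⟩ := (Finset.mem_filter.mp hf).2
    refine Finset.mem_filter.mpr ⟨Finset.mem_univ _, ?_⟩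
    refine (hf2.cyclePow_mul_mul_bar _ (hk f (.inl hf1) _)).trans
      ((congrArg₂ (· * ·) ?_ hf1).trans (mul_one g))
    exact (cyclePow_congr g _ l (rootExp_add_dvd hf2 hf3 (hsq f (.inl hf1)))).trans hl
  · intro f hf
    have hf1 := (Finset.mem_filter.mp hf).2
    have hf2 := AntiCommute.of_mul_bar_eq hf1
    have ho := oddStable_of_mul_bar_eq hf1
    refine Finset.mem_filter.mpr ⟨Finset.mem_univ _, ⟨?_, hf2.cyclePow_left _⟩, fun i hi => ?_⟩
    · refine (hf2.cyclePow_mul_mul_bar _ (hk f (.inr hf1) _)).trans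
        ((congrArg₂ (· * ·) (?_ : _ = g⁻¹) hf1).trans (inv_mul_cancel g))
      have h1 : g.cyclePow (-l) = g⁻¹ := by
        rw [eq_inv_iff_mul_eq_one]
        calc g.cyclePow (-l) * g = g.cyclePow (-l) * g.cyclePow l := by rw [hl]
          _ = 1 := by rw [← cyclePow_add, neg_add_cancel, cyclePow_zero]
      rw [← h1]
      refine cyclePow_congr g _ _ fun i => ?_
      have h2 := rootExp_add_dvd hf2 ho (hsq f (.inr hf1)) i
      rw [← dvd_neg] at h2
      refine h2.trans (dvd_of_eq ?_)
      change -((rootExp hf2).1 i + (rootExp hf2).1 (f.perm i) - 1) =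
        -(rootExp hf2).1 i + -(rootExp hf2).1 (f.perm i) - -1
      ring
    · exact ho i ((stable_cyclePow_mul_iff g f _ i).mp hi)
  · intro f hf
    have hf2 := (Finset.mem_filter.mp hf).2.1.2
    have h1 := rootExp_cyclePow_mul hf2 (rootExp hf2)
    change g.cyclePow (-rootExp (hf2.cyclePow_left (rootExp hf2))) *
      (g.cyclePow (rootExp hf2) * f) = f
    rw [h1, ← mul_assoc, ← cyclePow_add, neg_add_cancel, cyclePow_zero, one_mul]
  · intro f hf
    have hf2 := AntiCommute.of_mul_bar_eq (Finset.mem_filter.mp hf).2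
    have h1 := rootExp_cyclePow_mul hf2 (-rootExp hf2)
    change g.cyclePow (rootExp (hf2.cyclePow_left (-rootExp hf2))) *
      (g.cyclePow (-rootExp hf2) * f) = f
    rw [h1, ← mul_assoc, ← cyclePow_add, add_neg_cancel, cyclePow_zero, one_mul]

end Wreath

/-! ### The sign of a cycle -/

namespace Wreath

variable {r n : ℕ}

open Equiv.Perm

/-- The contribution to `modelSign g w` of a fixed point of `|w|` at which `g` and `w` have the
exponents `a` and `c`. -/
noncomputable def fixedSign (r : ℕ) (a c : ZMod r) : ℚ :=
  if Odd r then 1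
  else if ∃ k, k < r / 2 ∧ c.val = 2 * k + 1 ∧ r / 2 ≤ (a + (k : ZMod r)).val then -1 else 1

theorem fixedSign_add [NeZero r] (a b c : ZMod r) :
    fixedSign r (a + b) c = fixedSign r a (b + c + b) * fixedSign r b c := by
  unfold fixedSign
  by_cases hr : Odd r
  · simp [hr]
  · simp only [if_neg hr]
    exact sign_residue hr a b c

theorem fixedSign_zero [NeZero r] (c : ZMod r) : fixedSign r 0 c = 1 := by
  unfold fixedSign
  split_ifs with hr h
  · rfl
  · obtain ⟨k, hk, -, h⟩ := h
    rw [zero_add, ZMod.val_natCast, Nat.mod_eq_of_lt (by omega)] at h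
    omega
  · rfl

theorem two_mul_val_eq [NeZero r] {a : ZMod r} (h : a + a = 0) (ha : a ≠ 0) :
    2 * a.val = r := by
  have h1 := congrArg ZMod.val h
  rw [ZMod.val_add, ZMod.val_zero] at h1
  have h2 := ZMod.val_lt a
  have h3 : a.val ≠ 0 := fun h0 => ha ((ZMod.val_eq_zero a).mp h0)
  obtain ⟨c, hc⟩ := Nat.dvd_of_mod_eq_zero h1
  have h4 : c = 1 := by
    have : c < 2 := by
      by_contra hc2
      have : r * 2 ≤ r * c := Nat.mul_le_mul_left r (by omega)
      omega
    have : c ≠ 0 := by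
      rintro rfl
      omega
    omega
  rw [h4] at hc
  omega

theorem fixedSign_half [NeZero r] {a : ZMod r} (h : 2 * a.val = r) (c : ZMod r) :
    fixedSign r a c = if Even c.val then 1 else -1 := by
  have hr : ¬ Odd r := by
    rw [Nat.not_odd_iff_even]
    exact ⟨a.val, by omega⟩
  have hc := ZMod.val_lt c
  unfold fixedSign
  rw [if_neg hr]
  by_cases h1 : Even c.val
  · rw [if_pos h1, if_neg]
    rintro ⟨k, -, hk, -⟩
    exact Nat.not_odd_iff_even.mpr h1 ⟨k, hk⟩
  · rw [if_neg h1, if_pos]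
    obtain ⟨k, hk⟩ := Nat.not_even_iff_odd.mp h1
    refine ⟨k, by omega, hk, ?_⟩
    rw [ZMod.val_add, ZMod.val_natCast, Nat.mod_eq_of_lt (a := k) (by omega),
      Nat.mod_eq_of_lt (by omega)]
    omega

theorem even_val_add_one_iff [NeZero r] (hr : Even r) (c : ZMod r) :
    Even (c + 1).val ↔ ¬ Even c.val := by
  have hr0 := NeZero.pos r
  obtain ⟨m, hm⟩ := hr
  have hc := ZMod.val_lt c
  have h1 : (1 : ZMod r).val = 1 := ZMod.val_one'' (by omega)
  rw [ZMod.val_add, h1]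
  rcases lt_or_ge (c.val + 1) r with h | h
  · rw [Nat.mod_eq_of_lt h, Nat.even_add_one]
  · have : c.val + 1 = r := by omega
    rw [this, Nat.mod_self]
    have : Odd c.val := ⟨m - 1, by omega⟩
    simp [this]

open Classical in
/-- The contribution of the index `i` to `modelSign g w`. -/
noncomputable def localSign (g w : Wreath r n) (i : Fin n) : ℚ :=
  if w.perm i = i then fixedSign r (g.z i) (w.z i)
  else if i < w.perm i ∧ g.perm (w.perm i) < g.perm i then -1 else 1

theorem modelSign_eq_prod (g w : Wreath r n) (hw : ∀ i, w.perm (w.perm i) = i) :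
    modelSign g w = ∏ i, localSign g w i := by
  classical
  have h1 : ((-1 : ℚ)) ^ (signSet g w).card =
      ∏ i, if w.perm i = i then fixedSign r (g.z i) (w.z i) else 1 := by
    unfold signSet fixedSign
    by_cases hr : Odd r
    · simp [hr]
    · simp only [if_neg hr, ← ite_and]
      rw [Finset.prod_ite, Finset.prod_const, Finset.prod_const_one, mul_one]
  have h2 : ((-1 : ℚ)) ^ (invSet g.perm ∩ pairSet w.perm).card =
      ∏ i, if i < w.perm i ∧ g.perm (w.perm i) < g.perm i then (-1 : ℚ) else 1 := by
    rw [Finset.prod_ite, Finset.prod_const, Finset.prod_const_one, mul_one]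
    congr 1
    refine Finset.card_bij' (fun q _ => q.1) (fun i _ => (i, w.perm i)) ?_ ?_ ?_ ?_
    · rintro ⟨i, j⟩ hq
      simp only [invSet, pairSet, Finset.mem_inter, Finset.mem_filter, Finset.mem_univ,
        true_and] at hq ⊢
      rw [hq.2.2.1]
      exact ⟨hq.1.1, hq.1.2⟩
    · intro i hi
      simp only [invSet, pairSet, Finset.mem_inter, Finset.mem_filter, Finset.mem_univ,
        true_and] at hi ⊢
      exact ⟨hi, hi.1, hw i⟩
    · rintro ⟨i, j⟩ hq
      simp only [invSet, pairSet, Finset.mem_inter, Finset.mem_filter, Finset.mem_univ,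
        true_and] at hq ⊢
      rw [hq.2.2.1]
    · intro i hi
      rfl
  rw [modelSign, h1, h2, ← Finset.prod_mul_distrib]
  refine Finset.prod_congr rfl fun i _ => ?_
  unfold localSign
  by_cases hi : w.perm i = i
  · simp [hi]
  · simp [hi]

/-- `1` at the smaller and `-1` at the larger element of a `2`-cycle of `|w|`. -/
def orderSign (w : Wreath r n) (i : Fin n) : ℚ := if i < w.perm i then 1 else -1

theorem orderSign_mul_self (w : Wreath r n) (i : Fin n) : orderSign w i * orderSign w i = 1 := by
  unfold orderSign
  split_ifs <;> norm_num

/-- The sign of a `2`-cycle of `|w|` is a coboundary, hence telescopes along the cycles of `|g|`. -/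
theorem localSign_mul_localSign {g w : Wreath r n} (hw : ∀ i, w.perm (w.perm i) = i)
    (hc : ∀ i, g.perm (w.perm i) = w.perm (g.perm i)) {i : Fin n} (hi : w.perm i ≠ i) :
    localSign g w i * localSign g w (w.perm i) = orderSign w i * orderSign w (g.perm i) := by
  have h1 : w.perm (w.perm i) ≠ w.perm i := by rw [hw]; exact hi.symm
  have h2 : g.perm (w.perm i) ≠ g.perm i := fun h => hi (g.perm.injective h)
  unfold localSign orderSign
  rw [if_neg hi, if_neg h1, hw, ← hc]
  rcases lt_or_gt_of_ne hi with h3 | h3 <;> rcases lt_or_gt_of_ne h2 with h4 | h4 <;>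
    simp [h3, h4, h3.not_gt, h4.not_gt]

/-- The number of elements of the cycle through `a`. -/
noncomputable def cycleLen (g : Wreath r n) (a : Fin n) : ℕ := Function.minimalPeriod g.perm a

theorem perm_zpow_eq_iff (g : Wreath r n) (a : Fin n) (m : ℤ) :
    (g.perm ^ m) a = a ↔ (g.cycleLen a : ℤ) ∣ m :=
  MulAction.zpow_smul_eq_iff_period_dvd (g := g.perm) (a := a)

theorem cycleLen_pos (g : Wreath r n) (a : Fin n) : 0 < g.cycleLen a :=
  Function.minimalPeriod_pos_of_mem_periodicPts
    (g.perm.injective.mem_periodicPts a)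

open Classical in
theorem prod_cycle (g : Wreath r n) (a : Fin n) (F : Fin n → ℚ) :
    ∏ i with g.perm.SameCycle a i, F i = ∏ t ∈ Finset.range (g.cycleLen a), F ((g.perm ^ t) a) := by
  symm
  refine Finset.prod_nbij (fun t => (g.perm ^ t) a) ?_ ?_ ?_ fun t _ => rfl
  · intro t _
    exact Finset.mem_filter.mpr ⟨Finset.mem_univ _, t, by simp⟩
  · intro t ht u hu htu
    have h1 : (g.perm ^ ((t : ℤ) - u)) a = a := by
      have htu' : (g.perm ^ t) a = (g.perm ^ u) a := htu
      rw [sub_eq_neg_add, zpow_add, Equiv.Perm.mul_apply, zpow_natCast, htu', ← zpow_natCast,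
        ← Equiv.Perm.mul_apply, ← zpow_add, neg_add_cancel, zpow_zero, Equiv.Perm.one_apply]
    rw [perm_zpow_eq_iff] at h1
    have ht' : t < g.cycleLen a := by simpa using ht
    have hu' : u < g.cycleLen a := by simpa using hu
    have := Int.eq_zero_of_abs_lt_dvd h1 (by rw [abs_lt]; omega)
    omega
  · intro i hi
    obtain ⟨m, hm⟩ := (Finset.mem_filter.mp hi).2
    have hpos : (0 : ℤ) < g.cycleLen a := by exact_mod_cast g.cycleLen_pos a
    have h0 := Int.emod_nonneg m hpos.ne'
    have h1 := Int.emod_lt_of_pos m hpos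
    refine ⟨(m % (g.cycleLen a : ℤ)).toNat, ?_, ?_⟩
    · simp only [Finset.coe_range, Set.mem_Iio]
      omega
    · change (g.perm ^ (m % (g.cycleLen a : ℤ)).toNat) a = i
      rw [← zpow_natCast, Int.toNat_of_nonneg h0, ← hm, Int.emod_def, sub_eq_add_neg, zpow_add,
        Equiv.Perm.mul_apply, (g.perm_zpow_eq_iff a _).mpr ((dvd_mul_right _ _).neg_right)]

open Classical in
/-- The sign contributed by a cycle that `|f|` fixes pointwise. -/
theorem prod_localSign_of_fixed [NeZero r] {g f : Wreath r n} (h : AntiCommute g f) {a : Fin n}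
    (ha : f.perm a = a) : ∏ i with g.perm.SameCycle a i, localSign g f i =
      fixedSign r ((g ^ g.cycleLen a).z a) (f.z a) := by
  have hfix : ∀ t : ℕ, f.perm ((g.perm ^ t) a) = (g.perm ^ t) a := by
    intro t
    have := h.perm_zpow t a
    rw [ha, zpow_natCast] at this
    exact this.symm
  rw [prod_cycle]
  generalize g.cycleLen a = N
  induction N with
  | zero => simp [fixedSign_zero]
  | succ N ih =>
    have h1 : f.z ((g.perm ^ N) a) = (g ^ N).z a + f.z a + (g ^ N).z a := by
      have := h.z_zpow N a
      rw [ha, zpow_natCast, zpow_natCast, eq_sub_iff_add_eq] at this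
      exact this.symm
    rw [Finset.prod_range_succ, ih, pow_succ', mul_z, fixedSign_add, localSign, if_pos (hfix N),
      pow_perm, h1, mul_comm]

open Classical in
/-- The sign contributed by a cycle that `|f|` rotates by half a turn. -/
theorem prod_localSign_of_half {g f : Wreath r n} (h : AntiCommute g f)
    (hf : ∀ i, f.perm (f.perm i) = i) {a : Fin n} {m : ℕ} (hm : (g.perm ^ m) a = f.perm a)
    (hlen : g.cycleLen a = m + m) : ∏ i with g.perm.SameCycle a i, localSign g f i = -1 := by
  have hpos := g.cycleLen_pos a
  have hcomm : ∀ t : ℕ, f.perm ((g.perm ^ t) a) = (g.perm ^ (m + t)) a := by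
    intro t
    have := h.perm_zpow t a
    rw [zpow_natCast] at this
    rw [← this, ← hm, ← Equiv.Perm.mul_apply, ← pow_add, add_comm]
  have hne : ∀ t : ℕ, f.perm ((g.perm ^ t) a) ≠ (g.perm ^ t) a := by
    intro t ht
    rw [hcomm, add_comm, pow_add, Equiv.Perm.mul_apply, (g.perm ^ t).injective.eq_iff,
      ← zpow_natCast, perm_zpow_eq_iff, Int.natCast_dvd_natCast] at ht
    have := Nat.le_of_dvd (by omega) ht
    omega
  rw [prod_cycle, hlen, Finset.prod_range_add, ← Finset.prod_mul_distrib]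
  have hprod : ∀ M : ℕ, ∏ t ∈ Finset.range M, localSign g f ((g.perm ^ t) a) *
      localSign g f ((g.perm ^ (m + t)) a) = orderSign f a * orderSign f ((g.perm ^ M) a) := by
    intro M
    induction M with
    | zero => simp [orderSign_mul_self]
    | succ M ih =>
      rw [Finset.prod_range_succ, ih, ← hcomm, localSign_mul_localSign hf h.perm (hne M),
        mul_assoc, ← mul_assoc (orderSign f ((g.perm ^ M) a)), orderSign_mul_self, one_mul,
        pow_succ', Equiv.Perm.mul_apply]
  rw [hprod, hm]
  have h0 : f.perm a ≠ a := by simpa using hne 0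
  unfold orderSign
  rw [hf]
  rcases lt_or_gt_of_ne h0 with h1 | h1 <;> simp [h1, h1.not_gt]

end Wreath

/-! ### Cancellation of the stable cycles of even period -/

namespace Wreath

variable {r n : ℕ}

open Equiv.Perm

theorem SymmFixed.perm_perm {g f : Wreath r n} (h : SymmFixed g f) (i : Fin n) :
    f.perm (f.perm i) = i := ((mul_bar_eq_one_iff f).mp h.1).1 i

theorem SymmFixed.pointPeriod_dvd {g f : Wreath r n} (h : SymmFixed g f) {i : Fin n} {m : ℤ}
    (hm : (g.perm ^ m) i = f.perm i) : (g.pointPeriod i : ℤ) ∣ 2 * m := by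
  have := pointPeriod_dvd_of_stable h.2 (a := 0) (by rw [h.1, zpow_zero]) hm
  rwa [sub_zero] at this

theorem SymmFixed.z_cycleLen {g f : Wreath r n} (h : SymmFixed g f) {i : Fin n}
    (hi : f.perm i = i) : (g ^ g.cycleLen i).z i + (g ^ g.cycleLen i).z i = 0 := by
  have h1 := h.2.z_zpow (g.cycleLen i) i
  have h2 : (g.perm ^ (g.cycleLen i : ℤ)) i = i := (perm_zpow_eq_iff g i _).mpr dvd_rfl
  rw [hi, h2, zpow_natCast, eq_sub_iff_add_eq, add_right_comm, add_eq_right] at h1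
  exact h1

theorem SymmFixed.perm_eq_of_oddStable {g f : Wreath r n} (h : SymmFixed g f)
    (ho : OddStable g f) {i : Fin n} (hi : Stable g f i) : f.perm i = i := by
  obtain ⟨m, hm⟩ := hi
  have h1 := h.pointPeriod_dvd hm
  have h2 : (g.pointPeriod i : ℤ) ∣ m := by
    refine IsCoprime.dvd_of_dvd_mul_left ?_ h1
    rw [Int.isCoprime_iff_gcd_eq_one]
    have : Nat.Coprime (g.pointPeriod i) 2 := Nat.coprime_two_right.mpr (ho i ⟨m, hm⟩)
    exact_mod_cast this
  rw [← hm, ((g.pointPeriod_dvd_iff i m).mp h2).1]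

theorem SymmFixed.z_cycleLen_eq_zero {g f : Wreath r n} (h : SymmFixed g f)
    (ho : OddStable g f) {i : Fin n} (hi : Stable g f i) : (g ^ g.cycleLen i).z i = 0 := by
  have h1 := h.perm_eq_of_oddStable ho hi
  have h2 := h.z_cycleLen h1
  have h3 : (g.perm ^ (g.cycleLen i : ℤ)) i = i := (perm_zpow_eq_iff g i _).mpr dvd_rfl
  have h4 : (g.pointPeriod i : ℤ) ∣ 2 * g.cycleLen i := by
    rw [pointPeriod_dvd_iff, two_mul, zpow_add, zpow_add, Equiv.Perm.mul_apply, h3, mul_z,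
      zpow_perm, h3, zpow_natCast]
    exact ⟨rfl, h2⟩
  have h5 : (g.pointPeriod i : ℤ) ∣ g.cycleLen i := by
    refine IsCoprime.dvd_of_dvd_mul_left ?_ h4
    rw [Int.isCoprime_iff_gcd_eq_one]
    have : Nat.Coprime (g.pointPeriod i) 2 := Nat.coprime_two_right.mpr (ho i hi)
    exact_mod_cast this
  have := ((g.pointPeriod_dvd_iff i _).mp h5).2
  rwa [zpow_natCast] at this

open Classical in
/-- Without stable cycles of even period the sign is trivial: `|f|` fixes the stable cycles
pointwise, and on an interchanged pair of cycles the signs of the `2`-cycles telescope. -/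
theorem modelSign_eq_one_of_oddStable [NeZero r] {g f : Wreath r n} (h : SymmFixed g f)
    (ho : OddStable g f) : modelSign g f = 1 := by
  rw [modelSign_eq_prod g f h.perm_perm,
    ← Finset.prod_filter_mul_prod_filter_not Finset.univ (fun i => Stable g f i)]
  have h1 : ∏ i with Stable g f i, localSign g f i = 1 := by
    rw [← Finset.prod_fiberwise _ (cycleRep g.perm)]
    refine Finset.prod_eq_one fun c _ => ?_
    by_cases hc : ∃ i, Stable g f i ∧ cycleRep g.perm i = c
    · obtain ⟨a, ha, rfl⟩ := hc
      have h2 : (Finset.univ.filter fun i => Stable g f i).filter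
          (fun i => cycleRep g.perm i = cycleRep g.perm a) =
            Finset.univ.filter fun i => g.perm.SameCycle a i := by
        ext i
        simp only [Finset.mem_filter, Finset.mem_univ, true_and, cycleRep_eq_iff]
        exact ⟨fun hi => hi.2.symm, fun hi => ⟨ha.congr_sameCycle h.2 hi, hi.symm⟩⟩
      rw [h2, prod_localSign_of_fixed h.2 (h.perm_eq_of_oddStable ho ha),
        h.z_cycleLen_eq_zero ho ha, fixedSign_zero]
    · refine Finset.prod_eq_one fun i hi => (hc ⟨i, ?_⟩).elim
      simpa using hi
  have h2 : ∏ i with ¬ Stable g f i, localSign g f i = 1 := by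
    -- the indices in the lower cycle of each interchanged pair of cycles
    let T := Finset.univ.filter fun i : Fin n =>
      ¬ Stable g f i ∧ cycleRep g.perm i < cycleRep g.perm (f.perm i)
    have hns : ∀ i, Stable g f (f.perm i) ↔ Stable g f i := stable_perm_iff h.2
    have hlower : (Finset.univ.filter fun i => ¬ Stable g f i).filter
        (fun i => cycleRep g.perm i < cycleRep g.perm (f.perm i)) = T := by
      rw [Finset.filter_filter]
    rw [← Finset.prod_filter_mul_prod_filter_not _
      (fun i => cycleRep g.perm i < cycleRep g.perm (f.perm i)), hlower]
    have hupper : ∏ i ∈ (Finset.univ.filter fun i => ¬ Stable g f i) with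
        ¬ cycleRep g.perm i < cycleRep g.perm (f.perm i), localSign g f i =
        ∏ i ∈ T, localSign g f (f.perm i) := by
      refine Finset.prod_nbij' f.perm f.perm ?_ ?_ (fun i _ => h.perm_perm i)
        (fun i _ => h.perm_perm i) (fun i _ => by rw [h.perm_perm])
      · intro i hi
        simp only [Finset.mem_filter, Finset.mem_univ, true_and, T] at hi ⊢
        rw [hns, h.perm_perm]
        exact ⟨hi.1, lt_of_le_of_ne (not_lt.mp hi.2) fun hc =>
          hi.1 ((cycleRep_eq_iff _ _ _).mp hc).symm⟩
      · intro i hi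
        simp only [Finset.mem_filter, Finset.mem_univ, true_and, T] at hi ⊢
        rw [hns, h.perm_perm]
        exact ⟨hi.1, hi.2.not_gt⟩
    rw [hupper, ← Finset.prod_mul_distrib]
    have hne : ∀ i ∈ T, f.perm i ≠ i := by
      intro i hi hfi
      simp only [Finset.mem_filter, Finset.mem_univ, true_and, T] at hi
      exact hi.1 (by rw [Stable, hfi])
    rw [Finset.prod_congr rfl fun i hi => localSign_mul_localSign h.perm_perm h.2.perm (hne i hi),
      Finset.prod_mul_distrib]
    -- `T` is a union of cycles of `|g|`
    have hshift : ∏ i ∈ T, orderSign f (g.perm i) = ∏ i ∈ T, orderSign f i := by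
      have hT : ∀ i, g.perm i ∈ T ↔ i ∈ T := by
        intro i
        have e0 : g.perm.SameCycle i (g.perm i) := sameCycle_apply_right.mpr (SameCycle.refl _ _)
        have e1 : cycleRep g.perm (g.perm i) = cycleRep g.perm i :=
          (cycleRep_eq_iff _ _ _).mpr e0.symm
        have e2 : cycleRep g.perm (f.perm (g.perm i)) = cycleRep g.perm (f.perm i) := by
          rw [cycleRep_eq_iff, ← h.2.perm, sameCycle_apply_left]
        simp only [Finset.mem_filter, Finset.mem_univ, true_and, T, e1, e2]
        exact and_congr_left fun _ => not_congr
          ⟨Stable.congr_sameCycle h.2 e0.symm, Stable.congr_sameCycle h.2 e0⟩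
      refine Finset.prod_nbij g.perm (fun i hi => (hT i).mpr hi) g.perm.injective.injOn ?_
        fun i _ => rfl
      intro i hi
      refine ⟨g.perm.symm i, ?_, by simp⟩
      have := hT (g.perm.symm i)
      rw [Equiv.apply_symm_apply] at this
      exact this.mp hi
    rw [hshift, ← Finset.prod_mul_distrib]
    exact Finset.prod_eq_one fun i _ => orderSign_mul_self f i
  rw [h1, h2, mul_one]

open Classical in
/-- Two symmetric elements that differ only on one cycle, on which their signs are opposite,
cancel. -/
theorem modelSign_eq_neg_of_cycle {g f f' : Wreath r n} (h : SymmFixed g f)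
    (h' : SymmFixed g f') (a : Fin n)
    (hoff : ∀ i, ¬ g.perm.SameCycle a i → f'.perm i = f.perm i ∧ f'.z i = f.z i)
    (hon : ∏ i with g.perm.SameCycle a i, localSign g f' i =
      -∏ i with g.perm.SameCycle a i, localSign g f i) :
    modelSign g f + modelSign g f' = 0 := by
  rw [modelSign_eq_prod g f h.perm_perm, modelSign_eq_prod g f' h'.perm_perm,
    ← Finset.prod_filter_mul_prod_filter_not Finset.univ (fun i => g.perm.SameCycle a i),
    ← Finset.prod_filter_mul_prod_filter_not Finset.univ (fun i => g.perm.SameCycle a i)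
      (fun i => localSign g f' i), hon]
  have : ∏ i with ¬ g.perm.SameCycle a i, localSign g f' i =
      ∏ i with ¬ g.perm.SameCycle a i, localSign g f i := by
    refine Finset.prod_congr rfl fun i hi => ?_
    obtain ⟨h1, h2⟩ := hoff i (Finset.mem_filter.mp hi).2
    simp only [localSign, h1, h2]
  rw [this]
  ring

open Classical in
/-- The points in stable cycles of even period. -/
noncomputable def evenStablePts (g f : Wreath r n) : Finset (Fin n) :=
  Finset.univ.filter fun i => Stable g f i ∧ Even (g.pointPeriod i)

theorem evenStablePts_congr {g f f' : Wreath r n} (h : ∀ i, Stable g f i ↔ Stable g f' i) :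
    evenStablePts g f = evenStablePts g f' := by
  ext i
  simp only [evenStablePts, Finset.mem_filter, h]

theorem oddStable_iff (g f : Wreath r n) : OddStable g f ↔ evenStablePts g f = ∅ := by
  classical
  unfold OddStable evenStablePts
  rw [Finset.filter_eq_empty_iff]
  simp only [Finset.mem_univ, true_implies, not_and, Nat.not_even_iff_odd]

open Classical in
/-- Change the parity of the exponents of `f` on the cycle of `g` through `a`. -/
noncomputable def toggleParity (g : Wreath r n) (a : Fin n) (f : Wreath r n) : Wreath r n :=
  ⟨fun i => f.z i + if g.perm.SameCycle a i then (if Even (f.z a).val then 1 else -1) else 0,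
    f.perm⟩

theorem toggleParity_toggleParity [NeZero r] (hr : Even r) (g : Wreath r n) (a : Fin n)
    (f : Wreath r n) : toggleParity g a (toggleParity g a f) = f := by
  classical
  have ha : g.perm.SameCycle a a := SameCycle.refl _ _
  have h1 : Even ((toggleParity g a f).z a).val ↔ ¬ Even (f.z a).val := by
    simp only [toggleParity, if_pos ha]
    by_cases he : Even (f.z a).val
    · rw [if_pos he, even_val_add_one_iff hr]
    · have h2 := even_val_add_one_iff hr (f.z a + -1)
      rw [neg_add_cancel_right] at h2
      simp only [he, if_false, not_false_eq_true, iff_true]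
      by_contra hc
      exact he (h2.mpr hc)
  ext i
  · change (toggleParity g a f).z i + (if g.perm.SameCycle a i then
      (if Even ((toggleParity g a f).z a).val then 1 else -1) else 0) = f.z i
    by_cases hi : g.perm.SameCycle a i
    · simp only [if_pos hi, h1]
      simp only [toggleParity, if_pos hi]
      by_cases he : Even (f.z a).val <;> simp [he]
    · simp [toggleParity, hi]
  · rfl

theorem stable_toggleParity_iff (g : Wreath r n) (a : Fin n) (f : Wreath r n) (i : Fin n) :
    Stable g (toggleParity g a f) i ↔ Stable g f i := Iff.rfl

theorem SymmFixed.toggleParity {g f : Wreath r n} (h : SymmFixed g f) {a : Fin n}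
    (ha : Stable g f a) : SymmFixed g (toggleParity g a f) := by
  classical
  obtain ⟨h1, h2⟩ := (mul_bar_eq_one_iff f).mp h.1
  obtain ⟨h3, h4⟩ := (antiCommute_iff g f).mp h.2
  have hs : ∀ i, g.perm.SameCycle a (f.perm i) ↔ g.perm.SameCycle a i := by
    intro i
    constructor
    · intro hi
      have h5 : Stable g f i := (stable_perm_iff h.2 i).mp (ha.congr_sameCycle h.2 hi)
      exact hi.trans h5.symm
    · intro hi
      exact hi.trans (ha.congr_sameCycle h.2 hi)
  constructor
  · rw [mul_bar_eq_one_iff]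
    refine ⟨h1, fun i => ?_⟩
    change f.z (f.perm i) + (if g.perm.SameCycle a (f.perm i) then _ else _) = f.z i + _
    simp only [hs, h2]
  · rw [antiCommute_iff]
    refine ⟨h3, fun i => ?_⟩
    change g.z (f.perm i) + (f.z i + _) =
      f.z (g.perm i) + (if g.perm.SameCycle a (g.perm i) then _ else _) - g.z i
    simp only [sameCycle_apply_right]
    rw [← add_assoc, h4]
    ring

/-- On a stable cycle `|f|` is trivial or half a turn; the second case needs `g` to act on the
cycle with total exponent zero. -/
theorem SymmFixed.perm_eq_or_half {g f : Wreath r n} (h : SymmFixed g f) {a : Fin n}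
    (ha : Stable g f a) : f.perm a = a ∨ ∃ m : ℕ, (g.perm ^ m) a = f.perm a ∧
      g.cycleLen a = m + m ∧ (g ^ g.cycleLen a).z a = 0 := by
  obtain ⟨l, hl⟩ := ha
  have hpos : (0 : ℤ) < g.cycleLen a := by exact_mod_cast g.cycleLen_pos a
  have h0 := Int.emod_nonneg l hpos.ne'
  have h1 := Int.emod_lt_of_pos l hpos
  obtain ⟨m, hm⟩ := Int.eq_ofNat_of_zero_le h0
  have hm' : (g.perm ^ m) a = f.perm a := by
    rw [← zpow_natCast, ← hm, ← hl, Int.emod_def, sub_eq_add_neg, zpow_add,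
      Equiv.Perm.mul_apply, (g.perm_zpow_eq_iff a _).mpr ((dvd_mul_right _ _).neg_right)]
  have h2 := h.pointPeriod_dvd (m := m) (by rw [zpow_natCast]; exact hm')
  obtain ⟨h3, h4⟩ := (g.pointPeriod_dvd_iff a _).mp h2
  obtain ⟨c, hc⟩ := (g.perm_zpow_eq_iff a _).mp h3
  have hc0 : 0 ≤ c := by
    by_contra hneg
    have := mul_neg_of_pos_of_neg hpos (not_le.mp hneg)
    omega
  have hc2 : c < 2 := by
    by_contra hge
    have := mul_le_mul_of_nonneg_left (not_lt.mp hge) hpos.le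
    omega
  obtain rfl | rfl : c = 0 ∨ c = 1 := by omega
  · left
    have : m = 0 := by omega
    rw [← hm', this, pow_zero, Equiv.Perm.one_apply]
  · right
    have hlen : g.cycleLen a = m + m := by omega
    refine ⟨m, hm', hlen, ?_⟩
    rw [← zpow_natCast, show ((g.cycleLen a : ℕ) : ℤ) = 2 * m by omega]
    exact h4

/-- If `g` acts on the stable cycle with nonzero total exponent, then this exponent is `r / 2`, and
the sign of the cycle is `1` or `-1` according to the parity of the exponent of `f`. -/
theorem toggleParity_add_modelSign [NeZero r] {g f : Wreath r n} (h : SymmFixed g f) {a : Fin n}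
    (ha : Stable g f a) (hz : (g ^ g.cycleLen a).z a ≠ 0) :
    Even r ∧ modelSign g f + modelSign g (toggleParity g a f) = 0 := by
  classical
  have hfix : f.perm a = a := by
    rcases h.perm_eq_or_half ha with h1 | ⟨m, -, -, h1⟩
    · exact h1
    · exact absurd h1 hz
  have hhalf := two_mul_val_eq (h.z_cycleLen hfix) hz
  have hr : Even r := ⟨_, by rw [← two_mul]; exact hhalf.symm⟩
  refine ⟨hr, modelSign_eq_neg_of_cycle h (h.toggleParity ha) a (fun i hi => ⟨rfl, ?_⟩) ?_⟩
  · simp [toggleParity, hi]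
  · have hfix' : (toggleParity g a f).perm a = a := hfix
    rw [prod_localSign_of_fixed (h.toggleParity ha).2 hfix', prod_localSign_of_fixed h.2 hfix,
      fixedSign_half hhalf, fixedSign_half hhalf]
    simp only [toggleParity, if_pos (SameCycle.refl g.perm a)]
    by_cases he : Even (f.z a).val
    · simp only [if_pos he]
      rw [if_neg fun hc => (even_val_add_one_iff hr _).mp hc he]
    · have h2 := even_val_add_one_iff hr (f.z a + -1)
      rw [neg_add_cancel_right] at h2
      simp only [if_neg he]
      rw [if_pos (by_contra fun hc => he (h2.mpr hc)), neg_neg]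

open Classical in
/-- Half the length of the cycle of `g` through `a`, as a function supported on that cycle. -/
noncomputable def halfCycle (g : Wreath r n) (a : Fin n) : cycleFun g.perm :=
  ⟨fun i => if g.perm.SameCycle a i then ((g.cycleLen a / 2 : ℕ) : ℤ) else 0, fun i => by
    simp only [sameCycle_apply_right]⟩

theorem pointPeriod_sameCycle {g : Wreath r n} {a i : Fin n} (h : g.perm.SameCycle a i) :
    g.pointPeriod i = g.pointPeriod a := by
  let k : cycleFun g.perm := ⟨fun i => g.pointPeriod i, fun i => by
    change ((g.pointPeriod (g.perm i) : ℕ) : ℤ) = g.pointPeriod i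
    rw [pointPeriod_perm]⟩
  obtain ⟨m, rfl⟩ := h
  exact Int.natCast_inj.mp (cycleFun_zpow_apply k m a)

theorem pointPeriod_eq_cycleLen {g : Wreath r n} {a : Fin n}
    (hz : (g ^ g.cycleLen a).z a = 0) : g.pointPeriod a = g.cycleLen a := by
  apply Nat.dvd_antisymm
  · rw [← Int.natCast_dvd_natCast, pointPeriod_dvd_iff, zpow_natCast, zpow_natCast]
    exact ⟨by rw [← zpow_natCast, perm_zpow_eq_iff], hz⟩
  · rw [← Int.natCast_dvd_natCast, ← perm_zpow_eq_iff]
    exact ((g.pointPeriod_dvd_iff a _).mp dvd_rfl).1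

theorem halfCycle_mul_halfCycle_mul {g : Wreath r n} {a : Fin n}
    (hz : (g ^ g.cycleLen a).z a = 0) (he : Even (g.cycleLen a)) (f : Wreath r n) :
    g.cyclePow (halfCycle g a) * (g.cyclePow (halfCycle g a) * f) = f := by
  classical
  rw [← mul_assoc, ← cyclePow_add, cyclePow_congr g _ 0, cyclePow_zero, one_mul]
  intro i
  change _ ∣ (if g.perm.SameCycle a i then ((g.cycleLen a / 2 : ℕ) : ℤ) else 0) +
    (if g.perm.SameCycle a i then ((g.cycleLen a / 2 : ℕ) : ℤ) else 0) - 0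
  by_cases hi : g.perm.SameCycle a i
  · obtain ⟨q, hq⟩ := he
    rw [if_pos hi, pointPeriod_sameCycle hi, pointPeriod_eq_cycleLen hz]
    exact ⟨1, by omega⟩
  · simp [hi]

theorem SymmFixed.halfCycle_mul {g f : Wreath r n} (h : SymmFixed g f) {a : Fin n}
    (ha : Stable g f a) (hz : (g ^ g.cycleLen a).z a = 0) (he : Even (g.cycleLen a)) :
    SymmFixed g (g.cyclePow (halfCycle g a) * f) := by
  classical
  refine ⟨?_, h.2.cyclePow_left _⟩
  have hk : h.2.cycleFunComp (halfCycle g a) = halfCycle g a := by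
    refine Subtype.ext (funext fun i => ?_)
    change (if g.perm.SameCycle a (f.perm i) then _ else _) = if g.perm.SameCycle a i then _ else _
    refine if_congr ⟨fun hi => ?_, fun hi => ?_⟩ rfl rfl
    · exact hi.trans ((stable_perm_iff h.2 i).mp (ha.congr_sameCycle h.2 hi)).symm
    · exact hi.trans (ha.congr_sameCycle h.2 hi)
  refine (h.2.cyclePow_mul_mul_bar _ fun i => by rw [h.perm_perm]).trans
    ((congrArg₂ (· * ·) ?_ h.1).trans (mul_one 1))
  have h1 := halfCycle_mul_halfCycle_mul hz he 1
  rw [mul_one, ← cyclePow_add] at h1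
  rw [hk, h1]

/-- If `g` acts on the stable cycle, of even length, with total exponent zero, then `|f|` fixes this
cycle or rotates it by half a turn, and the two cases have opposite signs. -/
theorem halfCycle_mul_add_modelSign [NeZero r] {g f : Wreath r n} (h : SymmFixed g f) {a : Fin n}
    (ha : Stable g f a) (hz : (g ^ g.cycleLen a).z a = 0) (he : Even (g.cycleLen a)) :
    modelSign g f + modelSign g (g.cyclePow (halfCycle g a) * f) = 0 := by
  classical
  have h' := h.halfCycle_mul ha hz he
  obtain ⟨q, hq⟩ := he
  have hpa : (g.cyclePow (halfCycle g a) * f).perm a = (g.perm ^ q) (f.perm a) := by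
    change (g.perm ^ (if g.perm.SameCycle a (f.perm a) then _ else _)) (f.perm a) = _
    rw [if_pos (show g.perm.SameCycle a (f.perm a) from ha), zpow_natCast, hq]
    congr 2
    omega
  refine modelSign_eq_neg_of_cycle h h' a (fun i hi => ?_) ?_
  · have hi' : ¬ g.perm.SameCycle a (f.perm i) := fun hc =>
      hi (hc.trans ((stable_perm_iff h.2 i).mp (ha.congr_sameCycle h.2 hc)).symm)
    constructor
    · change (g.perm ^ (if g.perm.SameCycle a (f.perm i) then _ else _)) (f.perm i) = _
      rw [if_neg hi', zpow_zero, Equiv.Perm.one_apply]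
    · change (g ^ (if g.perm.SameCycle a (f.perm i) then _ else _)).z (f.perm i) + f.z i = _
      rw [if_neg hi', zpow_zero, one_z, zero_add]
  · rcases h.perm_eq_or_half ha with h1 | ⟨m, hm, hlen, -⟩
    · rw [prod_localSign_of_fixed h.2 h1, hz, fixedSign_zero,
        prod_localSign_of_half h'.2 h'.perm_perm (m := q) (by rw [hpa, h1]) hq]
    · have hmq : m = q := by omega
      have h2 : (g.cyclePow (halfCycle g a) * f).perm a = a := by
        rw [hpa, ← hm, hmq, ← Equiv.Perm.mul_apply, ← pow_add, ← hq, ← zpow_natCast,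
          perm_zpow_eq_iff]
      rw [prod_localSign_of_half h.2 h.perm_perm hm hlen, prod_localSign_of_fixed h'.2 h2, hz,
        fixedSign_zero, neg_neg]

open Classical in
/-- The symmetric elements fixed by `g` whose first point in a stable cycle of even period is `a`
cancel in pairs. -/
theorem sum_modelSign_of_min_eq [NeZero r] (g : Wreath r n) (a : Fin n) :
    ∑ f with SymmFixed g f ∧ (evenStablePts g f).min = a, modelSign g f = 0 := by
  have hne : ∀ f : Wreath r n, modelSign g f ≠ 0 := by
    intro f
    simp [modelSign]
  have hsa : ∀ f : Wreath r n, (evenStablePts g f).min = a →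
      Stable g f a ∧ Even (g.pointPeriod a) := fun f hf =>
    (Finset.mem_filter.mp (Finset.mem_of_min hf)).2
  by_cases hz : (g ^ g.cycleLen a).z a = 0
  · refine Finset.sum_involution (fun f _ => g.cyclePow (halfCycle g a) * f) ?_ ?_ ?_ ?_
    · intro f hf
      obtain ⟨h1, h2⟩ := (Finset.mem_filter.mp hf).2
      obtain ⟨h3, h4⟩ := hsa f h2
      rw [pointPeriod_eq_cycleLen hz] at h4
      exact halfCycle_mul_add_modelSign h1 h3 hz h4
    · intro f hf _ heq
      obtain ⟨h1, h2⟩ := (Finset.mem_filter.mp hf).2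
      obtain ⟨h3, h4⟩ := hsa f h2
      rw [pointPeriod_eq_cycleLen hz] at h4
      have h5 := halfCycle_mul_add_modelSign h1 h3 hz h4
      rw [heq, ← two_mul] at h5
      exact hne f ((mul_eq_zero.mp h5).resolve_left two_ne_zero)
    · intro f hf
      obtain ⟨h1, h2⟩ := (Finset.mem_filter.mp hf).2
      obtain ⟨h3, h4⟩ := hsa f h2
      rw [pointPeriod_eq_cycleLen hz] at h4
      refine Finset.mem_filter.mpr ⟨Finset.mem_univ _, h1.halfCycle_mul h3 hz h4, ?_⟩
      rw [← h2, evenStablePts_congr fun i => stable_cyclePow_mul_iff g f _ i]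
    · intro f hf
      obtain ⟨h3, h4⟩ := hsa f (Finset.mem_filter.mp hf).2.2
      rw [pointPeriod_eq_cycleLen hz] at h4
      exact halfCycle_mul_halfCycle_mul hz h4 f
  · refine Finset.sum_involution (fun f _ => toggleParity g a f) ?_ ?_ ?_ ?_
    · intro f hf
      obtain ⟨h1, h2⟩ := (Finset.mem_filter.mp hf).2
      exact (toggleParity_add_modelSign h1 (hsa f h2).1 hz).2
    · intro f hf _ heq
      obtain ⟨h1, h2⟩ := (Finset.mem_filter.mp hf).2
      have h5 := (toggleParity_add_modelSign h1 (hsa f h2).1 hz).2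
      rw [heq, ← two_mul] at h5
      exact hne f ((mul_eq_zero.mp h5).resolve_left two_ne_zero)
    · intro f hf
      obtain ⟨h1, h2⟩ := (Finset.mem_filter.mp hf).2
      refine Finset.mem_filter.mpr ⟨Finset.mem_univ _, h1.toggleParity (hsa f h2).1, ?_⟩
      rw [← h2, evenStablePts_congr fun i => stable_toggleParity_iff g a f i]
    · intro f hf
      obtain ⟨h1, h2⟩ := (Finset.mem_filter.mp hf).2
      exact toggleParity_toggleParity (toggleParity_add_modelSign h1 (hsa f h2).1 hz).1 g a f

open Classical in
/-- The character of the model at `g` counts the solutions of `f * bar f = g`. -/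
theorem sum_modelSign [NeZero r] (g : Wreath r n) :
    ∑ f with SymmFixed g f, modelSign g f =
      ((Finset.univ.filter fun f : Wreath r n => f * bar f = g).card : ℚ) := by
  rw [← card_oddStable_eq,
    ← Finset.sum_filter_add_sum_filter_not (Finset.univ.filter fun f => SymmFixed g f)
      (fun f => OddStable g f), Finset.filter_filter, Finset.filter_filter]
  have h1 : ∑ f with SymmFixed g f ∧ OddStable g f, modelSign g f =
      ((Finset.univ.filter fun f => SymmFixed g f ∧ OddStable g f).card : ℚ) := by
    rw [Finset.sum_congr rfl fun f hf => modelSign_eq_one_of_oddStable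
      (Finset.mem_filter.mp hf).2.1 (Finset.mem_filter.mp hf).2.2, Finset.sum_const, nsmul_one]
  have h2 : ∑ f with SymmFixed g f ∧ ¬ OddStable g f, modelSign g f = 0 := by
    rw [← Finset.sum_fiberwise_of_maps_to (fun f hf => Finset.mem_image_of_mem
      (fun f => (evenStablePts g f).min) hf)]
    refine Finset.sum_eq_zero fun y hy => ?_
    obtain ⟨f₀, hf₀, rfl⟩ := Finset.mem_image.mp hy
    have hne := (Finset.mem_filter.mp hf₀).2.2
    rw [oddStable_iff] at hne
    obtain ⟨a, ha⟩ := Finset.min_of_nonempty (Finset.nonempty_iff_ne_empty.mpr hne)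
    rw [Finset.filter_filter, ha, ← sum_modelSign_of_min_eq g a]
    refine Finset.sum_congr (Finset.filter_congr fun f _ => ?_) fun _ _ => rfl
    constructor
    · rintro ⟨⟨h1, -⟩, h2⟩
      exact ⟨h1, h2⟩
    · rintro ⟨h1, h2⟩
      refine ⟨⟨h1, fun ho => ?_⟩, h2⟩
      rw [oddStable_iff] at ho
      rw [ho] at h2
      cases h2
  rw [h1, h2, add_zero]

end Wreath

/-! ### Conjugacy of an element and its transpose -/

namespace Wreath

variable {r n : ℕ}

open Equiv.Perm

/-- `(g ^ j).z a + (g ^ (-j)).z a` depends only on the point `|g| ^ j a`, not on `j`. -/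
theorem zpow_z_congr (g : Wreath r n) {a : Fin n} {j k : ℤ}
    (h : (g.perm ^ j) a = (g.perm ^ k) a) :
    (g.perm ^ (-j)) a = (g.perm ^ (-k)) a ∧
      (g ^ j).z a + (g ^ (-j)).z a = (g ^ k).z a + (g ^ (-k)).z a := by
  have hd : (g.perm ^ (j - k)) a = a := by
    rw [sub_eq_neg_add, zpow_add, Equiv.Perm.mul_apply, h, ← Equiv.Perm.mul_apply, ← zpow_add,
      neg_add_cancel, zpow_zero, Equiv.Perm.one_apply]
  have hd' : (g.perm ^ (-(j - k))) a = a := by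
    rw [perm_zpow_eq_iff] at hd ⊢
    exact hd.neg_right
  have h1 : (g ^ (-(j - k))).z a + (g ^ (j - k)).z a = 0 := by
    have := congrArg (fun x => x.z a) (zpow_add g (-(j - k)) (j - k))
    rw [neg_add_cancel, zpow_zero] at this
    simp only [one_z, mul_z, zpow_perm, hd] at this
    exact this.symm
  have e1 : j = k + (j - k) := by ring
  have e2 : -j = -k + -(j - k) := by ring
  constructor
  · rw [e2, zpow_add, Equiv.Perm.mul_apply, hd']
  · have e3 : (g ^ j).z a = (g ^ k).z a + (g ^ (j - k)).z a := by
      conv_lhs => rw [e1]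
      rw [zpow_add, mul_z, zpow_perm, hd]
    have e4 : (g ^ (-j)).z a = (g ^ (-k)).z a + (g ^ (-(j - k))).z a := by
      conv_lhs => rw [e2]
      rw [zpow_add, mul_z, zpow_perm, hd']
    rw [e3, e4]
    linear_combination h1

/-- Every element is conjugate to its transpose: reversing each cycle of `g` is an antilinear map
that conjugates `g` to its inverse. -/
theorem exists_conj_eq_transpose (g : Wreath r n) : ∃ h, h * g * h⁻¹ = g.transpose := by
  classical
  choose j hj using fun i => sameCycle_cycleRep g.perm i
  have hrep : ∀ i (k : ℤ), cycleRep g.perm ((g.perm ^ k) i) = cycleRep g.perm i := by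
    intro i k
    rw [cycleRep_eq_iff, sameCycle_zpow_left]
  let m : Fin n → Fin n := cycleRep g.perm
  have hm : ∀ i, m (m i) = m i := by
    intro i
    have := hrep (m i) (j i)
    rw [hj i] at this
    exact this.symm
  let s : Fin n → Fin n := fun i => (g.perm ^ (-j i)) (m i)
  -- the values of the reversal do not depend on the chosen exponents
  have key : ∀ i (k : ℤ), m i = i →
      s ((g.perm ^ k) i) = (g.perm ^ (-k)) i ∧
        (g ^ j ((g.perm ^ k) i)).z i + (g ^ (-j ((g.perm ^ k) i))).z i =
          (g ^ k).z i + (g ^ (-k)).z i := by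
    intro i k hi
    have h1 : m ((g.perm ^ k) i) = i := (hrep i k).trans hi
    have h2 := hj ((g.perm ^ k) i)
    change (g.perm ^ j ((g.perm ^ k) i)) (m ((g.perm ^ k) i)) = _ at h2
    rw [h1] at h2
    have h3 := g.zpow_z_congr h2
    refine ⟨?_, h3.2⟩
    simp only [s]
    rw [h1, h3.1]
  have hs : ∀ i, s (s i) = i := by
    intro i
    have h1 := (key (m i) (-j i) (hm i)).1
    rw [neg_neg, hj] at h1
    exact h1
  let h : Wreath r n :=
    ⟨fun i => (g ^ j i).z (m i) + (g ^ (-j i)).z (m i), ⟨s, s, hs, hs⟩⟩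
  have hval : ∀ i (k : ℤ), m i = i → h.perm ((g.perm ^ k) i) = (g.perm ^ (-k)) i ∧
      h.z ((g.perm ^ k) i) = (g ^ k).z i + (g ^ (-k)).z i := by
    intro i k hi
    refine ⟨(key i k hi).1, ?_⟩
    rw [← (key i k hi).2]
    change (g ^ j _).z (m _) + (g ^ (-j _)).z (m _) = _
    rw [show m ((g.perm ^ k) i) = i from (hrep i k).trans hi]
  have hmain : h * bar g = g⁻¹ * h := by
    have hpt : ∀ i, (h * bar g).z i = (g⁻¹ * h).z i ∧ (h * bar g).perm i = (g⁻¹ * h).perm i := by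
      intro i
      obtain ⟨a, k, ha, rfl⟩ : ∃ (a : Fin n) (k : ℤ), m a = a ∧ (g.perm ^ k) a = i :=
        ⟨m i, j i, hm i, hj i⟩
      obtain ⟨h1, h2⟩ := hval a k ha
      obtain ⟨h3, h4⟩ := hval a (1 + k) ha
      rw [zpow_one_add, Equiv.Perm.mul_apply] at h3 h4
      have h5 : (g ^ (1 + k)).z a = g.z ((g.perm ^ k) a) + (g ^ k).z a := by
        rw [zpow_one_add, mul_z, zpow_perm]
      have h6 : (g ^ (-(1 + k))).z a = g⁻¹.z ((g.perm ^ (-k)) a) + (g ^ (-k)).z a := by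
        rw [neg_add, zpow_add, zpow_neg_one, mul_z, zpow_perm]
      constructor
      · rw [mul_z, mul_z, bar_perm, bar_z, h1, h2, h4, h5, h6]
        ring
      · rw [mul_perm, mul_perm, Equiv.Perm.mul_apply, Equiv.Perm.mul_apply, bar_perm, h1, h3,
          neg_add, zpow_add, zpow_neg_one, Equiv.Perm.mul_apply, inv_perm]
    ext i
    · exact (hpt i).1
    · exact congrArg Fin.val (hpt i).2
  refine ⟨bar h, ?_⟩
  have h1 := congrArg bar hmain
  rw [bar_mul, bar_mul, bar_bar] at h1
  rw [h1, mul_assoc, mul_inv_cancel, mul_one, transpose_eq]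
  exact map_inv barHom g

end Wreath

/-! ### Multiplicity one for the full wreath product -/

section Trace

/-- The trace of a map that sends every basis vector to a multiple of a basis vector. -/
theorem LinearMap.trace_of_monomial {ι R M : Type*} [Fintype ι] [DecidableEq ι] [CommRing R]
    [AddCommGroup M] [Module R M] (b : Module.Basis ι R M) (f : M →ₗ[R] M) (σ : ι → ι) (s : ι → R)
    (h : ∀ i, f (b i) = s i • b (σ i)) :
    LinearMap.trace R M f = ∑ i, if σ i = i then s i else 0 := by
  rw [LinearMap.trace_eq_matrix_trace R b, Matrix.trace]
  refine Finset.sum_congr rfl fun i _ => ?_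
  rw [Matrix.diag_apply, LinearMap.toMatrix_apply, h, map_smul, Finsupp.smul_apply,
    Module.Basis.repr_self, Finsupp.single_apply, smul_eq_mul, mul_ite, mul_one, mul_zero]

theorem character_complexification {G V : Type*} [Group G] [AddCommGroup V] [Module ℚ V]
    [FiniteDimensional ℚ V] (ρ : Representation ℚ G V) (g : G) :
    (complexification ρ).character g = (ρ.character g : ℂ) := by
  change LinearMap.trace ℂ _ ((ρ g).baseChange ℂ) = _
  rw [LinearMap.trace_baseChange]
  rfl

instance {r n : ℕ} [NeZero r] : Finite (SymmElt r n) := Subtype.finite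

noncomputable instance {r n : ℕ} [NeZero r] : Fintype (SymmElt r n) := Fintype.ofFinite _

theorem SymmElt.mul_bar {r n : ℕ} (w : SymmElt r n) : w.1 * w.1.bar = 1 := by
  have h := w.2
  rw [Wreath.transpose_eq] at h
  calc w.1 * w.1.bar = (w.1.bar)⁻¹ * w.1.bar := by rw [h]
    _ = 1 := inv_mul_cancel _

theorem SymmElt.conj_eq_iff {r n : ℕ} (g : Wreath r n) (w : SymmElt r n) :
    w.conj g = w ↔ Wreath.SymmFixed g w.1 := by
  rw [Subtype.ext_iff, Wreath.SymmFixed, and_iff_right w.mul_bar, Wreath.AntiCommute]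
  change g * w.1 * g.transpose = w.1 ↔ _
  rw [Wreath.transpose_eq, mul_inv_eq_iff_eq_mul]

open Classical in
theorem character_wreathModel {r n : ℕ} [NeZero r] (g : Wreath r n) :
    (wreathModel r n).character g = ∑ w : SymmElt r n with w.conj g = w, modelSign g w.1 := by
  rw [Finset.sum_filter]
  refine LinearMap.trace_of_monomial Finsupp.basisSingleOne _ (SymmElt.conj g) _ fun w => ?_
  rw [Finsupp.coe_basisSingleOne]
  exact wreathModel_single g w

open Classical in
theorem character_wreathModel_eq_card {r n : ℕ} [NeZero r] (g : Wreath r n) :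
    (wreathModel r n).character g =
      ((Finset.univ.filter fun f : Wreath r n => f * f.bar = g).card : ℚ) := by
  rw [character_wreathModel, ← Wreath.sum_modelSign]
  refine Finset.sum_bij' (fun w _ => w.1) (fun f hf => ⟨f, ?_⟩) ?_ ?_ ?_ ?_ ?_
  · have h := (Finset.mem_filter.mp hf).2.1
    rw [Wreath.transpose_eq, inv_eq_iff_mul_eq_one]
    exact mul_eq_one_comm.mp h
  · intro w hw
    rw [Finset.mem_filter] at hw ⊢
    exact ⟨Finset.mem_univ _, (w.conj_eq_iff g).mp hw.2⟩
  · intro f hf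
    rw [Finset.mem_filter] at hf ⊢
    exact ⟨Finset.mem_univ _, (SymmElt.conj_eq_iff g _).mpr hf.2⟩
  · exact fun _ _ => rfl
  · exact fun _ _ => rfl
  · exact fun _ _ => rfl

/-- The model of the full wreath product contains every irreducible representation exactly once:
the multiplicity is the twisted Frobenius–Schur indicator, which is a sign, and it is
nonnegative. -/
theorem sum_character_wreathModel_mul {r n m : ℕ} [NeZero r]
    {σ : Representation ℂ (Wreath r n) (Fin m → ℂ)} (hσ : σ.IsIrreducible) :
    ∑ g, ((wreathModel r n).character g : ℂ) * σ.character g⁻¹ =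
      Fintype.card (Wreath r n) := by
  classical
  have h1 : ∑ g, ((wreathModel r n).character g : ℂ) * σ.character g⁻¹ =
      ∑ f : Wreath r n, σ.character (f.transpose * f⁻¹) := by
    symm
    rw [← Finset.sum_fiberwise_of_maps_to
      (g := fun f : Wreath r n => f * f.bar) (fun f _ => Finset.mem_univ _)]
    refine Finset.sum_congr rfl fun g _ => ?_
    symm
    rw [character_wreathModel_eq_card, Rat.cast_natCast, ← nsmul_eq_mul, ← Finset.sum_const]
    refine Finset.sum_congr (by congr) fun f hf => ?_
    rw [← (Finset.mem_filter.mp hf).2, mul_inv_rev, Wreath.transpose_eq]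
  have h2 := hσ.sum_character_antiInvolution Wreath.transpose Wreath.transpose_transpose
    Wreath.transpose_mul fun g => by
      obtain ⟨k, hk⟩ := g.exists_conj_eq_transpose
      rw [← hk, Representation.char_conj]
  rw [← h1] at h2
  refine h2.resolve_right fun h3 => ?_
  have h4 := Representation.sum_character_mul_character_inv σ (complexification (wreathModel r n))
  simp only [character_complexification] at h4
  rw [h3] at h4
  have h5 : ((Fintype.card (Wreath r n) *
      (Module.finrank ℂ (Representation.IntertwiningMap σ (complexification (wreathModel r n))) + 1)
        : ℕ) : ℂ) = 0 := by
    push_cast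
    linear_combination -h4
  rw [Nat.cast_eq_zero] at h5
  exact (Nat.mul_pos Fintype.card_pos (Nat.succ_pos _)).ne' h5

/-- The sum over the fibre of `Δ` over `t` of the product of an irreducible character with the
character of the model; it is obtained by twisting with the characters of `Δ`. -/
theorem sum_character_wreathModel_mul_fiber {r n m : ℕ} [NeZero r]
    {σ : Representation ℂ (Wreath r n) (Fin m → ℂ)} (hσ : σ.IsIrreducible) (t : ZMod r) :
    ∑ g : Wreath r n with g.Delta = t, ((wreathModel r n).character g : ℂ) * σ.character g⁻¹ =
      if t = 0 then (Fintype.card (Wreath r n) : ℂ) else 0 := by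
  have h1 : ∀ ψ : AddChar (ZMod r) ℂ, ∑ g : Wreath r n, ψ (-g.Delta) *
      (((wreathModel r n).character g : ℂ) * σ.character g⁻¹) = Fintype.card (Wreath r n) := by
    intro ψ
    let χ : Wreath r n →* ℂ :=
      { toFun := fun g => ψ g.Delta
        map_one' := by rw [Wreath.Delta_one, AddChar.map_zero_eq_one]
        map_mul' := fun g h => by rw [Wreath.Delta_mul, AddChar.map_add_eq_mul] }
    rw [← sum_character_wreathModel_mul (hσ.twist χ)]
    refine Finset.sum_congr rfl fun g _ => ?_
    rw [Representation.character_twist]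
    change _ = _ * (ψ g⁻¹.Delta * _)
    rw [Wreath.Delta_inv]
    ring
  have h2 : ∑ ψ : AddChar (ZMod r) ℂ, ψ t * ∑ g : Wreath r n, ψ (-g.Delta) *
      (((wreathModel r n).character g : ℂ) * σ.character g⁻¹) =
        r * ∑ g : Wreath r n with g.Delta = t,
          ((wreathModel r n).character g : ℂ) * σ.character g⁻¹ := by
    simp_rw [Finset.mul_sum]
    rw [Finset.sum_comm, Finset.sum_filter]
    refine Finset.sum_congr rfl fun g _ => ?_
    simp_rw [← mul_assoc, ← AddChar.map_add_eq_mul]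
    simp_rw [mul_assoc]
    rw [← Finset.sum_mul, AddChar.sum_apply_eq_ite, ZMod.card, ← sub_eq_add_neg]
    simp only [sub_eq_zero, eq_comm (a := t), ite_mul, zero_mul]
  simp_rw [h1] at h2
  rw [← Finset.sum_mul, AddChar.sum_apply_eq_ite, ZMod.card] at h2
  have hr : (r : ℂ) ≠ 0 := Nat.cast_ne_zero.mpr (NeZero.ne r)
  apply mul_left_cancel₀ hr
  rw [← h2]
  split_ifs <;> simp

end Trace

/-! ### Scalar matrices and parity -/

namespace Wreath

variable {r n : ℕ}

/-- The scalar matrix `ζ ^ a`. -/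
def scalar (n : ℕ) (a : ZMod r) : Wreath r n := ⟨fun _ => a, 1⟩

theorem scalar_mem_center (a : ZMod r) : scalar n a ∈ Subgroup.center (Wreath r n) := by
  rw [Subgroup.mem_center_iff]
  intro g
  ext i
  · simp [scalar, add_comm]
  · simp [scalar]

theorem scalar_mul_scalar (a b : ZMod r) : scalar n a * scalar n b = scalar n (a + b) := by
  ext i <;> simp [scalar]

theorem scalar_zero : scalar n (0 : ZMod r) = 1 := by
  ext i <;> simp [scalar]

theorem transpose_scalar (a : ZMod r) : (scalar n a).transpose = scalar n a := by
  ext i <;> simp [scalar]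

theorem Delta_scalar (a : ZMod r) : (scalar n a).Delta = n * a := by
  simp [Delta, scalar]

theorem exists_Delta_eq (hn : 0 < n) (t : ZMod r) : ∃ g : Wreath r n, g.Delta = t :=
  ⟨⟨Pi.single ⟨0, hn⟩ t, 1⟩, by simp [Delta]⟩

/-- The character of order `2` of `ZMod r`, for `r` even. -/
def parity (x : ZMod r) : ℚ := if Even x.val then 1 else -1

theorem parity_mul_self (x : ZMod r) : parity x * parity x = 1 := by
  unfold parity
  split_ifs <;> norm_num

theorem parity_add_one [NeZero r] (hr : Even r) (x : ZMod r) : parity (x + 1) = -parity x := by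
  unfold parity
  by_cases h : Even x.val <;> simp [even_val_add_one_iff hr, h]

theorem parity_add [NeZero r] (hr : Even r) (x y : ZMod r) :
    parity (x + y) = parity x * parity y := by
  have h : ∀ k : ℕ, parity (x + (k : ZMod r)) = parity x * parity (k : ZMod r) := by
    intro k
    induction k with
    | zero => simp [parity]
    | succ k ih =>
      rw [Nat.cast_succ, ← add_assoc, parity_add_one hr, ih, parity_add_one hr, mul_neg]
  have := h y.val
  rwa [ZMod.natCast_zmod_val] at this

theorem parity_sum [NeZero r] (hr : Even r) {ι : Type*} (s : Finset ι) (f : ι → ZMod r) :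
    parity (∑ i ∈ s, f i) = ∏ i ∈ s, parity (f i) := by
  classical
  induction s using Finset.induction_on with
  | empty => simp [parity]
  | insert a s ha ih => rw [Finset.sum_insert ha, Finset.prod_insert ha, parity_add hr, ih]

/-- The scalar matrix `-1` acts on `C_w` by the parity of `Δ(w)`; the `2`-cycles of `|w|` contribute
even numbers to `Δ(w)`. -/
theorem modelSign_scalar_half [NeZero r] {a : ZMod r} (ha : 2 * a.val = r) (w : SymmElt r n) :
    modelSign (scalar n a) w.1 = parity w.1.Delta := by
  have hr : Even r := ⟨a.val, by omega⟩
  have hw := (mul_bar_eq_one_iff w.1).mp w.mul_bar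
  rw [modelSign_eq_prod _ _ hw.1, Delta, parity_sum hr, ← div_eq_one_iff_eq,
    ← Finset.prod_div_distrib]
  · refine Finset.prod_involution (fun i _ => w.1.perm i) ?_ ?_ ?_ ?_
    · intro i _
      by_cases hi : w.1.perm i = i
      · have h1 : localSign (scalar n a) w.1 i = parity (w.1.z i) := by
          rw [localSign, if_pos hi]
          exact fixedSign_half ha _
        have h2 : parity (w.1.z i) ≠ 0 := fun h => by simpa [h] using parity_mul_self (w.1.z i)
        rw [hi, h1, div_self h2, mul_one]
      · have h1 := localSign_mul_localSign (g := scalar n a) hw.1 (fun i => rfl) hi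
        rw [show orderSign w.1 ((scalar n a).perm i) = orderSign w.1 i from rfl,
          orderSign_mul_self] at h1
        rw [div_mul_div_comm, h1, hw.2, parity_mul_self, div_one]
    · intro i _ h hi
      apply h
      have h1 : localSign (scalar n a) w.1 i = parity (w.1.z i) := by
        rw [localSign, if_pos hi]
        exact fixedSign_half ha _
      have h2 : parity (w.1.z i) ≠ 0 := fun h => by simpa [h] using parity_mul_self (w.1.z i)
      rw [h1, div_self h2]
    · exact fun _ _ => Finset.mem_univ _
    · exact fun i _ => hw.1 i
  · refine Finset.prod_ne_zero_iff.mpr fun i _ h => ?_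
    simpa [h] using parity_mul_self (w.1.z i)

end Wreath

/-! ### The parts of the model with given `Δ` -/

theorem modelSign_ne_zero {r n : ℕ} (g w : Wreath r n) : modelSign g w ≠ 0 := by
  unfold modelSign
  positivity

theorem SymmElt.Delta_conj {r n : ℕ} (g : Wreath r n) (w : SymmElt r n) :
    (w.conj g).1.Delta = w.1.Delta + 2 * g.Delta := by
  change (g * w.1 * g.transpose).Delta = _
  rw [Wreath.Delta_mul, Wreath.Delta_mul, Wreath.Delta_transpose]
  ring

open Classical in
/-- The contribution to the character of the model of the `C_w` with `Δ(w) = j`. -/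
noncomputable def partialCharacter {r n : ℕ} [NeZero r] (j : ZMod r) (g : Wreath r n) : ℚ :=
  ∑ w : SymmElt r n with w.conj g = w ∧ w.1.Delta = j, modelSign g w.1

theorem sum_partialCharacter {r n : ℕ} [NeZero r] (g : Wreath r n) :
    ∑ j, partialCharacter j g = (wreathModel r n).character g := by
  classical
  rw [character_wreathModel, ← Finset.sum_fiberwise_of_maps_to
      (g := fun w : SymmElt r n => w.1.Delta) (t := Finset.univ) (fun f _ => Finset.mem_univ _)]
  refine Finset.sum_congr rfl fun j _ => ?_
  rw [Finset.filter_filter, partialCharacter]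

theorem partialCharacter_conj {r n : ℕ} [NeZero r] (j : ZMod r) (k g : Wreath r n) :
    partialCharacter (j + 2 * k.Delta) (k * g * k⁻¹) = partialCharacter j g := by
  classical
  have hk : ∀ w : SymmElt r n, (w.conj k).conj k⁻¹ = w := fun w => by
    rw [← SymmElt.conj_mul, inv_mul_cancel, SymmElt.conj_one]
  have hk' : ∀ w : SymmElt r n, (w.conj k⁻¹).conj k = w := fun w => by
    rw [← SymmElt.conj_mul, mul_inv_cancel, SymmElt.conj_one]
  have hcomm : ∀ w : SymmElt r n, (w.conj k).conj (k * g * k⁻¹) = (w.conj g).conj k := fun w => by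
    rw [← SymmElt.conj_mul, ← SymmElt.conj_mul, inv_mul_cancel_right]
  unfold partialCharacter
  symm
  refine Finset.sum_bij' (fun w _ => w.conj k) (fun w _ => w.conj k⁻¹) ?_ ?_ ?_ ?_ ?_
  · intro w hw
    rw [Finset.mem_filter] at hw ⊢
    refine ⟨Finset.mem_univ _, ?_, ?_⟩
    · rw [hcomm, hw.2.1]
    · rw [SymmElt.Delta_conj, hw.2.2]
  · intro w hw
    rw [Finset.mem_filter] at hw ⊢
    obtain ⟨-, h1, h2⟩ := hw
    refine ⟨Finset.mem_univ _, ?_, ?_⟩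
    · rw [← hk' w, hcomm] at h1
      rw [← hk ((w.conj k⁻¹).conj g), h1, hk]
    · rw [SymmElt.Delta_conj, Wreath.Delta_inv, h2]
      ring
  · exact fun w _ => hk w
  · exact fun w _ => hk' w
  · intro w hw
    have hw := (Finset.mem_filter.mp hw).2.1
    have h1 := modelSign_mul (k * g * k⁻¹) k w
    have h2 := modelSign_mul k g w
    rw [inv_mul_cancel_right, h2, hw, mul_comm] at h1
    exact mul_right_cancel₀ (modelSign_ne_zero _ _) h1

/-- The basis elements `C_w` of the model of `G(r, p, n)` are those with `Δ(w) ∈ p ℤ_r`. -/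
theorem character_reflectionModel {r p n : ℕ} [NeZero r] (h : reflectionGroup r p n) :
    (reflectionModel r p n).character h =
      ∑ j with j ∈ AddSubgroup.zmultiples (p : ZMod r), partialCharacter j h.1 := by
  classical
  let v : {w : SymmElt r n // w.1 ∈ reflectionGroup r p n} → (SymmElt r n →₀ ℚ) :=
    fun w => Finsupp.single w.1 1
  have hv : LinearIndependent ℚ v := by
    have := (Finsupp.basisSingleOne (R := ℚ) (ι := SymmElt r n)).linearIndependent.comp
      (fun w : {w : SymmElt r n // w.1 ∈ reflectionGroup r p n} => w.1) Subtype.val_injective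
    rwa [Finsupp.coe_basisSingleOne] at this
  have hspan : Submodule.span ℚ (Set.range v) = symmSpan r p n := by
    rw [symmSpan]
    congr 1
    ext x
    constructor
    · rintro ⟨w, rfl⟩
      exact ⟨w.1, w.2, rfl⟩
    · rintro ⟨w, hw, rfl⟩
      exact ⟨⟨w, hw⟩, rfl⟩
  let b := (Module.Basis.span hv).map (LinearEquiv.ofEq _ _ hspan)
  have hb : ∀ w, (b w : SymmElt r n →₀ ℚ) = Finsupp.single w.1 1 := fun w => by
    change ((Module.Basis.span hv w : Submodule.span ℚ (Set.range v)) : SymmElt r n →₀ ℚ) = _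
    rw [Module.Basis.span_apply]
  have hmem : ∀ w : SymmElt r n, w.1 ∈ reflectionGroup r p n →
      (w.conj h.1).1 ∈ reflectionGroup r p n := fun w hw => by
    refine mul_mem (mul_mem h.2 hw) ?_
    change h.1.transpose.Delta ∈ AddSubgroup.zmultiples (p : ZMod r)
    rw [Wreath.Delta_transpose]
    exact h.2
  have htr := LinearMap.trace_of_monomial b (reflectionModel r p n h)
    (fun w => ⟨w.1.conj h.1, hmem w.1 w.2⟩) (fun w => modelSign h.1 w.1.1) fun w => by
      apply Subtype.ext
      change wreathModel r n h.1 (b w : SymmElt r n →₀ ℚ) = modelSign h.1 w.1.1 • (b _ : _ →₀ ℚ)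
      rw [hb, hb, wreathModel_single]
  refine htr.trans ?_
  simp only [Subtype.ext_iff (a1 := (⟨_, _⟩ : {w : SymmElt r n // _}))]
  rw [← Finset.sum_subtype (Finset.univ.filter fun w : SymmElt r n => w.1 ∈ reflectionGroup r p n)
    (by simp) (fun w : SymmElt r n => if w.conj h.1 = w then modelSign h.1 w.1 else 0),
    ← Finset.sum_filter, Finset.filter_filter, ← Finset.sum_fiberwise_of_maps_to
      (g := fun w : SymmElt r n => w.1.Delta)
      (t := Finset.univ.filter fun j => j ∈ AddSubgroup.zmultiples (p : ZMod r))]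
  · refine Finset.sum_congr rfl fun j hj => ?_
    rw [partialCharacter, Finset.filter_filter]
    refine Finset.sum_congr (Finset.filter_congr fun w _ => ?_) fun _ _ => rfl
    constructor
    · rintro ⟨⟨-, h1⟩, h2⟩
      exact ⟨h1, h2⟩
    · rintro ⟨h1, rfl⟩
      exact ⟨⟨(Finset.mem_filter.mp hj).2, h1⟩, rfl⟩
  · intro w hw
    exact Finset.mem_filter.mpr ⟨Finset.mem_univ _, (Finset.mem_filter.mp hw).2.1⟩

theorem eq_of_add_one_eq {r : ℕ} [NeZero r] {α : Type*} {f : ZMod r → α}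
    (h : ∀ i, f (i + 1) = f i) (i : ZMod r) : f i = f 0 := by
  have : ∀ k : ℕ, f k = f 0 := by
    intro k
    induction k with
    | zero => rw [Nat.cast_zero]
    | succ k ih => rw [Nat.cast_succ, h, ih]
  rw [← ZMod.natCast_zmod_val i, this]

open Classical in
/-- If the average of `A` over the cosets of `M` does not depend on the coset, then it is the
average of `A`. -/
theorem mul_sum_mem_eq {r : ℕ} [NeZero r] (M : AddSubgroup (ZMod r)) (A : ZMod r → ℂ)
    (hA : ∀ i, ∑ j with j ∈ M, A (j + (i + 1)) = ∑ j with j ∈ M, A (j + i)) :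
    (r : ℂ) * ∑ j with j ∈ M, A j = (Finset.univ.filter fun j => j ∈ M).card * ∑ j, A j := by
  have h1 : ∑ i, ∑ j with j ∈ M, A (j + i) = r * ∑ j with j ∈ M, A j := by
    rw [Finset.sum_congr rfl fun i _ =>
      eq_of_add_one_eq (f := fun i => ∑ j with j ∈ M, A (j + i)) hA i]
    simp only [add_zero, Finset.sum_const, nsmul_eq_mul, Finset.card_univ, ZMod.card]
  rw [← h1, Finset.sum_comm, ← nsmul_eq_mul, ← Finset.sum_const]
  exact Finset.sum_congr rfl fun j _ => Equiv.sum_comp (Equiv.addLeft j) A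

open Classical in
/-- All fibres of `Δ` have the same size. -/
theorem card_Delta_mem {r n : ℕ} [NeZero r] (hn : 0 < n) (M : AddSubgroup (ZMod r)) :
    (r : ℂ) * (Finset.univ.filter fun g : Wreath r n => g.Delta ∈ M).card =
      (Finset.univ.filter fun j => j ∈ M).card * Fintype.card (Wreath r n) := by
  let A : ZMod r → ℂ := fun j => (Finset.univ.filter fun g : Wreath r n => g.Delta = j).card
  have hA : ∀ i, A (i + 1) = A i := by
    intro i
    obtain ⟨k, hk⟩ := Wreath.exists_Delta_eq hn (1 : ZMod r)
    refine congrArg Nat.cast (Finset.card_equiv (Equiv.mulRight k⁻¹) fun g => ?_)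
    simp only [Finset.mem_filter, Finset.mem_univ, true_and, Equiv.coe_mulRight,
      Wreath.Delta_mul, Wreath.Delta_inv, hk]
    rw [← sub_eq_add_neg, sub_eq_iff_eq_add]
  have h := mul_sum_mem_eq M A fun i => Finset.sum_congr rfl fun j _ => by rw [← add_assoc, hA]
  have h1 : (∑ j, A j) = Fintype.card (Wreath r n) := by
    rw [← Finset.card_univ, Finset.card_eq_sum_card_fiberwise
      (f := fun g : Wreath r n => g.Delta) (t := Finset.univ) fun _ _ => Finset.mem_univ _]
    push_cast
    rfl
  rw [← h1, ← h, Finset.card_eq_sum_card_fiberwise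
      (f := fun g : Wreath r n => g.Delta) (t := Finset.univ.filter fun j => j ∈ M)
      fun g hg => by simpa using hg]
  push_cast
  congr 1
  refine Finset.sum_congr rfl fun j hj => ?_
  rw [Finset.filter_filter]
  refine congrArg Nat.cast (congrArg Finset.card (Finset.filter_congr fun g _ => ?_))
  constructor
  · exact fun h => h.2
  · rintro rfl
    exact ⟨(Finset.mem_filter.mp hj).2, rfl⟩

/-! ### Multiplicities in the model of `G(r, p, n)` -/

section Multiplicity

variable {r p n m : ℕ} [NeZero r]

open Classical in
/-- The pairing of an irreducible character with the `j`-th part of the character of the model, over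
the group of the elements `g` with `Δ(g) ∈ M`. -/
noncomputable def partialPairing (M : AddSubgroup (ZMod r))
    (σ : Representation ℂ (Wreath r n) (Fin m → ℂ)) (j : ZMod r) : ℂ :=
  ∑ g : Wreath r n with g.Delta ∈ M, (partialCharacter j g : ℂ) * σ.character g⁻¹

/-- Conjugation by an element with `Δ = t` shifts `Δ(w)` by `2 * t`. -/
theorem partialPairing_add_two (hn : 0 < n) (M : AddSubgroup (ZMod r))
    (σ : Representation ℂ (Wreath r n) (Fin m → ℂ)) (j t : ZMod r) :
    partialPairing M σ (j + 2 * t) = partialPairing M σ j := by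
  classical
  obtain ⟨k, rfl⟩ := Wreath.exists_Delta_eq hn t
  symm
  refine Finset.sum_equiv (MulAut.conj k).toEquiv (fun g => ?_) fun g _ => ?_
  · simp [Wreath.Delta_mul, Wreath.Delta_inv]
  · change _ = (partialCharacter _ (k * g * k⁻¹) : ℂ) * σ.character (k * g * k⁻¹)⁻¹
    rw [partialCharacter_conj, show (k * g * k⁻¹)⁻¹ = k * g⁻¹ * k⁻¹ by group,
      Representation.char_conj]

/-- Only the fibre of `Δ` over `0` contributes, so the sum does not depend on `M`. -/
theorem sum_partialPairing (M : AddSubgroup (ZMod r))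
    {σ : Representation ℂ (Wreath r n) (Fin m → ℂ)} (hσ : σ.IsIrreducible) :
    ∑ j, partialPairing M σ j = Fintype.card (Wreath r n) := by
  classical
  unfold partialPairing
  rw [Finset.sum_comm]
  have h1 : ∀ g : Wreath r n, ∑ j, (partialCharacter j g : ℂ) * σ.character g⁻¹ =
      ((wreathModel r n).character g : ℂ) * σ.character g⁻¹ := fun g => by
    rw [← Finset.sum_mul, ← sum_partialCharacter, Rat.cast_sum]
  simp_rw [h1]
  rw [← Finset.sum_fiberwise_of_maps_to (g := fun g : Wreath r n => g.Delta)
      (t := Finset.univ.filter fun j => j ∈ M) fun g hg => by simpa using hg]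
  rw [Finset.sum_eq_single 0]
  · rw [Finset.filter_filter, ← (sum_character_wreathModel_mul_fiber hσ 0).trans (if_pos rfl)]
    refine Finset.sum_congr (Finset.filter_congr fun g _ => ?_) fun _ _ => rfl
    constructor
    · exact fun h => h.2
    · intro h
      rw [h]
      exact ⟨M.zero_mem, rfl⟩
  · intro t ht h0
    rw [Finset.filter_filter, ← (sum_character_wreathModel_mul_fiber hσ t).trans (if_neg h0)]
    refine Finset.sum_congr (Finset.filter_congr fun g _ => ?_) fun _ _ => rfl
    constructor
    · exact fun h => h.2
    · intro h
      rw [h]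
      exact ⟨(Finset.mem_filter.mp ht).2, rfl⟩
  · intro h
    exact absurd (Finset.mem_filter.mpr ⟨Finset.mem_univ _, M.zero_mem⟩) h

/-- The scalar matrix `-1` distinguishes the parts of the model with `Δ(w)` even and odd; if it
does not lie in the group, then these two parts pair equally with an irreducible character. -/
theorem partialPairing_add_one (hn : 0 < n) (M : AddSubgroup (ZMod r))
    {σ : Representation ℂ (Wreath r n) (Fin m → ℂ)} (hσ : σ.IsIrreducible) {a : ZMod r}
    (ha : 2 * a.val = r) (haM : (n : ZMod r) * a ∉ M) (j : ZMod r) :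
    partialPairing M σ (j + 1) = partialPairing M σ j := by
  classical
  have hr : Even r := ⟨a.val, by omega⟩
  have haa : a + a = 0 := by
    rw [← ZMod.natCast_zmod_val a, ← Nat.cast_add, ← two_mul, ha, ZMod.natCast_self]
  set z : Wreath r n := Wreath.scalar n a with hz
  have hzz : z * z = 1 := by rw [hz, Wreath.scalar_mul_scalar, haa, Wreath.scalar_zero]
  have hzc : z ∈ Subgroup.center (Wreath r n) := Wreath.scalar_mem_center a
  have hzinv : z⁻¹ = z := inv_eq_of_mul_eq_one_right hzz
  obtain ⟨c, hc⟩ := hσ.exists_eq_smul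
    (Representation.IntertwiningMap.centralMul σ z (hzc : z ∈ Submonoid.center _))
  have hc : σ z = c • (1 : Module.End ℂ (Fin m → ℂ)) := LinearMap.ext fun v => hc v
  have hcc : c * c = 1 := by
    obtain ⟨v, hv⟩ := @exists_ne _ ((Representation.isIrreducible_iff σ).mp hσ).1 0
    have h1 : (σ (z * z)) v = (c * c) • v := by
      rw [map_mul, hc]
      simp [mul_smul]
    rw [hzz, map_one, Module.End.one_apply] at h1
    have h2 : (c * c - 1) • v = 0 := by rw [sub_smul, one_smul, ← h1, sub_self]
    exact sub_eq_zero.mp ((smul_eq_zero.mp h2).resolve_right hv)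
  have hc0 : c ≠ 0 := by
    rintro rfl
    simp at hcc
  have hchar : ∀ g, σ.character (z * g) = c * σ.character g := fun g => by
    simp [Representation.character, hc]
  have hzw : ∀ w : SymmElt r n, w.conj z = w := fun w => by
    apply Subtype.ext
    change z * w.1 * z.transpose = w.1
    rw [hz, Wreath.transpose_scalar, ← hz, ← Subgroup.mem_center_iff.mp hzc, mul_assoc, hzz,
      mul_one]
  have hmodel : ∀ g : Wreath r n, (wreathModel r n).character (g * z) =
      ∑ i : ZMod r, Wreath.parity i * partialCharacter i g := fun g => by
    rw [character_wreathModel, ← Finset.sum_fiberwise_of_maps_to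
      (g := fun w : SymmElt r n => w.1.Delta) (t := Finset.univ) (fun f _ => Finset.mem_univ _)]
    refine Finset.sum_congr rfl fun i _ => ?_
    rw [Finset.filter_filter, partialCharacter, Finset.mul_sum]
    refine Finset.sum_congr (Finset.filter_congr fun w _ => ?_) fun w hw => ?_
    · rw [SymmElt.conj_mul, hzw]
    · rw [modelSign_mul, hzw, Wreath.modelSign_scalar_half ha, (Finset.mem_filter.mp hw).2.2,
        mul_comm]
  -- The elements `g * z` have `Δ` in a nonzero coset of `M`, where the pairing vanishes.
  have h0 : ∑ g : Wreath r n with g.Delta ∈ M,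
      ((wreathModel r n).character (g * z) : ℂ) * σ.character (g * z)⁻¹ = 0 := by
    rw [← Finset.sum_fiberwise_of_maps_to (g := fun g : Wreath r n => g.Delta)
      (t := Finset.univ.filter fun j => j ∈ M) fun g hg => by simpa using hg]
    refine Finset.sum_eq_zero fun t ht => ?_
    have htM := (Finset.mem_filter.mp ht).2
    have hne : t + n * a ≠ 0 := fun h => haM <| by
      rw [← neg_eq_of_add_eq_zero_right h]
      exact M.neg_mem htM
    rw [← (sum_character_wreathModel_mul_fiber hσ _).trans (if_neg hne)]
    refine Finset.sum_equiv (Equiv.mulRight z) (fun g => ?_) fun g _ => rfl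
    simp only [Finset.mem_filter, Finset.mem_univ, true_and, Equiv.coe_mulRight,
      Wreath.Delta_mul, hz, Wreath.Delta_scalar, add_left_inj]
    constructor
    · exact fun h => h.2
    · rintro rfl
      exact ⟨htM, rfl⟩
  have h1 : ∑ i : ZMod r, (Wreath.parity i : ℂ) * partialPairing M σ i = 0 := by
    apply mul_left_cancel₀ hc0
    rw [mul_zero, ← h0, Finset.mul_sum]
    simp_rw [partialPairing, Finset.mul_sum]
    rw [Finset.sum_comm]
    refine Finset.sum_congr rfl fun g _ => ?_
    rw [hmodel, mul_inv_rev, hzinv, hchar, Rat.cast_sum, Finset.sum_mul]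
    refine Finset.sum_congr rfl fun i _ => ?_
    rw [Rat.cast_mul]
    ring
  let D : ZMod r → ℂ := fun i =>
    (Wreath.parity i : ℂ) * (partialPairing M σ i - partialPairing M σ (i + 1))
  have hD : ∀ i, D (i + 1) = D i := fun i => by
    have := partialPairing_add_two hn M σ i 1
    rw [mul_one, show (2 : ZMod r) = 1 + 1 by norm_num, ← add_assoc] at this
    simp only [D]
    rw [this, Wreath.parity_add_one hr]
    push_cast
    ring
  have hsum : ∑ i, D i = 0 := by
    simp only [D, mul_sub, Finset.sum_sub_distrib, h1, zero_sub, neg_eq_zero]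
    rw [← neg_eq_zero, ← Finset.sum_neg_distrib]
    refine Eq.trans (Finset.sum_congr rfl fun i _ => ?_)
      ((Equiv.sum_comp (Equiv.addRight (1 : ZMod r)) _).trans h1)
    rw [Equiv.coe_addRight, Wreath.parity_add_one hr]
    push_cast
    ring
  rw [Finset.sum_congr rfl fun i _ => (eq_of_add_one_eq hD i).trans (eq_of_add_one_eq hD j).symm,
    Finset.sum_const, Finset.card_univ, ZMod.card, nsmul_eq_mul, mul_eq_zero, Nat.cast_eq_zero,
    or_iff_right (NeZero.ne r), mul_eq_zero, sub_eq_zero] at hsum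
  refine (hsum.resolve_left fun h => ?_).symm
  have := Wreath.parity_mul_self j
  rw [Rat.cast_eq_zero] at h
  rw [h] at this
  simp at this

/-- Unless `-1` lies in `G(r, p, n)` although `p` is even, the model contains exactly one copy of
the restriction to `G(r, p, n)` of an irreducible representation of the full wreath product. -/
theorem finrank_intertwiningMap_reflectionModel (hn : 0 < n)
    (h : Odd p ∨ ∃ a : ZMod r, 2 * a.val = r ∧
      (n : ZMod r) * a ∉ AddSubgroup.zmultiples (p : ZMod r))
    {σ : Representation ℂ (Wreath r n) (Fin m → ℂ)} (hσ : σ.IsIrreducible) :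
    Module.finrank ℂ (Representation.IntertwiningMap (σ.comp (reflectionGroup r p n).subtype)
      (complexification (reflectionModel r p n))) = 1 := by
  classical
  have : Fintype (reflectionGroup r p n) := Fintype.ofFinite _
  set M := AddSubgroup.zmultiples (p : ZMod r) with hM
  have hcard : Fintype.card (reflectionGroup r p n) =
      (Finset.univ.filter fun g : Wreath r n => g.Delta ∈ M).card :=
    Fintype.card_of_subtype _ fun g => by
      simp only [Finset.mem_filter, Finset.mem_univ, true_and]
      rfl
  have h1 := Representation.sum_character_mul_character_inv
    (σ.comp (reflectionGroup r p n).subtype) (complexification (reflectionModel r p n))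
  have h2 : ∑ g, (complexification (reflectionModel r p n)).character g *
      Representation.character (σ.comp (reflectionGroup r p n).subtype) g⁻¹ =
        ∑ j with j ∈ M, partialPairing M σ j := by
    simp_rw [partialPairing]
    rw [Finset.sum_comm, Finset.sum_subtype (p := (· ∈ reflectionGroup r p n)) _ fun g => by
      simp only [Finset.mem_filter, Finset.mem_univ, true_and]
      rfl]
    refine Finset.sum_congr rfl fun g _ => ?_
    rw [character_complexification, character_reflectionModel, Rat.cast_sum, Finset.sum_mul]
    rfl
  have h3 := mul_sum_mem_eq M (partialPairing M σ) fun i => by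
    rcases h with ⟨k, hk⟩ | ⟨a, ha, haM⟩
    -- translation by `p` preserves `M`, and has the same effect as translation by `1`
    · refine Finset.sum_equiv (Equiv.addRight (-(p : ZMod r))) (fun j => ?_) fun j _ => ?_
      · have hp : -(p : ZMod r) ∈ M := M.neg_mem (AddSubgroup.mem_zmultiples _)
        simp only [Finset.mem_filter, Finset.mem_univ, true_and, Equiv.coe_addRight]
        exact (M.add_mem_cancel_right hp).symm
      · rw [← partialPairing_add_two hn M σ (Equiv.addRight (-(p : ZMod r)) j + i) (k + 1),
          Equiv.coe_addRight, hk]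
        congr 1
        push_cast
        ring
    · refine Finset.sum_congr rfl fun j _ => ?_
      rw [← add_assoc, partialPairing_add_one hn M hσ ha haM]
  have h4 := card_Delta_mem hn M
  rw [sum_partialPairing M hσ, ← h4, ← h2, h1, ← hcard] at h3
  have hr : (r : ℂ) ≠ 0 := Nat.cast_ne_zero.mpr (NeZero.ne r)
  have hH : (Fintype.card (reflectionGroup r p n) : ℂ) ≠ 0 :=
    Nat.cast_ne_zero.mpr Fintype.card_ne_zero
  have h5 := mul_left_cancel₀ hr h3
  rw [mul_eq_left₀ hH] at h5
  exact_mod_cast h5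

end Multiplicity

/-! ### An irreducible representation that becomes reducible on the subgroup -/

namespace Wreath

variable {r n : ℕ} [NeZero r]

/-- The words obtained from `f₀ : Fin n → ZMod r` by permuting the letters. -/
abbrev Rearrangement (f₀ : Fin n → ZMod r) : Type :=
  {f : Fin n → ZMod r // ∃ π : Equiv.Perm (Fin n), f = f₀ ∘ π}

/-- The word `f ∘ π`. -/
def Rearrangement.permute {f₀ : Fin n → ZMod r} (f : Rearrangement f₀) (π : Equiv.Perm (Fin n)) :
    Rearrangement f₀ :=
  ⟨f.1 ∘ π, by
    obtain ⟨σ, hσ⟩ := f.2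
    exact ⟨σ * π, by rw [hσ]; rfl⟩⟩

/-- The representation of the wreath product on the functions of the rearrangements of a word
`f₀`; a diagonal matrix acts on the functions supported at `f` by the character
`x ↦ ψ (∑ i, f i * x i)`, where `ψ` is the standard additive character of `ZMod r`. -/
noncomputable def wordRep (f₀ : Fin n → ZMod r) :
    Representation ℂ (Wreath r n) (Rearrangement f₀ → ℂ) where
  toFun g :=
    { toFun := fun F f => ZMod.stdAddChar (∑ i, f.1 (g.perm i) * g.z i) * F (f.permute g.perm)
      map_add' := fun F F' => funext fun f => mul_add _ _ _
      map_smul' := fun c F => funext fun f => by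
        simp only [Pi.smul_apply, smul_eq_mul, RingHom.id_apply]
        ring }
  map_one' := by
    ext F f
    simp [Rearrangement.permute]
  map_mul' g h := by
    refine LinearMap.ext fun F => funext fun f => ?_
    simp only [mul_z, mul_perm, LinearMap.coe_mk, AddHom.coe_mk, Module.End.mul_apply]
    rw [← mul_assoc, ← AddChar.map_add_eq_mul,
      ← Equiv.sum_comp h.perm fun i => f.1 (g.perm i) * g.z i, ← Finset.sum_add_distrib]
    simp only [Equiv.Perm.mul_apply, mul_add]
    rfl

theorem wordRep_apply (f₀ : Fin n → ZMod r) (g : Wreath r n) (F : Rearrangement f₀ → ℂ)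
    (f : Rearrangement f₀) : wordRep f₀ g F f =
      ZMod.stdAddChar (∑ i, f.1 (g.perm i) * g.z i) * F (f.permute g.perm) := rfl

theorem sum_stdAddChar_mul {d : Fin n → ZMod r} (hd : d ≠ 0) :
    ∑ x : Fin n → ZMod r, (ZMod.stdAddChar (∑ i, d i * x i) : ℂ) = 0 := by
  classical
  let χ : AddChar (Fin n → ZMod r) ℂ :=
    { toFun := fun x => ZMod.stdAddChar (∑ i, d i * x i)
      map_zero_eq_one' := by simp
      map_add_eq_mul' := fun x y => by
        simp only [Pi.add_apply, mul_add, Finset.sum_add_distrib, AddChar.map_add_eq_mul] }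
  obtain ⟨i, hi⟩ := Function.ne_iff.mp hd
  refine AddChar.sum_eq_zero_of_ne_one (ψ := χ) fun h => hi ?_
  have h1 : χ (Pi.single i 1) = 1 := by rw [h, AddChar.one_apply]
  have h2 : (ZMod.stdAddChar (∑ j, d j * (Pi.single i 1 : Fin n → ZMod r) j) : ℂ) = 1 := h1
  rw [Finset.sum_eq_single i (fun j _ hj => by rw [Pi.single_eq_of_ne hj, mul_zero])
    (by simp), Pi.single_eq_same, mul_one,
    ← AddChar.map_zero_eq_one (ZMod.stdAddChar (N := r))] at h2
  exact ZMod.injective_stdAddChar h2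

/-- The diagonal matrices separate the words, and the permutations act transitively on them. -/
theorem wordRep_isIrreducible (f₀ : Fin n → ZMod r) : (wordRep f₀).IsIrreducible := by
  classical
  rw [Representation.isIrreducible_iff]
  have : Nonempty (Rearrangement f₀) := ⟨⟨f₀, 1, rfl⟩⟩
  refine ⟨inferInstance, fun S hS => or_iff_not_imp_left.mpr fun hbot => ?_⟩
  obtain ⟨F, hF, hF0⟩ := (Submodule.ne_bot_iff S).mp hbot
  obtain ⟨f₁, hf₁⟩ := Function.ne_iff.mp hF0
  -- averaging over the diagonal matrices projects to the functions supported at `f₁`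
  have h1 : Pi.single f₁ (1 : ℂ) ∈ S := by
    have h2 : ∑ x : Fin n → ZMod r, (ZMod.stdAddChar (-∑ i, f₁.1 i * x i) : ℂ) •
        wordRep f₀ ⟨x, 1⟩ F =
          ((Fintype.card (Fin n → ZMod r) : ℂ) * F f₁) • Pi.single f₁ (1 : ℂ) := by
      ext f
      simp only [Finset.sum_apply, Pi.smul_apply, smul_eq_mul, wordRep_apply, ← mul_assoc,
        ← AddChar.map_add_eq_mul, Equiv.Perm.one_apply, ← Finset.sum_mul]
      rw [show f.permute 1 = f from rfl]
      by_cases hf : f = f₁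
      · subst hf
        simp
      · rw [Pi.single_eq_of_ne hf, mul_zero]
        have hd : f.1 - f₁.1 ≠ 0 := fun h => hf (Subtype.ext (sub_eq_zero.mp h))
        have h3 := sum_stdAddChar_mul hd
        simp only [Pi.sub_apply, sub_mul, Finset.sum_sub_distrib] at h3
        simp only [neg_add_eq_sub, h3, zero_mul]
    have h3 := S.sum_mem fun x (_ : x ∈ Finset.univ) =>
      S.smul_mem (ZMod.stdAddChar (-∑ i, f₁.1 i * x i) : ℂ) (hS ⟨x, 1⟩ F hF)
    rw [h2] at h3
    exact (S.smul_mem_iff (mul_ne_zero (Nat.cast_ne_zero.mpr Fintype.card_ne_zero) hf₁)).mp h3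
  have h4 : ∀ f : Rearrangement f₀, Pi.single f (1 : ℂ) ∈ S := by
    intro f
    obtain ⟨π, hπ⟩ := f.2
    obtain ⟨π₁, hπ₁⟩ := f₁.2
    convert hS ⟨0, π⁻¹ * π₁⟩ _ h1 using 1
    ext f'
    rw [wordRep_apply]
    simp only [Pi.zero_apply, mul_zero, Finset.sum_const_zero, AddChar.map_zero_eq_one, one_mul]
    have : f'.permute (π⁻¹ * π₁) = f₁ ↔ f' = f := by
      constructor
      · intro h
        apply Subtype.ext
        have h5 : f'.1 ∘ (π⁻¹ * π₁) = f₀ ∘ π₁ := (congrArg Subtype.val h).trans hπ₁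
        rw [hπ]
        funext i
        have := congrFun h5 (π₁⁻¹ (π i))
        simpa using this
      · rintro rfl
        apply Subtype.ext
        change f'.1 ∘ _ = _
        rw [hπ, hπ₁]
        funext i
        simp
    simp only [Pi.single_apply, this]
  rw [eq_top_iff]
  rintro F' -
  rw [← Finset.univ_sum_single F']
  refine S.sum_mem fun f _ => ?_
  have := S.smul_mem (F' f) (h4 f)
  rwa [← Pi.single_smul, smul_eq_mul, mul_one] at this

/-- If a nonzero constant `a` annihilates the values of `Δ` on a subgroup, and adding `a` to a word
rearranges it, then translation by `a` is a non-scalar endomorphism of the restricted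
representation. -/
theorem not_isIrreducible_wordRep_comp {f₀ : Fin n → ZMod r} (H : Subgroup (Wreath r n))
    {a : ZMod r} (hH : ∀ g ∈ H, a * g.Delta = 0) (hn : 0 < n) (ha : a ≠ 0)
    (hf₀ : ∃ π : Equiv.Perm (Fin n), (fun i => f₀ i + a) = f₀ ∘ π) :
    ¬ Representation.IsIrreducible ((wordRep f₀).comp H.subtype) := by
  classical
  intro hirr
  obtain ⟨π, hπ⟩ := hf₀
  let shift : Rearrangement f₀ → Rearrangement f₀ := fun f => ⟨fun i => f.1 i + a, by
    obtain ⟨σ, hσ⟩ := f.2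
    refine ⟨π * σ, funext fun i => ?_⟩
    rw [hσ]
    exact congrFun hπ (σ i)⟩
  let Φ : Representation.IntertwiningMap ((wordRep f₀).comp H.subtype)
      ((wordRep f₀).comp H.subtype) :=
    { toLinearMap := LinearMap.funLeft ℂ ℂ shift
      isIntertwining' := fun g => by
        refine LinearMap.ext fun F => funext fun f => ?_
        change wordRep f₀ g.1 F (shift f) = wordRep f₀ g.1 (fun f => F (shift f)) f
        rw [wordRep_apply, wordRep_apply]
        congr 2
        simp only [shift, add_mul, Finset.sum_add_distrib, ← Finset.mul_sum]
        rw [show ∑ i, g.1.z i = g.1.Delta from rfl, hH g.1 g.2, add_zero] }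
  obtain ⟨c, hc⟩ := hirr.exists_eq_smul Φ
  let e : Rearrangement f₀ := ⟨f₀, 1, rfl⟩
  have h1 : (Pi.single (shift e) 1 : Rearrangement f₀ → ℂ) (shift e) =
      c * (Pi.single (shift e) 1 : Rearrangement f₀ → ℂ) e :=
    congrFun (hc (Pi.single (shift e) (1 : ℂ))) e
  have h2 : e ≠ shift e := fun h => ha <| by
    have := congrFun (congrArg Subtype.val h) ⟨0, hn⟩
    exact left_eq_add.mp this
  rw [Pi.single_eq_same, Pi.single_eq_of_ne h2, mul_zero] at h1
  exact one_ne_zero h1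

/-- If `p` and `n` have a common prime factor, then some irreducible representation of the full
wreath product becomes reducible on `G(r, p, n)`. -/
theorem exists_isIrreducible_not_isIrreducible_comp {p q : ℕ} (hpr : p ∣ r) (hn : 0 < n)
    (hq : q.Prime) (hqp : q ∣ p) (hqn : q ∣ n) :
    ∃ f₀ : Fin n → ZMod r, ¬ Representation.IsIrreducible
      ((wordRep f₀).comp (reflectionGroup r p n).subtype) := by
  have hr := NeZero.pos r
  obtain ⟨s, hs⟩ := hqp.trans hpr
  have hs0 : 0 < s := Nat.pos_of_ne_zero fun h => by
    rw [h, mul_zero] at hs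
    omega
  have hqs : (q : ZMod r) * s = 0 := by rw [← Nat.cast_mul, ← hs, ZMod.natCast_self]
  have hns : (n : ZMod r) * s = 0 := by
    obtain ⟨k, rfl⟩ := hqn
    push_cast
    linear_combination (k : ZMod r) * hqs
  -- with `s = r / q`, adding `s` to the word `(0, s, 2 * s, …)` rotates it, as `q` divides `n`
  refine ⟨fun i => (i.val : ZMod r) * s, not_isIrreducible_wordRep_comp _ (a := (s : ZMod r))
    ?_ hn ?_ ?_⟩
  · intro g hg
    obtain ⟨k, hk⟩ : g.Delta ∈ AddSubgroup.zmultiples (p : ZMod r) := hg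
    obtain ⟨l, rfl⟩ := hqp
    rw [← hk]
    simp only [zsmul_eq_mul]
    push_cast
    linear_combination (k : ZMod r) * l * hqs
  · rw [Ne, ZMod.natCast_eq_zero_iff]
    intro h
    have h1 := Nat.le_of_dvd hs0 h
    have h2 := hq.two_le
    nlinarith
  · have : NeZero n := ⟨hn.ne'⟩
    refine ⟨Equiv.addRight 1, funext fun i => ?_⟩
    have h1 : (((i + 1 : Fin n).val : ℕ) : ZMod r) * s = ((i.val + 1 : ℕ) : ZMod r) * s := by
      have h2 : (i + 1 : Fin n).val = (i.val + 1) % n := by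
        rw [Fin.val_add, Fin.val_one', Nat.add_mod_mod]
      rw [h2]
      conv_rhs => rw [← Nat.mod_add_div (i.val + 1) n]
      push_cast
      linear_combination -(((i.val + 1) / n : ℕ) : ZMod r) * hns
    simp only [Function.comp_apply, Equiv.coe_addRight, h1]
    push_cast
    ring

end Wreath

/-! ### The criterion -/

section Criterion

variable {r p n : ℕ}

theorem natCast_mem_zmultiples_iff (hpr : p ∣ r) (x : ℕ) :
    (x : ZMod r) ∈ AddSubgroup.zmultiples (p : ZMod r) ↔ p ∣ x := by
  constructor
  · rintro ⟨k, hk⟩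
    have h1 : ((k * p : ℤ) : ZMod r) = ((x : ℤ) : ZMod r) := by
      simpa using hk
    rw [ZMod.intCast_eq_intCast_iff_dvd_sub] at h1
    have h2 : (p : ℤ) ∣ x - k * p := (Int.natCast_dvd_natCast.mpr hpr).trans h1
    exact Int.natCast_dvd_natCast.mp ((dvd_sub_left (dvd_mul_left _ _)).mp h2)
  · rintro ⟨k, rfl⟩
    exact ⟨k, by simp [mul_comm]⟩

variable [NeZero r]

/-- If `p` is even and the scalar matrix `-1` lies in `G(r, p, n)`, then it acts trivially on the
model. -/
theorem reflectionModel_scalar_half {a : ZMod r} (ha : 2 * a.val = r) (hp : Even p)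
    (hmem : Wreath.scalar n a ∈ reflectionGroup r p n) :
    reflectionModel r p n ⟨Wreath.scalar n a, hmem⟩ = 1 := by
  have haa : a + a = 0 := by
    rw [← ZMod.natCast_zmod_val a, ← Nat.cast_add, ← two_mul, ha, ZMod.natCast_self]
  have hr : Even r := ⟨a.val, by omega⟩
  have key : ∀ v ∈ symmSpan r p n, wreathModel r n (Wreath.scalar n a) v = v := by
    intro v hv
    induction hv using Submodule.span_induction with
    | mem v hv =>
      obtain ⟨w, ⟨k, hk⟩, rfl⟩ := hv
      obtain ⟨s, hs⟩ := hp
      have h1 : w.conj (Wreath.scalar n a) = w := by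
        apply Subtype.ext
        change Wreath.scalar n a * w.1 * (Wreath.scalar n a).transpose = w.1
        rw [Wreath.transpose_scalar,
          ← Subgroup.mem_center_iff.mp (Wreath.scalar_mem_center a), mul_assoc,
          Wreath.scalar_mul_scalar, haa, Wreath.scalar_zero, mul_one]
      have h2 : w.1.Delta = (k * s : ZMod r) + k * s := by
        rw [← hk, hs]
        simp only [zsmul_eq_mul]
        push_cast
        ring
      rw [wreathModel_single, h1, Wreath.modelSign_scalar_half ha, h2, Wreath.parity_add hr,
        Wreath.parity_mul_self, one_smul]
    | zero => rw [map_zero]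
    | add v w _ _ hv hw => rw [map_add, hv, hw]
    | smul c v _ hv => rw [map_smul, hv]
  exact LinearMap.ext fun v => Subtype.ext (key v.1 v.2)

/-- If `n` is prime to `p`, then `G(r, 1, n)` is generated by its centre and `G(r, p, n)`. -/
theorem exists_center_mul_mem_reflectionGroup (h : Nat.gcd p n = 1) (g : Wreath r n) :
    ∃ z ∈ Subgroup.center (Wreath r n), z * g ∈ reflectionGroup r p n := by
  have h1 := Nat.gcd_eq_gcd_ab p n
  rw [h] at h1
  have h2 := congrArg (Int.cast : ℤ → ZMod r) h1
  push_cast at h2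
  refine ⟨Wreath.scalar n (-(Nat.gcdB p n * g.Delta)), Wreath.scalar_mem_center _, ?_⟩
  refine ⟨Nat.gcdA p n * (g.Delta.val : ℤ), ?_⟩
  simp only [zsmul_eq_mul, Wreath.Delta_mul, Wreath.Delta_scalar]
  push_cast
  rw [ZMod.natCast_zmod_val]
  linear_combination -g.Delta * h2

end Criterion

theorem mainTheorem2 (r p n : ℕ) [NeZero r] (hn : 0 < n) (hp : 0 < p) (hpr : p ∣ r) :
    IsGelfandModel (complexification (reflectionModel r p n)) ↔
      (Nat.gcd p n = 1 ∧ (Odd p ∨ Odd (r / p))) := by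
  have hrpos := NeZero.pos r
  have hhalf : Even p → 2 * ((r / 2 : ℕ) : ZMod r).val = r := fun hpe => by
    have hr : 2 ∣ r := hpe.two_dvd.trans hpr
    rw [ZMod.val_cast_of_lt (by omega)]
    omega
  have hcast : (n : ZMod r) * ((r / 2 : ℕ) : ZMod r) = ((n * (r / 2) : ℕ) : ZMod r) := by
    push_cast
    rfl
  constructor
  · intro h
    -- otherwise `-1` would lie in the kernel of the model, which is faithful
    have hC : Odd p ∨ ∃ a : ZMod r, 2 * a.val = r ∧
        (n : ZMod r) * a ∉ AddSubgroup.zmultiples (p : ZMod r) := by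
      by_contra! hcon
      obtain ⟨hpo, hcon⟩ := hcon
      rw [Nat.not_odd_iff_even] at hpo
      have ha := hhalf hpo
      have hmem : Wreath.scalar n ((r / 2 : ℕ) : ZMod r) ∈ reflectionGroup r p n := by
        change (Wreath.scalar n ((r / 2 : ℕ) : ZMod r)).Delta ∈ AddSubgroup.zmultiples (p : ZMod r)
        rw [Wreath.Delta_scalar]
        exact hcon _ ha
      have h1 : complexification (reflectionModel r p n)
          ⟨Wreath.scalar n ((r / 2 : ℕ) : ZMod r), hmem⟩ = 1 := by
        change (reflectionModel r p n _).baseChange ℂ = 1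
        rw [reflectionModel_scalar_half ha hpo hmem]
        exact LinearMap.baseChange_id ..
      have h2 := congrArg (fun g => g.1.z ⟨0, hn⟩) (h.eq_one_of_apply_eq_one h1)
      have h3 : ((r / 2 : ℕ) : ZMod r) = 0 := h2
      rw [h3, ZMod.val_zero] at ha
      omega
    constructor
    · by_contra hgcd
      obtain ⟨q, hq, hqd⟩ := Nat.exists_prime_and_dvd hgcd
      obtain ⟨f₀, hf₀⟩ := Wreath.exists_isIrreducible_not_isIrreducible_comp hpr hn hq
        (hqd.trans (Nat.gcd_dvd_left p n)) (hqd.trans (Nat.gcd_dvd_right p n))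
      obtain ⟨m, σ, ⟨e⟩⟩ := Representation.exists_equiv_coordinates (Wreath.wordRep f₀)
      have hσ : σ.IsIrreducible := (Wreath.wordRep_isIrreducible f₀).of_equiv e
      have hσ' : ¬ Representation.IsIrreducible (σ.comp (reflectionGroup r p n).subtype) :=
        fun hirr =>
        hf₀ (hirr.of_equiv (Representation.Equiv.mk e.symm.toLinearEquiv
          fun g => e.symm.toIntertwiningMap.isIntertwining' g.1))
      have := ((Representation.isIrreducible_iff σ).mp hσ).1
      have h1 := h.two_le_finrank hσ'
      rw [finrank_intertwiningMap_reflectionModel hn hC hσ] at h1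
      omega
    · by_contra! hcon
      simp only [Nat.not_odd_iff_even] at hcon
      obtain ⟨a, ha, haM⟩ := hC.resolve_left (Nat.not_odd_iff_even.mpr hcon.1)
      obtain ⟨k, hk⟩ := hcon.2
      have h1 : r = p * (k + k) := by rw [← hk, Nat.mul_div_cancel' hpr]
      have h2 : a.val = p * k := by
        rw [mul_add] at h1
        omega
      rw [← ZMod.natCast_zmod_val a, h2, ← Nat.cast_mul, natCast_mem_zmultiples_iff hpr] at haM
      exact haM ⟨n * k, by ring⟩
  · rintro ⟨hgcd, hodd⟩
    have hC : Odd p ∨ ∃ a : ZMod r, 2 * a.val = r ∧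
        (n : ZMod r) * a ∉ AddSubgroup.zmultiples (p : ZMod r) := by
      by_cases hpo : Odd p
      · exact .inl hpo
      · refine .inr ⟨_, hhalf (Nat.not_odd_iff_even.mp hpo), ?_⟩
        rw [hcast, natCast_mem_zmultiples_iff hpr]
        intro hdvd
        obtain ⟨k, hk⟩ := Nat.Coprime.dvd_of_dvd_mul_left hgcd hdvd
        have hr : 2 ∣ r := (Nat.not_odd_iff_even.mp hpo).two_dvd.trans hpr
        have h1 : r = p * (k + k) := by
          rw [mul_add]
          omega
        have h2 : r / p = k + k := by rw [h1, Nat.mul_div_cancel_left _ hp]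
        exact Nat.not_odd_iff_even.mpr ⟨k, h2⟩ (hodd.resolve_left hpo)
    refine isGelfandModel_of_finrank_eq_one _ fun m τ hτ => ?_
    obtain ⟨m', σ, hσ, f, hf⟩ := hτ.exists_injective_restrict
    rw [← finrank_intertwiningMap_reflectionModel (p := p) hn hC hσ]
    have hσ' := hσ.comp_subtype _ (exists_center_mul_mem_reflectionGroup (p := p) hgcd)
    have hτ' := hτ
    have hbij : Function.Bijective f :=
      (Representation.IsIrreducible.bijective_or_eq_zero f).resolve_right fun h0 => by
        obtain ⟨v, hv⟩ := @exists_ne _ ((Representation.isIrreducible_iff τ).mp hτ).1 0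
        exact hv (hf (by rw [h0]; rfl))
    exact Representation.finrank_intertwiningMap_congr (f.ofBijective hbij) _
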